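/- Let $d\ge 1$, let $M$ be a smooth $d$-manifold and let $[g,a]$ be a Weyl class on $M$: an equivalence class of pairs of a pseudo-Riemannian metric $g$ of signature $(p,q)$ and a one-form $a$ under $(g,a)\sim(\mathcal B^{-2}g,\ a-\mathrm d\ln\mathcal B)$, $\mathcal B>0$ smooth. Let $\pi:\mathcal P_W\to M$ be a Weyl structure, i.e. a principal $\mathbb R_+$-bundle with dilatations $\delta_s$, identified with the bundle of metrics $s^2g_x$ ($s>0$) of the conformal class; a representative $(g,a)$ then induces a trivialization $\mathcal P_W\simeq\mathbb R_+\times M$, $p\mapsto(t,x)$, in which $(t,x)$ corresponds to $t^2g_x$, and the tautological tensor is $\mathbf g_0=t^2\pi^*g$. A Weyl-ambient space $(\tilde M,\tilde g)$ for $(M,[g,a])$ is a dilatation-invariant open neighbourhood $\tilde M$ of $\mathcal P_W\times\{0\}$ in $\mathcal P_W\times\mathbb R$ with a smooth metric $\tilde g$ of signature $(p+1,q+1)$ such that $\delta_s^*\tilde g=s^2\tilde g$ for $s>0$, the pullback of $\tilde g$ to $\mathcal P_W\times\{0\}$ is $\mathbf g_0$, and $\mathrm{Ric}(\tilde g)$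 vanishes to infinite order along $\mathcal P_W\times\{0\}$. Write $\rho$ for the coordinate on $\mathbb R$, and $0,i,\infty$ for the indices of $t,x^i,\rho$. The space is in Weyl-normal form (with respect to $(g,a)$) with acceleration $\mathcal A$ if: (i) for each $p\in\mathcal P_W$ the set $\{\rho:(p,\rho)\in\tilde M\}$ is an open interval containing $0$; (ii) the curves $\rho\mapsto(p,\rho)$ have acceleration $\mathcal A=\tilde\nabla_{\partial_\rho}\partial_\rho$ with $\tilde g(t\partial_t,\mathcal A)=0$ and $\tilde g(\partial_\rho,\mathcal A)=0$; (iii) $\tilde g|_{\rho=0}=\mathbf g_0+2t^2(t^{-1}\mathrm dt+a_i(x)\mathrm dx^i)\,\mathrm d\rho$. **Theorem.** Let $(g,a)$ be any representative of the Weyl class, and let $(\tilde M,\tilde g)$ be a Weyl-ambient space for $(M,[g,a])$ in Weyl-normal form with acceleration $\mathcal A$. Then $$\tilde g = 2\rho\,\mathrm dt^2+2t^2\,\mathrm d\rho\left(\frac{\mathrm dt}{t}+a_i(x,\rho)\,\mathrm dx^i\right)+t^2g_{ij}(x,\rho)\,\mathrm dx^i\mathrm dx^j,$$ where $a_i(x,\rho)=a_i(x)+t^{-2}\int_0^\rho\mathcal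 A_i(t,x,\rho')\,\mathrm d\rho'$ is smooth and independent of $t$, and $g_{ij}(x,\rho)$ is a smooth family of symmetric tensors on $M$ with $g_{ij}(x,0)=g_{ij}(x)$, in the following sense. The components $\tilde g_{0\infty}=t$, $\tilde g_{i\infty}=t^2a_i(x,\rho)$, $\tilde g_{\infty\infty}=0$ and $\tilde g_{ij}=t^2g_{ij}(x,\rho)$ have this form on all of $\tilde M$. The components $\tilde g_{00}=2\rho$ and $\tilde g_{0i}=0$ have this form to all orders in $\rho$ at $\rho=0$ if $d$ is odd, and through order $\rho^{d/2}$ if $d$ is even. -/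

import Mathlib

open scoped Manifold ContDiff

noncomputable section

namespace WeylAmbient

/-! ### Pseudo-Riemannian geometry in coordinates -/

/-- The partial derivative `∂ᵢ f` at `z`. -/
def pderiv {n : ℕ} (i : Fin n) (f : (Fin n → ℝ) → ℝ) (z : Fin n → ℝ) : ℝ :=
  fderiv ℝ f z (Pi.single i 1)

/-- The Christoffel symbol `Γᵏᵢⱼ` of the Levi-Civita connection of the metric with component
matrix `G`. -/
def christoffel {n : ℕ} (G : (Fin n → ℝ) → Matrix (Fin n) (Fin n) ℝ) (k i j : Fin n)
    (z : Fin n → ℝ) : ℝ :=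
  (1 / 2) * ∑ l, (G z)⁻¹ k l *
    (pderiv i (fun y => G y j l) z + pderiv j (fun y => G y i l) z - pderiv l (fun y => G y i j) z)

/-- The Ricci curvature component
`Rᵢⱼ = ∂ₖΓᵏᵢⱼ - ∂ⱼΓᵏᵢₖ + ΓᵏₖₗΓˡᵢⱼ - ΓᵏⱼₗΓˡᵢₖ` of the metric with component matrix `G`. -/
def ricci {n : ℕ} (G : (Fin n → ℝ) → Matrix (Fin n) (Fin n) ℝ) (i j : Fin n)
    (z : Fin n → ℝ) : ℝ :=
  (∑ k, (pderiv k (christoffel G k i j) z - pderiv j (christoffel G k i k) z)) +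
    ∑ k, ∑ l, (christoffel G k k l z * christoffel G l i j z -
      christoffel G k j l z * christoffel G l i k z)

/-- `B` is a nondegenerate symmetric bilinear form of signature `(np, nq)`. -/
def HasSignature {V : Type*} [AddCommGroup V] [Module ℝ V] (B : LinearMap.BilinForm ℝ V)
    (np nq : ℕ) : Prop :=
  ∃ b : Module.Basis (Fin np ⊕ Fin nq) ℝ V, ∀ i j,
    B (b i) (b j) = if i = j then Sum.elim (fun _ => (1 : ℝ)) (fun _ => -1) i else 0

/-! ### Tensors on an `n`-dimensional manifold

Manifolds of dimension `n` are modelled on `Fin n → ℝ`. -/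

/-- The tangent space `T_x X` of an `n`-dimensional manifold. -/
abbrev Tan (n : ℕ) {X : Type*} [TopologicalSpace X] [ChartedSpace (Fin n → ℝ) X] (x : X) : Type :=
  TangentSpace 𝓘(ℝ, Fin n → ℝ) x

/-- The smooth charts of `X` with values in `Fin n → ℝ`. -/
abbrev Charts (n : ℕ) (X : Type*) [TopologicalSpace X] [ChartedSpace (Fin n → ℝ) X] :
    Set (OpenPartialHomeomorph X (Fin n → ℝ)) :=
  IsManifold.maximalAtlas 𝓘(ℝ, Fin n → ℝ) ∞ X

/-- The coordinate vector `∂ᵢ` of the chart `e` at the point with coordinates `y`. -/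
def coordVec {n : ℕ} {X : Type*} [TopologicalSpace X] [ChartedSpace (Fin n → ℝ) X]
    (e : OpenPartialHomeomorph X (Fin n → ℝ)) (y : Fin n → ℝ) (i : Fin n) : Tan n (e.symm y) :=
  mfderiv 𝓘(ℝ, Fin n → ℝ) 𝓘(ℝ, Fin n → ℝ) e.symm y (Pi.single i (1 : ℝ) : Fin n → ℝ)

/-- The differential `df : T_x X → ℝ` of a real function. -/
def differential {n : ℕ} {X : Type*} [TopologicalSpace X] [ChartedSpace (Fin n → ℝ) X]
    (f : X → ℝ) (x : X) : Tan n x →ₗ[ℝ] ℝ :=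
  (mfderiv 𝓘(ℝ, Fin n → ℝ) 𝓘(ℝ, ℝ) f x).toLinearMap

/-- A smooth pseudo-Riemannian metric of signature `(np, nq)` on a `d`-manifold `M`. -/
structure PseudoMetric (d : ℕ) (M : Type*) [TopologicalSpace M] [ChartedSpace (Fin d → ℝ) M]
    (np nq : ℕ) where
  form : ∀ x : M, LinearMap.BilinForm ℝ (Tan d x)
  signature : ∀ x, HasSignature (form x) np nq
  smooth : ∀ e ∈ Charts d M, ∀ i j, ContDiffOn ℝ ∞
    (fun y => form (e.symm y) (coordVec e y i) (coordVec e y j)) e.target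

/-- A smooth one-form on a `d`-manifold `M`. -/
structure OneForm (d : ℕ) (M : Type*) [TopologicalSpace M] [ChartedSpace (Fin d → ℝ) M] where
  form : ∀ x : M, Tan d x →ₗ[ℝ] ℝ
  smooth : ∀ e ∈ Charts d M, ∀ i, ContDiffOn ℝ ∞
    (fun y => form (e.symm y) (coordVec e y i)) e.target

/-! ### Weyl classes and Weyl structures -/

/-- A pair `(g, a)` of a metric and a one-form on `M`. -/
structure WeylPair (d : ℕ) (M : Type*) [TopologicalSpace M] [ChartedSpace (Fin d → ℝ) M]
    (np nq : ℕ) where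
  g : PseudoMetric d M np nq
  a : OneForm d M

/-- `(g', a') = (B⁻² g, a - d ln B)` for some smooth positive function `B` on `M`. -/
def WeylPair.Related {d : ℕ} {M : Type*} [TopologicalSpace M] [ChartedSpace (Fin d → ℝ) M]
    {np nq : ℕ} (r r' : WeylPair d M np nq) : Prop :=
  ∃ B : M → ℝ, ContMDiff 𝓘(ℝ, Fin d → ℝ) 𝓘(ℝ, ℝ) ∞ B ∧ (∀ x, 0 < B x) ∧
    (∀ x, r'.g.form x = ((B x) ^ 2)⁻¹ • r.g.form x) ∧
    ∀ x (v : Tan d x), r'.a.form x v =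
      r.a.form x v - differential (fun y => Real.log (B y)) x v

/-- A Weyl class `[g, a]` on `M`: an equivalence class of pairs `(g, a)`. -/
structure WeylClass (d : ℕ) (M : Type*) [TopologicalSpace M] [ChartedSpace (Fin d → ℝ) M]
    (np nq : ℕ) where
  reps : Set (WeylPair d M np nq)
  nonempty : reps.Nonempty
  mem_iff : ∀ r ∈ reps, ∀ r', r' ∈ reps ↔ r.Related r'

/-- A Weyl structure `P` over `(M, [g, a])`: a principal `ℝ₊`-bundle over `M`, identified with the
bundle of the metrics `s² gₓ` of the conformal class. -/
structure WeylStructure {d : ℕ} {M : Type*} [TopologicalSpace M] [ChartedSpace (Fin d → ℝ) M]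
    {np nq : ℕ} (C : WeylClass d M np nq)
    (P : Type*) [TopologicalSpace P] [ChartedSpace (Fin (d + 1) → ℝ) P] where
  /-- the projection `π` -/
  proj : P → M
  /-- the dilatation `δ_s`, meaningful for `s > 0` -/
  dil : ℝ → P → P
  dil_one : ∀ p, dil 1 p = p
  dil_mul : ∀ s s', 0 < s → 0 < s' → ∀ p, dil (s * s') p = dil s (dil s' p)
  dil_free : ∀ s, 0 < s → ∀ p, dil s p = p → s = 1
  proj_dil : ∀ s, 0 < s → ∀ p, proj (dil s p) = proj p
  /-- smooth equivariant local trivializations `π⁻¹(U) ≃ U × ℝ₊` over `U` -/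
  locally_trivial : ∀ x : M, ∃ U : Set M, IsOpen U ∧ x ∈ U ∧
    ∃ T : OpenPartialHomeomorph P (M × ℝ),
      T.source = proj ⁻¹' U ∧ T.target = U ×ˢ Set.Ioi 0 ∧
      (∀ p ∈ T.source, (T p).1 = proj p) ∧
      (∀ p ∈ T.source, ∀ s, 0 < s → (T (dil s p)).2 = s * (T p).2) ∧
      ContMDiffOn 𝓘(ℝ, Fin (d + 1) → ℝ) (𝓘(ℝ, Fin d → ℝ).prod 𝓘(ℝ, ℝ)) ∞ T T.source ∧
      ContMDiffOn (𝓘(ℝ, Fin d → ℝ).prod 𝓘(ℝ, ℝ)) 𝓘(ℝ, Fin (d + 1) → ℝ) ∞ T.symm T.target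
  /-- the point `p` corresponds to the point `(π p, metricAt p)` of the metric bundle -/
  metricAt : ∀ p, LinearMap.BilinForm ℝ (Tan d (proj p))
  /-- the fibre coordinate `t` of the trivialization of `P` induced by a representative `(g, a)`,
  in which `(x, t)` corresponds to `(x, t² gₓ)` -/
  fibre : WeylPair d M np nq → P → ℝ
  fibre_pos : ∀ r ∈ C.reps, ∀ p, 0 < fibre r p
  fibre_dil : ∀ r ∈ C.reps, ∀ s, 0 < s → ∀ p, fibre r (dil s p) = s * fibre r p
  fibre_smooth : ∀ r ∈ C.reps, ContMDiff 𝓘(ℝ, Fin (d + 1) → ℝ) 𝓘(ℝ, ℝ) ∞ (fibre r)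
  metricAt_eq : ∀ r ∈ C.reps, ∀ p, metricAt p = (fibre r p) ^ 2 • r.g.form (proj p)

section

variable {d : ℕ} {M : Type*} [TopologicalSpace M] [ChartedSpace (Fin d → ℝ) M]
  {np nq : ℕ} {C : WeylClass d M np nq}
  {P : Type*} [TopologicalSpace P] [ChartedSpace (Fin (d + 1) → ℝ) P]

/-- The push-forward `π_* : T_p P → T_{π p} M`. -/
def WeylStructure.projT (W : WeylStructure C P) (p : P) : Tan (d + 1) p →ₗ[ℝ] Tan d (W.proj p) :=
  (mfderiv 𝓘(ℝ, Fin (d + 1) → ℝ) 𝓘(ℝ, Fin d → ℝ) W.proj p).toLinearMap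

/-- The differential `dδ_s : T_p P → T_{δ_s p} P`. -/
def WeylStructure.dilT (W : WeylStructure C P) (s : ℝ) (p : P) :
    Tan (d + 1) p →ₗ[ℝ] Tan (d + 1) (W.dil s p) :=
  (mfderiv 𝓘(ℝ, Fin (d + 1) → ℝ) 𝓘(ℝ, Fin (d + 1) → ℝ) (W.dil s) p).toLinearMap

/-- The generator `T = d/ds (δ_s p)` at `s = 1` of the dilatations. -/
def WeylStructure.gen (W : WeylStructure C P) (p : P) : Tan (d + 1) p :=
  mfderiv 𝓘(ℝ, ℝ) 𝓘(ℝ, Fin (d + 1) → ℝ) (fun s => W.dil s p) 1 (1 : ℝ)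

/-- The differential `dt` of the fibre coordinate induced by the representative `r`. -/
def WeylStructure.dt (W : WeylStructure C P) (r : WeylPair d M np nq) (p : P) :
    Tan (d + 1) p →ₗ[ℝ] ℝ :=
  differential (W.fibre r) p

/-! ### Tensors on `P × ℝ`

The tangent space of `P × ℝ` at `(p, ρ)` is `T_p P × ℝ`, and `(0, 1)` is `∂_ρ`. A chart `e` of `P`
gives the chart `(p, ρ) ↦ z = (ρ, e p)` of `P × ℝ`: the index `0 : Fin (d + 2)` belongs to the
coordinate `ρ`, and the other indices to the coordinates of `P`. -/

/-- The coordinate frame of `P × ℝ` at the point with coordinates `z = (ρ, y)`. -/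
def frame (e : OpenPartialHomeomorph P (Fin (d + 1) → ℝ)) (z : Fin (d + 2) → ℝ) :
    Fin (d + 2) → Tan (d + 1) (e.symm (Fin.tail z)) × ℝ :=
  Fin.cons (0, 1) (fun i => (coordVec e (Fin.tail z) i, 0))

/-- The component matrix, in the chart `e`, of a field `G` of bilinear forms on `P × ℝ`. -/
def comps (G : ∀ (p : P) (_ : ℝ), LinearMap.BilinForm ℝ (Tan (d + 1) p × ℝ))
    (e : OpenPartialHomeomorph P (Fin (d + 1) → ℝ)) (z : Fin (d + 2) → ℝ) :
    Matrix (Fin (d + 2)) (Fin (d + 2)) ℝ :=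
  Matrix.of fun I J => G (e.symm (Fin.tail z)) (z 0) (frame e z I) (frame e z J)

/-- The coordinates of the points of `D ⊆ P × ℝ` in the chart `e`. -/
def coordDomain {n : ℕ} {X : Type*} [TopologicalSpace X]
    (e : OpenPartialHomeomorph X (Fin n → ℝ)) (D : Set (X × ℝ)) : Set (Fin (n + 1) → ℝ) :=
  {z | Fin.tail z ∈ e.target ∧ (e.symm (Fin.tail z), z 0) ∈ D}

/-- A Weyl pre-ambient space `(M̃, g̃)` for `(M, [g, a])`. -/
structure PreAmbient (W : WeylStructure C P) where
  /-- the space `M̃` -/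
  dom : Set (P × ℝ)
  isOpen_dom : IsOpen dom
  zero_mem : ∀ p, (p, (0 : ℝ)) ∈ dom
  dil_mem : ∀ s, 0 < s → ∀ p ρ, (p, ρ) ∈ dom → (W.dil s p, ρ) ∈ dom
  /-- the metric `g̃`; only its values on `M̃` matter -/
  metric : ∀ (p : P) (_ : ℝ), LinearMap.BilinForm ℝ (Tan (d + 1) p × ℝ)
  signature : ∀ p ρ, (p, ρ) ∈ dom → HasSignature (metric p ρ) (np + 1) (nq + 1)
  smooth : ∀ e ∈ Charts (d + 1) P, ∀ I J,
    ContDiffOn ℝ ∞ (fun z => comps metric e z I J) (coordDomain e dom)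
  /-- `δ_s^* g̃ = s² g̃` -/
  homogeneous : ∀ s, 0 < s → ∀ p ρ, (p, ρ) ∈ dom → ∀ w₁ w₂ : Tan (d + 1) p × ℝ,
    metric (W.dil s p) ρ (W.dilT s p w₁.1, w₁.2) (W.dilT s p w₂.1, w₂.2) =
      s ^ 2 * metric p ρ w₁ w₂
  /-- `ι^* g̃` is the tautological tensor -/
  pullback : ∀ p, ∀ w₁ w₂ : Tan (d + 1) p,
    metric p 0 (w₁, 0) (w₂, 0) = W.metricAt p (W.projT p w₁) (W.projT p w₂)

/-- The Ricci curvature of `g̃` vanishes to infinite order at every point of `P × {0}`: all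
`ρ`-derivatives of its components vanish at all points with `ρ = 0` (hence so do all mixed
derivatives). A Weyl pre-ambient space with this property is a Weyl-ambient space. -/
def PreAmbient.IsAmbient {W : WeylStructure C P} (S : PreAmbient W) : Prop :=
  ∀ e ∈ Charts (d + 1) P, ∀ y ∈ e.target, ∀ I J, ∀ m : ℕ,
    iteratedDeriv m (fun ρ : ℝ => ricci (comps S.metric e) I J (Fin.cons ρ y)) 0 = 0

/-- `(M̃, g̃)` is in Weyl-normal form, with respect to the representative `r = (g, a)`, with
acceleration the vector field `A` on `M̃`. -/
structure PreAmbient.IsWeylNormal {W : WeylStructure C P} (S : PreAmbient W)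
    (r : WeylPair d M np nq) (A : ∀ (p : P) (_ : ℝ), Tan (d + 1) p × ℝ) : Prop where
  /-- `{ρ | (p, ρ) ∈ M̃}`, which is open and contains `0`, is an interval -/
  interval : ∀ p, Set.OrdConnected {ρ : ℝ | (p, ρ) ∈ S.dom}
  /-- `A = ∇_U U` is the acceleration of the curves `ρ ↦ (p, ρ)`, where `U = ∂_ρ` -/
  acceleration : ∀ e ∈ Charts (d + 1) P, ∀ z ∈ coordDomain e S.dom,
    A (e.symm (Fin.tail z)) (z 0) = ∑ K, christoffel (comps S.metric e) K 0 0 z • frame e z K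
  /-- `g̃(T, A) = 0` -/
  orthogonal_gen : ∀ p ρ, (p, ρ) ∈ S.dom → S.metric p ρ (W.gen p, 0) (A p ρ) = 0
  /-- `g̃(U, A) = 0`: the curves are parametrized so that `A` has no `ρ`-component -/
  orthogonal_velocity : ∀ p ρ, (p, ρ) ∈ S.dom → S.metric p ρ (0, 1) (A p ρ) = 0
  /-- `g̃ = g₀ + 2 t² (t⁻¹ dt + aᵢ dxⁱ) dρ` at `ρ = 0` -/
  initial : ∀ p, ∀ w₁ w₂ : Tan (d + 1) p × ℝ, S.metric p 0 w₁ w₂ =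
    W.metricAt p (W.projT p w₁.1) (W.projT p w₂.1) +
      (W.fibre r p) ^ 2 *
        (((W.fibre r p)⁻¹ * W.dt r p w₁.1 + r.a.form (W.proj p) (W.projT p w₁.1)) * w₂.2 +
         ((W.fibre r p)⁻¹ * W.dt r p w₂.1 + r.a.form (W.proj p) (W.projT p w₂.1)) * w₁.2)

/-- The value on `w₁, w₂ ∈ T_{(p, ρ)}(P × ℝ)` of the Weyl-ambient metric
`2 ρ dt² + 2 t² dρ (dt / t + aᵢ(x, ρ) dxⁱ) + t² gᵢⱼ(x, ρ) dxⁱ dxʲ`,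
in the trivialization induced by the representative `r`. -/
def weylAmbientForm (W : WeylStructure C P) (r : WeylPair d M np nq)
    (aρ : ∀ (x : M) (_ : ℝ), Tan d x →ₗ[ℝ] ℝ)
    (gρ : ∀ (x : M) (_ : ℝ), LinearMap.BilinForm ℝ (Tan d x))
    (p : P) (ρ : ℝ) (w₁ w₂ : Tan (d + 1) p × ℝ) : ℝ :=
  2 * ρ * (W.dt r p w₁.1 * W.dt r p w₂.1) +
    (W.fibre r p) ^ 2 *
      (w₁.2 * (W.dt r p w₂.1 / W.fibre r p + aρ (W.proj p) ρ (W.projT p w₂.1)) +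
       w₂.2 * (W.dt r p w₁.1 / W.fibre r p + aρ (W.proj p) ρ (W.projT p w₁.1))) +
    (W.fibre r p) ^ 2 * gρ (W.proj p) ρ (W.projT p w₁.1) (W.projT p w₂.1)

/-- The points `(x, ρ)` of `M × ℝ` over which `M̃` lies. -/
def PreAmbient.base {W : WeylStructure C P} (S : PreAmbient W) : Set (M × ℝ) :=
  {b | ∃ p, W.proj p = b.1 ∧ (p, b.2) ∈ S.dom}

end

end WeylAmbient

end

noncomputable section

namespace WeylAmbient

/-! ### Partial derivatives of smooth functions -/

section Calculus

variable {n : ℕ} {Ω : Set (Fin n → ℝ)} {f g : (Fin n → ℝ) → ℝ} {z : Fin n → ℝ}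

/-! Everything happens in coordinates `(ρ, ln t, x)` with indices `0`, `1`, `i`, in which the
generator `T = t∂_t` of the dilatations is `∂₁` and homogeneity reads `∂₁G = 2G`.

The components with an index `∞` come from `g̃(𝒜, ∂_J) = ∂₀G_{0J} - ½ ∂_J G₀₀`. Orthogonality of `𝒜`
to `∂_ρ` makes `G₀₀` constant in `ρ`, hence zero; orthogonality to `T` then keeps `G₀₁` at its
initial value `t²`; and `G₀ᵢ` is its initial value plus the integral of `𝒜ᵢ`. On vectors killed by
`dt`, homogeneity makes `t⁻² g̃` independent of the point of the fibre, so `aᵢ(x, ρ)` and `gᵢⱼ(x,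
ρ)` live on the base (`PreAmbient.metric_horizontal`).

What remains is `φ = G₁₁ - 2ρt²` and `G₁ᵢ`. Both vanish at `ρ = 0` because the tautological tensor
annihilates `T`. Of the Ricci condition only `Ric(T, ·)` is used. Since `T` is homothetic, `∇T = id
+ E`, where `E` is half of `dT♭` with an index raised, and `Ric(T, ·)` is the divergence of the
antisymmetric tensor `E^{kp}` (`sum_ricci_hom`). Homogeneity turns the `t`-part of the divergence
into `d E^{1p}` (`divergence_vanishes`).

Suppose `φ` and `G₁ᵢ` are `O(ρ^{q+1})`. In the `∞`-component all terms except `d E^{10}` are of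
higher order, and `E^{10}` is `-½ (G^{01})² ∂_ρφ` to leading order; hence `φ = O(ρ^{q+2})`
(`phi_vanishes`). With this, the `i`-component reduces to `(q - d/2) G^{01} G^{ik} ∂_ρ G₁ₖ =
O(ρ^{q+1})`: the `q` is Euler's relation applied to `E^{0i} ≈ G^{01} G^{ik} (ρ∂_ρ - 1) G₁ₖ`, and the
`-d/2` comes from `d E^{1i}` (`tx_vanishes`). The induction is obstructed only at `2q = d`, which
gives the distinction between odd and even `d`. -/

lemma differentiableAt_of_contDiffOn (hΩ : IsOpen Ω) (hf : ContDiffOn ℝ ∞ f Ω) (hz : z ∈ Ω) :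
    DifferentiableAt ℝ f z :=
  (hf.contDiffAt (hΩ.mem_nhds hz)).differentiableAt (by simp)

lemma pderiv_contDiffOn (hΩ : IsOpen Ω) (hf : ContDiffOn ℝ ∞ f Ω) (i : Fin n) :
    ContDiffOn ℝ ∞ (pderiv i f) Ω :=
  (hf.fderiv_of_isOpen hΩ (m := ∞) (by simp)).clm_apply contDiffOn_const

lemma pderiv_congr (hΩ : IsOpen Ω) (h : ∀ z ∈ Ω, f z = g z) (hz : z ∈ Ω) (i : Fin n) :
    pderiv i f z = pderiv i g z := by
  have : f =ᶠ[nhds z] g := Filter.eventually_of_mem (hΩ.mem_nhds hz) h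
  simp only [pderiv, this.fderiv_eq]

lemma pderiv_const (c : ℝ) (i : Fin n) : pderiv i (fun _ => c) z = 0 := by
  simp [pderiv]

lemma pderiv_add (hf : DifferentiableAt ℝ f z) (hg : DifferentiableAt ℝ g z) (i : Fin n) :
    pderiv i (fun z => f z + g z) z = pderiv i f z + pderiv i g z := by
  simp only [pderiv, fderiv_fun_add hf hg, add_apply]

lemma pderiv_sub (hf : DifferentiableAt ℝ f z) (hg : DifferentiableAt ℝ g z) (i : Fin n) :
    pderiv i (fun z => f z - g z) z = pderiv i f z - pderiv i g z := by
  simp only [pderiv, fderiv_fun_sub hf hg, sub_apply]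

lemma pderiv_mul (hf : DifferentiableAt ℝ f z) (hg : DifferentiableAt ℝ g z) (i : Fin n) :
    pderiv i (fun z => f z * g z) z = pderiv i f z * g z + f z * pderiv i g z := by
  simp only [pderiv, fderiv_fun_mul hf hg, add_apply,
    smul_apply, smul_eq_mul]
  ring

lemma pderiv_const_mul (c : ℝ) (hf : DifferentiableAt ℝ f z) (i : Fin n) :
    pderiv i (fun z => c * f z) z = c * pderiv i f z := by
  rw [pderiv_mul (differentiableAt_const c) hf, pderiv_const]; ring

lemma pderiv_sum {ι : Type*} (s : Finset ι) {f : ι → (Fin n → ℝ) → ℝ}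
    (hf : ∀ k ∈ s, DifferentiableAt ℝ (f k) z) (i : Fin n) :
    pderiv i (fun z => ∑ k ∈ s, f k z) z = ∑ k ∈ s, pderiv i (f k) z := by
  simp only [pderiv, fderiv_fun_sum hf, sum_apply]

lemma pderiv_coord (i j : Fin n) : pderiv i (fun z => z j) z = if i = j then 1 else 0 := by
  have : HasFDerivAt (fun z : Fin n → ℝ => z j) (ContinuousLinearMap.proj (R := ℝ) j) z :=
    (ContinuousLinearMap.proj (R := ℝ) (φ := fun _ : Fin n => ℝ) j).hasFDerivAt
  simp [pderiv, this.fderiv, Pi.single_apply, eq_comm]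

lemma pderiv_eq_deriv (i : Fin n) (hf : DifferentiableAt ℝ f z) :
    HasDerivAt (fun s : ℝ => f (Function.update z i s)) (pderiv i f z) (z i) := by
  have h1 := hasDerivAt_update z i (z i)
  have h2 : HasFDerivAt f (fderiv ℝ f z) (Function.update z i (z i)) := by
    simpa using hf.hasFDerivAt
  exact h2.comp_hasDerivAt _ h1

lemma pderiv_comm (hΩ : IsOpen Ω) (hf : ContDiffOn ℝ ∞ f Ω) (hz : z ∈ Ω) (i j : Fin n) :
    pderiv i (pderiv j f) z = pderiv j (pderiv i f) z := by
  have h := hf.contDiffAt (hΩ.mem_nhds hz)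
  have hsymm : IsSymmSndFDerivAt ℝ f z :=
    h.isSymmSndFDerivAt (by simpa using ENat.LEInfty.out)
  have hd : DifferentiableAt ℝ (fderiv ℝ f) z :=
    (h.fderiv_right (m := ∞) (by simp)).differentiableAt (by simp)
  have key : ∀ i j, pderiv i (pderiv j f) z =
      fderiv ℝ (fderiv ℝ f) z (Pi.single i 1) (Pi.single j 1) := by
    intro i j
    change fderiv ℝ (fun y => fderiv ℝ f y (Pi.single j 1)) z (Pi.single i 1) = _
    rw [fderiv_clm_apply hd (differentiableAt_const _)]
    simp
  rw [key, key, hsymm]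

end Calculus

/-! ### Vanishing to finite order along `z 0 = 0` -/

/-- `f` is smooth on `Ω` and its derivatives `∂₀ᵏ f`, `k < m`, vanish at the points of `Ω` with
`z 0 = 0`. -/
def VanishesTo {n : ℕ} (Ω : Set (Fin (n + 1) → ℝ)) : ℕ → ((Fin (n + 1) → ℝ) → ℝ) → Prop
  | 0, f => ContDiffOn ℝ ∞ f Ω
  | m + 1, f => ContDiffOn ℝ ∞ f Ω ∧ (∀ z ∈ Ω, z 0 = 0 → f z = 0) ∧ VanishesTo Ω m (pderiv 0 f)

namespace VanishesTo

variable {n : ℕ} {Ω : Set (Fin (n + 1) → ℝ)} {f g : (Fin (n + 1) → ℝ) → ℝ} {a b m : ℕ}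

lemma smooth (h : VanishesTo Ω m f) : ContDiffOn ℝ ∞ f Ω := by
  cases m with
  | zero => exact h
  | succ m => exact h.1

lemma of_succ (h : VanishesTo Ω (m + 1) f) : VanishesTo Ω m f := by
  induction m generalizing f with
  | zero => exact h.1
  | succ m ih => exact ⟨h.1, h.2.1, ih h.2.2⟩

lemma mono (h : VanishesTo Ω a f) (hba : b ≤ a) : VanishesTo Ω b f := by
  induction a with
  | zero => obtain rfl : b = 0 := by omega
            exact h
  | succ a ih =>
    rcases Nat.lt_or_ge a b with hb | hb
    · obtain rfl : b = a + 1 := by omega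
      exact h
    · exact ih h.of_succ hb

lemma pderiv_zero (h : VanishesTo Ω (m + 1) f) : VanishesTo Ω m (pderiv 0 f) := h.2.2

lemma congr (hΩ : IsOpen Ω) (h : VanishesTo Ω m f) (hfg : ∀ z ∈ Ω, g z = f z) :
    VanishesTo Ω m g := by
  induction m generalizing f g with
  | zero => exact ContDiffOn.congr h hfg
  | succ m ih =>
    exact ⟨h.1.congr hfg, fun z hz h0 => (hfg z hz).trans (h.2.1 z hz h0),
      ih h.2.2 fun z hz => pderiv_congr hΩ hfg hz 0⟩

lemma add (hΩ : IsOpen Ω) (hf : VanishesTo Ω m f) (hg : VanishesTo Ω m g) :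
    VanishesTo Ω m (fun z => f z + g z) := by
  induction m generalizing f g with
  | zero => exact ContDiffOn.add hf hg
  | succ m ih =>
    refine ⟨hf.1.add hg.1, fun z hz h0 => by simp [hf.2.1 z hz h0, hg.2.1 z hz h0], ?_⟩
    exact (ih hf.2.2 hg.2.2).congr hΩ fun z hz => pderiv_add
      (differentiableAt_of_contDiffOn hΩ hf.1 hz) (differentiableAt_of_contDiffOn hΩ hg.1 hz) 0

lemma zero : VanishesTo Ω m (fun _ => 0) := by
  induction m with
  | zero => exact contDiffOn_const
  | succ m ih =>
    refine ⟨contDiffOn_const, fun _ _ _ => rfl, ?_⟩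
    have : pderiv (0 : Fin (n + 1)) (fun _ => (0 : ℝ)) = fun _ => 0 :=
      funext fun z => pderiv_const 0 0
    rwa [this]

/-- The product of functions vanishing to orders `a` and `b` vanishes to order `a + b`. -/
lemma mul (hΩ : IsOpen Ω) (hf : VanishesTo Ω a f) (hg : VanishesTo Ω b g) :
    VanishesTo Ω (a + b) (fun z => f z * g z) := by
  induction hm : a + b generalizing a b f g with
  | zero =>
    obtain ⟨rfl, rfl⟩ : a = 0 ∧ b = 0 := by omega
    exact ContDiffOn.mul hf hg
  | succ m ih =>
    refine ⟨hf.smooth.mul hg.smooth, fun z hz h0 => ?_, ?_⟩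
    · rcases a with _ | a
      · obtain rfl : b = m + 1 := by omega
        simp [hg.2.1 z hz h0]
      · simp [hf.2.1 z hz h0]
    · have e : ∀ z ∈ Ω, pderiv 0 (fun z => f z * g z) z =
          pderiv 0 f z * g z + f z * pderiv 0 g z := fun z hz => pderiv_mul
        (differentiableAt_of_contDiffOn hΩ hf.smooth hz)
        (differentiableAt_of_contDiffOn hΩ hg.smooth hz) 0
      refine VanishesTo.congr hΩ (VanishesTo.add hΩ ?_ ?_) e
      · rcases a with _ | a
        -- For `a = 0` the first factor has no order to lose when differentiated; one order of `g`
        -- is given up instead, and the total is still `m`.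
        · exact ih (a := 0) (b := m) (pderiv_contDiffOn hΩ hf 0) (hg.mono (by omega)) (by omega)
        · exact ih hf.2.2 hg (by omega)
      · rcases b with _ | b
        · exact ih (a := m) (b := 0) (hf.mono (by omega)) (pderiv_contDiffOn hΩ hg 0) (by omega)
        · exact ih hf hg.2.2 (by omega)

lemma mul_le (hΩ : IsOpen Ω) (hf : VanishesTo Ω a f) (hg : VanishesTo Ω b g) (hm : m ≤ a + b) :
    VanishesTo Ω m (fun z => f z * g z) := (mul hΩ hf hg).mono hm

lemma smul (hΩ : IsOpen Ω) (hg : ContDiffOn ℝ ∞ g Ω) (hf : VanishesTo Ω m f) :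
    VanishesTo Ω m (fun z => g z * f z) := mul_le (a := 0) hΩ hg hf (by omega)

lemma const_mul (hΩ : IsOpen Ω) (c : ℝ) (hf : VanishesTo Ω m f) :
    VanishesTo Ω m (fun z => c * f z) := smul hΩ contDiffOn_const hf

lemma neg (hΩ : IsOpen Ω) (hf : VanishesTo Ω m f) : VanishesTo Ω m (fun z => -f z) :=
  (const_mul hΩ (-1) hf).congr hΩ fun z _ => by ring

lemma sub (hΩ : IsOpen Ω) (hf : VanishesTo Ω m f) (hg : VanishesTo Ω m g) :
    VanishesTo Ω m (fun z => f z - g z) :=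
  (add hΩ hf (neg hΩ hg)).congr hΩ fun z _ => by ring

lemma sum (hΩ : IsOpen Ω) {ι : Type*} (s : Finset ι) {f : ι → (Fin (n + 1) → ℝ) → ℝ}
    (hf : ∀ k ∈ s, VanishesTo Ω m (f k)) : VanishesTo Ω m (fun z => ∑ k ∈ s, f k z) := by
  classical
  induction s using Finset.induction_on with
  | empty => simpa using zero
  | insert k s hk ih =>
    refine (add hΩ (hf k (by simp)) (ih fun j hj => hf j (by simp [hj]))).congr hΩ fun z _ => ?_
    rw [Finset.sum_insert hk]

/-- Derivatives in the directions tangent to `z 0 = 0` preserve the order of vanishing. -/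
lemma pderiv (hΩ : IsOpen Ω) (hf : VanishesTo Ω m f) {i : Fin (n + 1)} (hi : i ≠ 0) :
    VanishesTo Ω m (pderiv i f) := by
  induction m generalizing f with
  | zero => exact pderiv_contDiffOn hΩ hf i
  | succ m ih =>
    refine ⟨pderiv_contDiffOn hΩ hf.1 i, fun z hz h0 => ?_, ?_⟩
    -- The coordinate line in a direction `i ≠ 0` stays in `z 0 = 0`, where `f` is identically zero.
    · have h1 := pderiv_eq_deriv i (differentiableAt_of_contDiffOn hΩ hf.1 hz)
      have hc : Filter.Tendsto (fun s : ℝ => Function.update z i s) (nhds (z i)) (nhds z) := by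
        have := (continuous_const.update i continuous_id : Continuous
          (fun s : ℝ => Function.update z i s)).tendsto (z i)
        simpa using this
      have h2 : (fun s : ℝ => f (Function.update z i s)) =ᶠ[nhds (z i)] fun _ => 0 := by
        filter_upwards [hc (hΩ.mem_nhds hz)] with s hs
        exact hf.2.1 _ hs (by rw [Function.update_of_ne hi.symm]; exact h0)
      exact (h1.congr_of_eventuallyEq h2.symm).unique (hasDerivAt_const _ _)
    · exact (ih hf.2.2).congr hΩ fun z hz => pderiv_comm hΩ hf.1 hz 0 i

lemma coord_zero : VanishesTo Ω 1 (fun z => z 0) :=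
  ⟨(ContinuousLinearMap.proj (R := ℝ) (φ := fun _ : Fin (n + 1) => ℝ) 0).contDiff.contDiffOn,
    fun _ _ h => h, by
    have : WeylAmbient.pderiv (0 : Fin (n + 1)) (fun z => z 0) = fun _ => 1 := by
      funext z; rw [pderiv_coord]; simp
    rw [this]; exact contDiffOn_const⟩

/-- Euler's relation to leading order. -/
lemma euler (hΩ : IsOpen Ω) (hf : VanishesTo Ω m f) :
    VanishesTo Ω (m + 1) (fun z => z 0 * WeylAmbient.pderiv 0 f z - m * f z) := by
  induction m generalizing f with
  | zero =>
    refine (mul_le hΩ coord_zero (b := 0) (pderiv_contDiffOn hΩ hf 0) (by omega)).congr hΩ ?_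
    intro z _; simp
  | succ m ih =>
    have s0 : ContDiffOn ℝ ∞ (fun z : Fin (n + 1) → ℝ => z 0) Ω := coord_zero.smooth
    have s1 := pderiv_contDiffOn hΩ hf.1 0
    -- `∂₀(ρ f' - (m + 1) f) = ρ f'' - m f'`, which is the induction hypothesis for `f' = ∂₀f`.
    refine ⟨(s0.mul s1).sub (contDiffOn_const.mul hf.1), fun z hz h0 => by
      simp [h0, hf.2.1 z hz h0], (ih hf.2.2).congr hΩ fun z hz => ?_⟩
    have d0 := differentiableAt_of_contDiffOn hΩ s0 hz
    have d1 := differentiableAt_of_contDiffOn hΩ s1 hz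
    have df := differentiableAt_of_contDiffOn hΩ hf.1 hz
    rw [pderiv_sub (f := fun z => z 0 * WeylAmbient.pderiv 0 f z) (d0.mul d1) (df.const_mul _),
      pderiv_mul d0 d1, pderiv_const_mul _ df,
      pderiv_coord]
    push_cast
    simp; ring

/-- A smooth function on `Ω` vanishing at `z 0 = 0` vanishes to order one. -/
lemma one (hΩ : IsOpen Ω) (hf : ContDiffOn ℝ ∞ f Ω) (h : ∀ z ∈ Ω, z 0 = 0 → f z = 0) :
    VanishesTo Ω 1 f := ⟨hf, h, pderiv_contDiffOn hΩ hf 0⟩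

lemma of_pderiv_zero (hf : ContDiffOn ℝ ∞ f Ω) (h : ∀ z ∈ Ω, z 0 = 0 → f z = 0)
    (h' : VanishesTo Ω m (WeylAmbient.pderiv 0 f)) : VanishesTo Ω (m + 1) f := ⟨hf, h, h'⟩

end VanishesTo

lemma iteratedDeriv_slice_succ {n : ℕ} {Ω : Set (Fin (n + 1) → ℝ)} (hΩ : IsOpen Ω)
    {f : (Fin (n + 1) → ℝ) → ℝ} (hf : ContDiffOn ℝ ∞ f Ω) {y : Fin n → ℝ}
    (hy : (Fin.cons 0 y : Fin (n + 1) → ℝ) ∈ Ω) (m : ℕ) :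
    iteratedDeriv (m + 1) (fun ρ : ℝ => f (Fin.cons ρ y)) 0 =
      iteratedDeriv m (fun ρ : ℝ => pderiv 0 f (Fin.cons ρ y)) 0 := by
  rw [iteratedDeriv_succ']
  apply Filter.EventuallyEq.iteratedDeriv_eq
  have hc : Continuous (fun ρ : ℝ => (Fin.cons ρ y : Fin (n + 1) → ℝ)) :=
    Continuous.finCons (A := fun _ => ℝ) continuous_id continuous_const
  filter_upwards [hc.continuousAt (hΩ.mem_nhds hy)] with ρ hρ
  have h := pderiv_eq_deriv 0 (differentiableAt_of_contDiffOn hΩ hf hρ)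
  simp only [Fin.update_cons_zero, Fin.cons_zero] at h
  exact h.deriv

/-- The bridge between the recursive notion of order and the iterated `ρ`-derivatives of the
theorem: one direction feeds in the Ricci condition, the other delivers the conclusion. -/
lemma vanishesTo_iff_iteratedDeriv {n : ℕ} {Ω : Set (Fin (n + 1) → ℝ)} (hΩ : IsOpen Ω)
    {f : (Fin (n + 1) → ℝ) → ℝ} (hf : ContDiffOn ℝ ∞ f Ω) (m : ℕ) :
    VanishesTo Ω m f ↔ ∀ y : Fin n → ℝ, (Fin.cons 0 y : Fin (n + 1) → ℝ) ∈ Ω → ∀ k < m,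
      iteratedDeriv k (fun ρ : ℝ => f (Fin.cons ρ y)) 0 = 0 := by
  induction m generalizing f with
  | zero => simpa using show VanishesTo Ω 0 f from hf
  | succ m ih =>
    have h1 := ih (pderiv_contDiffOn hΩ hf 0)
    constructor
    · rintro ⟨-, h0, hd⟩ y hy k hk
      rcases k with _ | k
      · simpa using h0 _ hy (by simp)
      · rw [iteratedDeriv_slice_succ hΩ hf hy]
        exact h1.1 hd y hy k (by omega)
    · intro h
      refine ⟨hf, fun z hz h0 => ?_, h1.2 fun y hy k hk => ?_⟩
      · have e : (Fin.cons 0 (Fin.tail z) : Fin (n + 1) → ℝ) = z := by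
          rw [← h0]; exact Fin.cons_self_tail z
        simpa [e] using h (Fin.tail z) (by rwa [e]) 0 (by omega)
      · rw [← iteratedDeriv_slice_succ hΩ hf hy]
        exact h y hy (k + 1) (by omega)

/-! ### Smooth fields of metric matrices -/

/-- `G` is a smooth field of symmetric invertible matrices on the open set `Ω`. -/
structure IsMetricOn {n : ℕ} (Ω : Set (Fin n → ℝ))
    (G : (Fin n → ℝ) → Matrix (Fin n) (Fin n) ℝ) : Prop where
  isOpen : IsOpen Ω
  smooth : ∀ i j, ContDiffOn ℝ ∞ (fun z => G z i j) Ω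
  symm : ∀ z ∈ Ω, ∀ i j, G z i j = G z j i
  det_ne : ∀ z ∈ Ω, (G z).det ≠ 0

lemma contDiffOn_det {n : ℕ} {E : Type*} [NormedAddCommGroup E] [NormedSpace ℝ E] {Ω : Set E}
    {G : E → Matrix (Fin n) (Fin n) ℝ} (h : ∀ i j, ContDiffOn ℝ ∞ (fun z => G z i j) Ω) :
    ContDiffOn ℝ ∞ (fun z => (G z).det) Ω := by
  simp only [Matrix.det_apply]
  exact ContDiffOn.sum fun σ _ => (contDiffOn_prod fun i _ => h _ _).const_smul _

lemma antisymm_sum_eq_zero {ι : Type*} [Fintype ι] {f : ι → ι → ℝ} (h : ∀ i j, f i j = -f j i) :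
    ∑ i, ∑ j, f i j = 0 := by
  have h1 : ∑ i, ∑ j, f i j = -∑ i, ∑ j, f i j := by
    conv_lhs => rw [Finset.sum_comm]
    simp only [← Finset.sum_neg_distrib]
    exact Finset.sum_congr rfl fun i _ => Finset.sum_congr rfl fun j _ => h j i
  linarith

/-- The components of the differential of the one-form `G_{o l} dzˡ`. -/
def homF {n : ℕ} (G : (Fin n → ℝ) → Matrix (Fin n) (Fin n) ℝ) (o j l : Fin n) (z : Fin n → ℝ) : ℝ :=
  pderiv j (fun z => G z o l) z - pderiv l (fun z => G z o j) z

/-- Half the tensor `homF` with one index raised. -/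
def homE1 {n : ℕ} (G : (Fin n → ℝ) → Matrix (Fin n) (Fin n) ℝ) (o k j : Fin n) (z : Fin n → ℝ) : ℝ :=
  (1 / 2) * ∑ l, (G z)⁻¹ k l * homF G o j l z

/-- Half the tensor `homF` with both indices raised. -/
def homE {n : ℕ} (G : (Fin n → ℝ) → Matrix (Fin n) (Fin n) ℝ) (o k p : Fin n) (z : Fin n → ℝ) : ℝ :=
  ∑ j, homE1 G o k j z * (G z)⁻¹ j p

lemma homF_antisymm {n : ℕ} (G : (Fin n → ℝ) → Matrix (Fin n) (Fin n) ℝ) (o j l : Fin n)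
    (z : Fin n → ℝ) : homF G o j l z = -homF G o l j z := by
  unfold homF; ring

namespace IsMetricOn

variable {n : ℕ} {Ω : Set (Fin n → ℝ)} {G : (Fin n → ℝ) → Matrix (Fin n) (Fin n) ℝ}
  {z : Fin n → ℝ}

lemma diff (hG : IsMetricOn Ω G) (hz : z ∈ Ω) (i j : Fin n) :
    DifferentiableAt ℝ (fun z => G z i j) z :=
  differentiableAt_of_contDiffOn hG.isOpen (hG.smooth i j) hz

/-- Cramer's rule: the entries are polynomials in those of `G` divided by a nonvanishing
determinant. -/
lemma inv_smooth (hG : IsMetricOn Ω G) (i j : Fin n) :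
    ContDiffOn ℝ ∞ (fun z => (G z)⁻¹ i j) Ω := by
  have e : ∀ z ∈ Ω, (G z)⁻¹ i j = ((G z).det)⁻¹ * (G z).adjugate i j := fun z _ => by
    simp [Matrix.inv_def, Ring.inverse_eq_inv']
  refine ContDiffOn.congr (ContDiffOn.mul ((contDiffOn_det hG.smooth).inv hG.det_ne) ?_) e
  simp only [Matrix.adjugate_apply]
  refine contDiffOn_det fun k l => ?_
  simp only [Matrix.updateRow_apply]
  split_ifs
  · exact contDiffOn_const
  · exact hG.smooth k l

lemma inv_diff (hG : IsMetricOn Ω G) (hz : z ∈ Ω) (i j : Fin n) :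
    DifferentiableAt ℝ (fun z => (G z)⁻¹ i j) z :=
  differentiableAt_of_contDiffOn hG.isOpen (hG.inv_smooth i j) hz

lemma inv_symm (hG : IsMetricOn Ω G) (hz : z ∈ Ω) (i j : Fin n) :
    (G z)⁻¹ i j = (G z)⁻¹ j i := by
  have h : (G z).transpose = G z := Matrix.ext fun i j => hG.symm z hz j i
  conv_rhs => rw [← h, ← Matrix.transpose_nonsing_inv]
  rfl

lemma mul_inv (hG : IsMetricOn Ω G) (hz : z ∈ Ω) (i j : Fin n) :
    ∑ k, G z i k * (G z)⁻¹ k j = if i = j then 1 else 0 := by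
  have h := Matrix.mul_nonsing_inv (G z) (isUnit_iff_ne_zero.2 (hG.det_ne z hz))
  simpa [Matrix.mul_apply, Matrix.one_apply] using congrFun (congrFun h i) j

lemma inv_mul (hG : IsMetricOn Ω G) (hz : z ∈ Ω) (i j : Fin n) :
    ∑ k, (G z)⁻¹ i k * G z k j = if i = j then 1 else 0 := by
  have h := Matrix.nonsing_inv_mul (G z) (isUnit_iff_ne_zero.2 (hG.det_ne z hz))
  simpa [Matrix.mul_apply, Matrix.one_apply] using congrFun (congrFun h i) j

lemma pderiv_symm (hG : IsMetricOn Ω G) (hz : z ∈ Ω) (k i j : Fin n) :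
    pderiv k (fun z => G z i j) z = pderiv k (fun z => G z j i) z :=
  pderiv_congr hG.isOpen (fun z hz => hG.symm z hz i j) hz k

lemma christoffel_smooth (hG : IsMetricOn Ω G) (k i j : Fin n) :
    ContDiffOn ℝ ∞ (christoffel G k i j) Ω := by
  unfold christoffel
  exact contDiffOn_const.mul (ContDiffOn.sum fun l _ => (hG.inv_smooth k l).mul
    (((pderiv_contDiffOn hG.isOpen (hG.smooth _ _) _).add
      (pderiv_contDiffOn hG.isOpen (hG.smooth _ _) _)).sub
      (pderiv_contDiffOn hG.isOpen (hG.smooth _ _) _)))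

lemma ricci_smooth (hG : IsMetricOn Ω G) (i j : Fin n) :
    ContDiffOn ℝ ∞ (ricci G i j) Ω := by
  have hc := hG.christoffel_smooth
  unfold ricci
  exact (ContDiffOn.sum fun k _ => (pderiv_contDiffOn hG.isOpen (hc _ _ _) _).sub
    (pderiv_contDiffOn hG.isOpen (hc _ _ _) _)).add
    (ContDiffOn.sum fun k _ => ContDiffOn.sum fun l _ =>
      ((hc _ _ _).mul (hc _ _ _)).sub ((hc _ _ _).mul (hc _ _ _)))

lemma christoffel_comm (hG : IsMetricOn Ω G) (hz : z ∈ Ω) (k i j : Fin n) :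
    christoffel G k i j z = christoffel G k j i z := by
  unfold christoffel
  congr 1
  refine Finset.sum_congr rfl fun l _ => ?_
  rw [hG.pderiv_symm hz l i j]; ring

/-- The Christoffel symbols of the first kind. -/
lemma sum_mul_christoffel (hG : IsMetricOn Ω G) (hz : z ∈ Ω) (m i j : Fin n) :
    ∑ k, G z m k * christoffel G k i j z = (1 / 2) * (pderiv i (fun y => G y j m) z +
      pderiv j (fun y => G y i m) z - pderiv m (fun y => G y i j) z) := by
  simp only [christoffel, Finset.mul_sum]
  rw [Finset.sum_comm]
  have : ∀ l, ∑ k, G z m k * ((1 / 2) * ((G z)⁻¹ k l * (pderiv i (fun y => G y j l) z +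
      pderiv j (fun y => G y i l) z - pderiv l (fun y => G y i j) z))) =
      (if m = l then 1 else 0) * ((1 / 2) * (pderiv i (fun y => G y j l) z +
      pderiv j (fun y => G y i l) z - pderiv l (fun y => G y i j) z)) := by
    intro l
    rw [← hG.mul_inv hz, Finset.sum_mul]
    exact Finset.sum_congr rfl fun k _ => by ring
  simp only [this]
  simp

/-- Obtained by differentiating `G⁻¹ G = 1` and multiplying by `G⁻¹` on the right. -/
lemma pderiv_inv (hG : IsMetricOn Ω G) (hz : z ∈ Ω) (k a b : Fin n) :
    pderiv k (fun z => (G z)⁻¹ a b) z =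
      -∑ i, ∑ j, (G z)⁻¹ a i * pderiv k (fun z => G z i j) z * (G z)⁻¹ j b := by
  have h0 : ∀ j, ∑ i, (pderiv k (fun z => (G z)⁻¹ a i) z * G z i j +
      (G z)⁻¹ a i * pderiv k (fun z => G z i j) z) = 0 := by
    intro j
    have h1 := pderiv_congr (g := fun _ => if a = j then 1 else 0) hG.isOpen
      (fun z hz => hG.inv_mul hz a j) hz k
    rw [pderiv_const, pderiv_sum (f := fun i z => (G z)⁻¹ a i * G z i j) _
      fun i _ => (hG.inv_diff hz a i).mul (hG.diff hz i j)] at h1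
    rw [← h1]
    exact Finset.sum_congr rfl fun i _ =>
      (pderiv_mul (hG.inv_diff hz a i) (hG.diff hz i j) k).symm
  have h2 : ∑ j, (∑ i, (pderiv k (fun z => (G z)⁻¹ a i) z * G z i j +
      (G z)⁻¹ a i * pderiv k (fun z => G z i j) z)) * (G z)⁻¹ j b = 0 := by simp [h0]
  simp only [Finset.sum_add_distrib, add_mul, Finset.sum_mul] at h2
  rw [Finset.sum_comm, Finset.sum_comm (f := fun j i => (G z)⁻¹ a i * _ * _)] at h2
  have h3 : ∀ i, ∑ j, pderiv k (fun z => (G z)⁻¹ a i) z * G z i j * (G z)⁻¹ j b =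
      pderiv k (fun z => (G z)⁻¹ a i) z * if i = b then 1 else 0 := by
    intro i
    rw [← hG.mul_inv hz, Finset.mul_sum]
    exact Finset.sum_congr rfl fun j _ => by ring
  simp only [h3, mul_ite, mul_one, mul_zero, Finset.sum_ite_eq', Finset.mem_univ, if_true] at h2
  linarith

/-- The inverse metric is parallel. -/
lemma pderiv_inv_eq_christoffel (hG : IsMetricOn Ω G) (hz : z ∈ Ω) (k a b : Fin n) :
    pderiv k (fun z => (G z)⁻¹ a b) z =
      -(∑ m, christoffel G a k m z * (G z)⁻¹ m b) -
        ∑ m, christoffel G b k m z * (G z)⁻¹ a m := by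
  rw [hG.pderiv_inv hz]
  simp only [christoffel, Finset.mul_sum, Finset.sum_mul]
  conv_rhs => rw [Finset.sum_comm]
  simp only [← Finset.sum_neg_distrib, ← Finset.sum_sub_distrib]
  refine Finset.sum_congr rfl fun i _ => Finset.sum_congr rfl fun j _ => ?_
  rw [hG.inv_symm hz b j, hG.pderiv_symm hz k j i]
  ring

/-! ### Metrics with a homothetic coordinate vector field -/

lemma homF_smooth (hG : IsMetricOn Ω G) (o j l : Fin n) : ContDiffOn ℝ ∞ (homF G o j l) Ω :=
  (pderiv_contDiffOn hG.isOpen (hG.smooth _ _) _).sub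
    (pderiv_contDiffOn hG.isOpen (hG.smooth _ _) _)

lemma homE1_smooth (hG : IsMetricOn Ω G) (o k j : Fin n) : ContDiffOn ℝ ∞ (homE1 G o k j) Ω :=
  contDiffOn_const.mul (ContDiffOn.sum fun l _ => (hG.inv_smooth k l).mul (hG.homF_smooth o j l))

lemma homE_smooth (hG : IsMetricOn Ω G) (o k p : Fin n) : ContDiffOn ℝ ∞ (homE G o k p) Ω :=
  ContDiffOn.sum fun j _ => (hG.homE1_smooth o k j).mul (hG.inv_smooth j p)

lemma homE_eq (hG : IsMetricOn Ω G) (hz : z ∈ Ω) (o k p : Fin n) :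
    homE G o k p z = (1 / 2) * ∑ l, ∑ m, (G z)⁻¹ k l * (G z)⁻¹ p m * homF G o m l z := by
  simp only [homE, homE1, Finset.mul_sum, Finset.sum_mul]
  rw [Finset.sum_comm]
  refine Finset.sum_congr rfl fun l _ => Finset.sum_congr rfl fun m _ => ?_
  rw [hG.inv_symm hz p m]; ring

lemma homE_antisymm (hG : IsMetricOn Ω G) (hz : z ∈ Ω) (o k p : Fin n) :
    homE G o k p z = -homE G o p k z := by
  rw [hG.homE_eq hz, hG.homE_eq hz, Finset.sum_comm, ← mul_neg, ← Finset.sum_neg_distrib]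
  congr 1
  refine Finset.sum_congr rfl fun l _ => ?_
  rw [← Finset.sum_neg_distrib]
  refine Finset.sum_congr rfl fun m _ => ?_
  rw [homF_antisymm]; ring

/-- The trace pairs the symmetric `G⁻¹` with the antisymmetric `homF`. -/
lemma sum_homE1 (hG : IsMetricOn Ω G) (hz : z ∈ Ω) (o : Fin n) :
    ∑ k, homE1 G o k k z = 0 := by
  simp only [homE1, Finset.mul_sum]
  refine antisymm_sum_eq_zero fun i j => ?_
  rw [hG.inv_symm hz i j, homF_antisymm]; ring

variable {o : Fin n}

/-- This is `∇T = id + E` for `T = ∂ₒ`: homothety fixes the symmetric part of `∇T`, and the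
antisymmetric part is half the differential of `T♭`. -/
lemma christoffel_hom (hG : IsMetricOn Ω G)
    (ho : ∀ z ∈ Ω, ∀ i j, pderiv o (fun z => G z i j) z = 2 * G z i j) (hz : z ∈ Ω)
    (k j : Fin n) :
    christoffel G k o j z = (if k = j then 1 else 0) + homE1 G o k j z := by
  have h : ∑ l, (G z)⁻¹ k l * G z j l = if k = j then 1 else 0 := by
    rw [← hG.inv_mul hz]
    exact Finset.sum_congr rfl fun l _ => by rw [hG.symm z hz j l]
  rw [← h]
  simp only [christoffel, homE1, homF, Finset.mul_sum, ← Finset.sum_add_distrib]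
  refine Finset.sum_congr rfl fun l _ => ?_
  rw [ho z hz]; ring

lemma sum_christoffel_hom (hG : IsMetricOn Ω G)
    (ho : ∀ z ∈ Ω, ∀ i j, pderiv o (fun z => G z i j) z = 2 * G z i j) (hz : z ∈ Ω) :
    ∑ k, christoffel G k k o z = n := by
  have : ∀ k, christoffel G k k o z = 1 + homE1 G o k k z := fun k => by
    rw [hG.christoffel_comm hz, hG.christoffel_hom ho hz]; simp
  simp [this, Finset.sum_add_distrib, hG.sum_homE1 hz]

/-- Inserting `∇T = id + E` in the Ricci tensor, the identity contributes `Γᵏₖⱼ - Γᵏⱼₖ = 0`, and the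
derivative of the trace of `E` drops out since that trace is zero. -/
lemma ricci_hom (hG : IsMetricOn Ω G)
    (ho : ∀ z ∈ Ω, ∀ i j, pderiv o (fun z => G z i j) z = 2 * G z i j) (hz : z ∈ Ω)
    (j : Fin n) :
    ricci G o j z = ∑ k, pderiv k (homE1 G o k j) z +
      ∑ k, ∑ l, (christoffel G k k l z * homE1 G o l j z -
        christoffel G k j l z * homE1 G o l k z) := by
  have hd : ∀ k m i, pderiv i (christoffel G k o m) z = pderiv i (homE1 G o k m) z := by
    intro k m i
    rw [pderiv_congr hG.isOpen (fun z hz => hG.christoffel_hom ho hz k m) hz,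
      pderiv_add (differentiableAt_const _)
        (differentiableAt_of_contDiffOn hG.isOpen (hG.homE1_smooth o k m) hz), pderiv_const,
      zero_add]
  have ht : ∑ k, pderiv j (homE1 G o k k) z = 0 := by
    rw [← pderiv_sum _ fun k _ =>
      differentiableAt_of_contDiffOn hG.isOpen (hG.homE1_smooth o k k) hz,
      pderiv_congr hG.isOpen (fun z hz => hG.sum_homE1 hz o) hz, pderiv_const]
  have hdelta : ∑ k, ∑ l, (christoffel G k k l z * (if l = j then 1 else 0) -
      christoffel G k j l z * (if l = k then 1 else 0)) = 0 := by
    simp [Finset.sum_sub_distrib, hG.christoffel_comm hz _ j]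
  simp only [ricci, hd, Finset.sum_sub_distrib, ht, sub_zero]
  simp only [← Finset.sum_sub_distrib, hG.christoffel_hom ho hz]
  have hsum : ∑ k, ∑ l, (christoffel G k k l z * ((if l = j then 1 else 0) + homE1 G o l j z) -
      christoffel G k j l z * ((if l = k then 1 else 0) + homE1 G o l k z)) =
      ∑ k, ∑ l, (christoffel G k k l z * homE1 G o l j z -
        christoffel G k j l z * homE1 G o l k z) +
      ∑ k, ∑ l, (christoffel G k k l z * (if l = j then 1 else 0) -
      christoffel G k j l z * (if l = k then 1 else 0)) := by
    simp only [← Finset.sum_add_distrib]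
    exact Finset.sum_congr rfl fun k _ => Finset.sum_congr rfl fun l _ => by ring
  rw [hsum, hdelta, add_zero]

/-- The Ricci curvature in the direction of a homothetic field is a divergence. -/
lemma sum_ricci_hom (hG : IsMetricOn Ω G)
    (ho : ∀ z ∈ Ω, ∀ i j, pderiv o (fun z => G z i j) z = 2 * G z i j) (hz : z ∈ Ω)
    (p : Fin n) :
    ∑ j, ricci G o j z * (G z)⁻¹ j p = ∑ k, pderiv k (homE G o k p) z +
      ∑ k, ∑ l, christoffel G k k l z * homE G o l p z := by
  have dE : ∀ k j, DifferentiableAt ℝ (homE1 G o k j) z := fun k j =>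
    differentiableAt_of_contDiffOn hG.isOpen (hG.homE1_smooth o k j) hz
  -- The product rule, with the derivative of `G⁻¹` written through Christoffel symbols. After
  -- summation over `k` the last term pairs symmetric lower indices with the antisymmetric `homE`
  -- and disappears (`h2`), while the middle one is the second quadratic term of `ricci_hom` (`h4`).
  have h1 : ∀ k, pderiv k (homE G o k p) z =
      ∑ j, (pderiv k (homE1 G o k j) z * (G z)⁻¹ j p -
        ∑ m, homE1 G o k j z * christoffel G j k m z * (G z)⁻¹ m p) -
        ∑ m, christoffel G p k m z * homE G o k m z := by
    intro k
    have e1 : pderiv k (homE G o k p) z =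
        ∑ j, pderiv k (fun z => homE1 G o k j z * (G z)⁻¹ j p) z :=
      pderiv_sum Finset.univ (fun j _ => (dE k j).mul (hG.inv_diff hz j p)) k
    have e2 : ∑ m, christoffel G p k m z * homE G o k m z =
        ∑ j, ∑ m, homE1 G o k j z * (christoffel G p k m z * (G z)⁻¹ j m) := by
      simp only [homE, Finset.mul_sum]
      rw [Finset.sum_comm]
      exact Finset.sum_congr rfl fun j _ => Finset.sum_congr rfl fun m _ => by ring
    rw [e1, e2, ← Finset.sum_sub_distrib]
    refine Finset.sum_congr rfl fun j _ => ?_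
    rw [pderiv_mul (dE k j) (hG.inv_diff hz j p), hG.pderiv_inv_eq_christoffel hz, mul_sub,
      mul_neg, Finset.mul_sum, Finset.mul_sum]
    have : ∀ m, homE1 G o k j z * christoffel G j k m z * (G z)⁻¹ m p =
      homE1 G o k j z * (christoffel G j k m z * (G z)⁻¹ m p) := fun m => by ring
    simp only [this]
    ring
  have h2 : ∑ k, ∑ m, christoffel G p k m z * homE G o k m z = 0 :=
    antisymm_sum_eq_zero fun i j => by
      rw [hG.christoffel_comm hz, hG.homE_antisymm hz o i j]; ring
  have h3 : ∑ k, ∑ l, christoffel G k k l z * homE G o l p z =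
      ∑ j, (∑ k, ∑ l, christoffel G k k l z * homE1 G o l j z) * (G z)⁻¹ j p := by
    simp only [homE, Finset.mul_sum, Finset.sum_mul]
    have : ∀ k, ∑ l, ∑ j, christoffel G k k l z * (homE1 G o l j z * (G z)⁻¹ j p) =
        ∑ j, ∑ l, christoffel G k k l z * homE1 G o l j z * (G z)⁻¹ j p := fun k => by
      rw [Finset.sum_comm]
      exact Finset.sum_congr rfl fun j _ => Finset.sum_congr rfl fun l _ => by ring
    simp only [this]
    rw [Finset.sum_comm]
  have h4 : ∑ k, ∑ j, ∑ m, homE1 G o k j z * christoffel G j k m z * (G z)⁻¹ m p =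
      ∑ j, (∑ k, ∑ l, christoffel G k j l z * homE1 G o l k z) * (G z)⁻¹ j p := by
    simp only [Finset.sum_mul]
    have : ∀ k, ∑ j, ∑ m, homE1 G o k j z * christoffel G j k m z * (G z)⁻¹ m p =
        ∑ m, ∑ j, christoffel G j m k z * homE1 G o k j z * (G z)⁻¹ m p := fun k => by
      rw [Finset.sum_comm]
      exact Finset.sum_congr rfl fun m _ => Finset.sum_congr rfl fun j _ => by
        rw [hG.christoffel_comm hz j k m]; ring
    simp only [this]
    rw [Finset.sum_comm]
    exact Finset.sum_congr rfl fun j _ => Finset.sum_comm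
  simp only [h1, Finset.sum_sub_distrib, h2, h3, h4, hG.ricci_hom ho hz, add_mul, sub_mul,
    Finset.sum_add_distrib, Finset.sum_mul]
  rw [Finset.sum_comm (f := fun j k => pderiv k (homE1 G o k j) z * _)]
  ring

lemma pderiv_inv_hom (hG : IsMetricOn Ω G)
    (ho : ∀ z ∈ Ω, ∀ i j, pderiv o (fun z => G z i j) z = 2 * G z i j) (hz : z ∈ Ω)
    (a b : Fin n) : pderiv o (fun z => (G z)⁻¹ a b) z = -2 * (G z)⁻¹ a b := by
  rw [hG.pderiv_inv hz]
  have : ∀ j, ∑ i, (G z)⁻¹ a i * pderiv o (fun z => G z i j) z * (G z)⁻¹ j b =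
      2 * ((if a = j then 1 else 0) * (G z)⁻¹ j b) := fun j => by
    rw [← hG.inv_mul hz, Finset.sum_mul, Finset.mul_sum]
    exact Finset.sum_congr rfl fun i _ => by rw [ho z hz]; ring
  rw [Finset.sum_comm]
  simp [this]

lemma pderiv_homF_hom (hG : IsMetricOn Ω G)
    (ho : ∀ z ∈ Ω, ∀ i j, pderiv o (fun z => G z i j) z = 2 * G z i j) (hz : z ∈ Ω)
    (j l : Fin n) : pderiv o (homF G o j l) z = 2 * homF G o j l z := by
  have dP : ∀ i a b, DifferentiableAt ℝ (pderiv i fun z => G z a b) z := fun i a b =>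
    differentiableAt_of_contDiffOn hG.isOpen (pderiv_contDiffOn hG.isOpen (hG.smooth a b) i) hz
  have h : ∀ i a b, pderiv o (pderiv i fun z => G z a b) z = 2 * pderiv i (fun z => G z a b) z := by
    intro i a b
    rw [pderiv_comm hG.isOpen (hG.smooth a b) hz,
      pderiv_congr hG.isOpen (fun z hz => ho z hz a b) hz, pderiv_const_mul _ (hG.diff hz a b)]
  change pderiv o (fun z => pderiv j (fun z => G z o l) z - pderiv l (fun z => G z o j) z) z = _
  rw [pderiv_sub (dP _ _ _) (dP _ _ _), h, h, homF]
  ring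

/-- A count of degrees: two inverse metrics of degree `-2` and one `homF` of degree `2`. -/
lemma pderiv_homE_hom (hG : IsMetricOn Ω G)
    (ho : ∀ z ∈ Ω, ∀ i j, pderiv o (fun z => G z i j) z = 2 * G z i j) (hz : z ∈ Ω)
    (k p : Fin n) : pderiv o (homE G o k p) z = -2 * homE G o k p z := by
  have dF : ∀ m l, DifferentiableAt ℝ (homF G o m l) z := fun m l =>
    differentiableAt_of_contDiffOn hG.isOpen (hG.homF_smooth o m l) hz
  have dt : ∀ l m, DifferentiableAt ℝ
      (fun z => (G z)⁻¹ k l * (G z)⁻¹ p m * homF G o m l z) z := fun l m =>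
    ((hG.inv_diff hz k l).mul (hG.inv_diff hz p m)).mul (dF m l)
  have ds : ∀ l, DifferentiableAt ℝ
      (fun z => ∑ m, (G z)⁻¹ k l * (G z)⁻¹ p m * homF G o m l z) z := fun l =>
    DifferentiableAt.fun_sum fun m _ => dt l m
  rw [pderiv_congr hG.isOpen (fun z hz => hG.homE_eq hz o k p) hz,
    pderiv_const_mul _ (DifferentiableAt.fun_sum fun l _ => ds l), pderiv_sum _ fun l _ => ds l,
    hG.homE_eq hz]
  simp only [Finset.mul_sum]
  refine Finset.sum_congr rfl fun l _ => ?_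
  rw [pderiv_sum _ fun m _ => dt l m, Finset.mul_sum]
  refine Finset.sum_congr rfl fun m _ => ?_
  rw [pderiv_mul (f := fun z => (G z)⁻¹ k l * (G z)⁻¹ p m)
    ((hG.inv_diff hz k l).mul (hG.inv_diff hz p m)) (dF m l),
    pderiv_mul (hG.inv_diff hz k l) (hG.inv_diff hz p m), hG.pderiv_inv_hom ho hz,
    hG.pderiv_inv_hom ho hz, hG.pderiv_homF_hom ho hz]
  ring

end IsMetricOn

/-! ### The equation `Ric(T, ·) = 0` for a metric in normal form, order by order in `ρ` -/

lemma VanishesTo.of_smul {n : ℕ} {Ω : Set (Fin (n + 1) → ℝ)} {f w : (Fin (n + 1) → ℝ) → ℝ}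
    {m : ℕ} (hΩ : IsOpen Ω) (hw : ContDiffOn ℝ ∞ w Ω) (h0 : ∀ z ∈ Ω, w z ≠ 0)
    (h : VanishesTo Ω m (fun z => w z * f z)) : VanishesTo Ω m f :=
  (VanishesTo.smul hΩ (hw.inv h0) h).congr hΩ fun z hz => by
    rw [Pi.inv_apply, inv_mul_cancel_left₀ (h0 z hz)]

/-- A smooth field of metric matrices in coordinates `(ρ, ln t, x)` that is homogeneous of degree
two in `t`, and whose components `G_{∞∞}`, `G_{0∞}` and initial values are those of a metric in
Weyl-normal form. -/
structure IsNormalMetricOn {d : ℕ} (Ω : Set (Fin (d + 2) → ℝ))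
    (G : (Fin (d + 2) → ℝ) → Matrix (Fin (d + 2)) (Fin (d + 2)) ℝ) : Prop
    extends IsMetricOn Ω G where
  hom : ∀ z ∈ Ω, ∀ i j, pderiv 1 (fun z => G z i j) z = 2 * G z i j
  rt : ∀ z ∈ Ω, ∀ i, i ≠ 1 → pderiv i (fun z => G z 0 1) z = 0
  rt_ne : ∀ z ∈ Ω, G z 0 1 ≠ 0
  tt_init : ∀ z ∈ Ω, z 0 = 0 → G z 1 1 = 0
  tx_init : ∀ z ∈ Ω, z 0 = 0 → ∀ k : Fin d, G z 1 k.succ.succ = 0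

lemma sum_univ_split {d : ℕ} (f : Fin (d + 2) → ℝ) :
    ∑ k, f k = f 0 + f 1 + ∑ i : Fin d, f i.succ.succ := by
  simp [Fin.sum_univ_succ, add_assoc]

namespace IsNormalMetricOn

variable {d : ℕ} {Ω : Set (Fin (d + 2) → ℝ)}
  {G : (Fin (d + 2) → ℝ) → Matrix (Fin (d + 2)) (Fin (d + 2)) ℝ} {z : Fin (d + 2) → ℝ} {q : ℕ}

/-- The deviation of `G₀₀` from `2 ρ dt²`. -/
def phi (G : (Fin (d + 2) → ℝ) → Matrix (Fin (d + 2)) (Fin (d + 2)) ℝ) (z : Fin (d + 2) → ℝ) : ℝ :=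
  G z 1 1 - 2 * (z 0 * G z 0 1)

lemma succ_ne_one (k : Fin d) : k.succ.succ ≠ 1 := fun h =>
  Fin.succ_ne_zero k (Fin.succ_injective _ h)

lemma coord_smooth : ContDiffOn ℝ ∞ (fun z : Fin (d + 2) → ℝ => z 0) Ω :=
  VanishesTo.coord_zero.smooth

lemma phi_smooth (hG : IsNormalMetricOn Ω G) : ContDiffOn ℝ ∞ (phi G) Ω :=
  (hG.smooth 1 1).sub (contDiffOn_const.mul (coord_smooth.mul (hG.smooth 0 1)))

lemma pderiv_tt (hG : IsNormalMetricOn Ω G) (hz : z ∈ Ω) {i : Fin (d + 2)} (hi : i ≠ 1) :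
    pderiv i (fun z => G z 1 1) z =
      pderiv i (phi G) z + if i = 0 then 2 * G z 0 1 else 0 := by
  have dz := differentiableAt_of_contDiffOn hG.isOpen coord_smooth hz
  have h : pderiv i (phi G) z = pderiv i (fun z => G z 1 1) z -
      pderiv i (fun z => 2 * (z 0 * G z 0 1)) z :=
    pderiv_sub (hG.diff hz 1 1) ((dz.mul (hG.diff hz 0 1)).const_mul 2) i
  rw [h, pderiv_const_mul (f := fun z => z 0 * G z 0 1) 2 (dz.mul (hG.diff hz 0 1)),
    pderiv_mul dz (hG.diff hz 0 1), hG.rt z hz i hi, pderiv_coord]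
  split_ifs <;> ring

/-- At `ρ = 0` the row `G₁ₐ` has the single nonzero entry `G₁₀`, so `G G⁻¹ = 1` determines the row
`G^{0a}` of the inverse. -/
lemma inv_init (hG : IsNormalMetricOn Ω G) (hz : z ∈ Ω) (h0 : z 0 = 0) (a : Fin (d + 2)) :
    G z 0 1 * (G z)⁻¹ 0 a = if (1 : Fin (d + 2)) = a then 1 else 0 := by
  rw [← hG.mul_inv hz, sum_univ_split]
  have h1 : G z 1 0 = G z 0 1 := hG.symm z hz 1 0
  have h2 : G z 1 1 = 0 := hG.tt_init z hz h0
  simp [h1, h2, hG.tx_init z hz h0]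

lemma inv_vanishes (hG : IsNormalMetricOn Ω G) {a : Fin (d + 2)} (ha : a ≠ 1) :
    VanishesTo Ω 1 (fun z => (G z)⁻¹ 0 a) :=
  .one hG.isOpen (hG.inv_smooth 0 a) fun z hz h0 => by
    have h := hG.inv_init hz h0 a
    rw [if_neg ha.symm] at h
    exact (mul_eq_zero.1 h).resolve_left (hG.rt_ne z hz)

lemma inv_vanishes' (hG : IsNormalMetricOn Ω G) {a : Fin (d + 2)} (ha : a ≠ 1) :
    VanishesTo Ω 1 (fun z => (G z)⁻¹ a 0) :=
  (hG.inv_vanishes ha).congr hG.isOpen fun _ hz => hG.inv_symm hz a 0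

lemma inv_one_vanishes (hG : IsNormalMetricOn Ω G) :
    VanishesTo Ω 1 (fun z => G z 0 1 * (G z)⁻¹ 0 1 - 1) :=
  .one hG.isOpen (((hG.smooth 0 1).mul (hG.inv_smooth 0 1)).sub contDiffOn_const)
    fun z hz h0 => by rw [hG.inv_init hz h0]; simp

/-- A factor `G^{01}` may be cancelled. -/
lemma of_inv_mul (hG : IsNormalMetricOn Ω G) {f : (Fin (d + 2) → ℝ) → ℝ}
    (hf : VanishesTo Ω q f) (h : VanishesTo Ω (q + 1) (fun z => (G z)⁻¹ 0 1 * f z)) :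
    VanishesTo Ω (q + 1) f :=
  -- `G^{01}` need not be invertible away from `ρ = 0`, so it is not divided out: `f = G₀₁ G^{01} f
  -- - (G₀₁ G^{01} - 1) f`, where the bracket is `O(ρ)` and `f` is already `O(ρ^q)`.
  (VanishesTo.sub hG.isOpen (VanishesTo.smul hG.isOpen (hG.smooth 0 1) h)
    (VanishesTo.mul_le hG.isOpen hG.inv_one_vanishes hf (by omega))).congr hG.isOpen
    fun z _ => by ring

lemma homF_zero_x (hG : IsNormalMetricOn Ω G) (hz : z ∈ Ω) (k : Fin d) :
    homF G 1 k.succ.succ 0 z = -pderiv 0 (fun z => G z 1 k.succ.succ) z := by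
  have h : pderiv k.succ.succ (fun z => G z 1 0) z = 0 := by
    rw [hG.pderiv_symm hz, hG.rt z hz _ (succ_ne_one k)]
  rw [homF, h]; ring

/-- The term `2ρ dt²` subtracted in `phi` is the one that makes `T♭ = d(ρt²)` closed, so only `phi`
survives in this component of `dT♭`. -/
lemma homF_one_zero (hG : IsNormalMetricOn Ω G) (hz : z ∈ Ω) :
    homF G 1 1 0 z = -pderiv 0 (phi G) z := by
  have h : pderiv 1 (fun z => G z 1 0) z = 2 * G z 0 1 := by
    rw [hG.pderiv_symm hz, hG.hom z hz]
  rw [homF, h, hG.pderiv_tt hz (by simp)]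
  simp

lemma homF_x_one (hG : IsNormalMetricOn Ω G) (hz : z ∈ Ω) (k : Fin d) :
    homF G 1 k.succ.succ 1 z =
      pderiv k.succ.succ (phi G) z - 2 * G z 1 k.succ.succ := by
  rw [homF, hG.hom z hz, hG.pderiv_tt hz (succ_ne_one k)]
  simp

/-- The components `G₀₀` and `G₀ᵢ` have their normal form through order `ρ^q`. -/
structure NormalTo (Ω : Set (Fin (d + 2) → ℝ))
    (G : (Fin (d + 2) → ℝ) → Matrix (Fin (d + 2)) (Fin (d + 2)) ℝ) (q : ℕ) : Prop where
  tt : VanishesTo Ω (q + 1) (phi G)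
  tx : ∀ k : Fin d, VanishesTo Ω (q + 1) (fun z => G z 1 k.succ.succ)

lemma normalTo_zero (hG : IsNormalMetricOn Ω G) : NormalTo Ω G 0 where
  tt := .one hG.isOpen hG.phi_smooth fun z hz h0 => by simp [phi, hG.tt_init z hz h0, h0]
  tx k := .one hG.isOpen (hG.smooth _ _) fun z hz h0 => hG.tx_init z hz h0 k

/-- Without an index `0` only derivatives tangent to `ρ = 0` and undifferentiated terms occur, and
no order is lost. An index `0` brings in `∂₀` and costs one order, as in `homF_vanishes`. -/
lemma homF_vanishes_of_ne (hG : IsNormalMetricOn Ω G) (h : NormalTo Ω G q)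
    {m l : Fin (d + 2)} (hm : m ≠ 0) (hl : l ≠ 0) : VanishesTo Ω (q + 1) (homF G 1 m l) := by
  have hx1 : ∀ k : Fin d, VanishesTo Ω (q + 1) (homF G 1 k.succ.succ 1) := fun k =>
    (VanishesTo.sub hG.isOpen (VanishesTo.pderiv hG.isOpen h.tt (Fin.succ_ne_zero _))
      (VanishesTo.const_mul hG.isOpen 2 (h.tx k))).congr hG.isOpen fun z hz => hG.homF_x_one hz k
  have anti : ∀ m l, VanishesTo Ω (q + 1) (homF G 1 m l) → VanishesTo Ω (q + 1) (homF G 1 l m) :=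
    fun m l h => (VanishesTo.neg hG.isOpen h).congr hG.isOpen fun z _ =>
      homF_antisymm G 1 l m z
  obtain ⟨m, rfl⟩ := Fin.exists_succ_eq.2 hm
  obtain ⟨l, rfl⟩ := Fin.exists_succ_eq.2 hl
  refine Fin.cases ?_ (fun m => ?_) m <;> refine Fin.cases ?_ (fun l => ?_) l
  · exact VanishesTo.zero.congr hG.isOpen fun z _ => by simp [homF]
  · exact anti _ _ (hx1 l)
  · exact hx1 m
  · exact VanishesTo.sub hG.isOpen (VanishesTo.pderiv hG.isOpen (h.tx l) (Fin.succ_ne_zero _))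
      (VanishesTo.pderiv hG.isOpen (h.tx m) (Fin.succ_ne_zero _))

lemma homF_vanishes (hG : IsNormalMetricOn Ω G) (h : NormalTo Ω G q)
    (m l : Fin (d + 2)) : VanishesTo Ω q (homF G 1 m l) := by
  have hx : ∀ m : Fin (d + 1), VanishesTo Ω q (homF G 1 m.succ 0) := fun m => by
    refine Fin.cases ?_ (fun k => ?_) m
    · exact (VanishesTo.neg hG.isOpen h.tt.pderiv_zero).congr hG.isOpen
        fun z hz => hG.homF_one_zero hz
    · exact (VanishesTo.neg hG.isOpen (h.tx k).pderiv_zero).congr hG.isOpen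
        fun z hz => hG.homF_zero_x hz k
  by_cases hm : m = 0 <;> by_cases hl : l = 0
  · subst hm hl
    exact VanishesTo.zero.congr hG.isOpen fun z _ => by simp [homF]
  · obtain ⟨l, rfl⟩ := Fin.exists_succ_eq.2 hl
    subst hm
    exact (VanishesTo.neg hG.isOpen (hx l)).congr hG.isOpen fun z _ =>
      homF_antisymm G 1 0 l.succ z
  · obtain ⟨m, rfl⟩ := Fin.exists_succ_eq.2 hm
    subst hl
    exact hx m
  · exact (hG.homF_vanishes_of_ne h hm hl).of_succ

/-- Comparison of `homE` with a double sum, term by term. -/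
lemma homE_sub_vanishes (hG : IsNormalMetricOn Ω G) {m : ℕ} (k p : Fin (d + 2))
    {c : Fin (d + 2) → Fin (d + 2) → (Fin (d + 2) → ℝ) → ℝ}
    (h : ∀ l j, VanishesTo Ω m
      (fun z => (G z)⁻¹ k l * (G z)⁻¹ p j * homF G 1 j l z - c l j z)) :
    VanishesTo Ω m (fun z => homE G 1 k p z - (1 / 2) * ∑ l, ∑ j, c l j z) :=
  (VanishesTo.const_mul hG.isOpen (1 / 2) (VanishesTo.sum hG.isOpen Finset.univ fun l _ =>
    VanishesTo.sum hG.isOpen Finset.univ fun j _ => h l j)).congr hG.isOpen fun z hz => by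
      simp only [hG.homE_eq hz, Finset.sum_sub_distrib]
      ring

/-- Three-fold products. -/
lemma term_vanishes (hG : IsNormalMetricOn Ω G) {a b c m : ℕ}
    {f₁ f₂ f₃ : (Fin (d + 2) → ℝ) → ℝ} (h₁ : VanishesTo Ω a f₁) (h₂ : VanishesTo Ω b f₂)
    (h₃ : VanishesTo Ω c f₃) (hm : m ≤ a + b + c) :
    VanishesTo Ω m (fun z => f₁ z * f₂ z * f₃ z) :=
  VanishesTo.mul_le hG.isOpen (VanishesTo.mul hG.isOpen h₁ h₂) h₃ hm

lemma inv_zero (hG : IsNormalMetricOn Ω G) (k l : Fin (d + 2)) :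
    VanishesTo Ω 0 (fun z => (G z)⁻¹ k l) := hG.inv_smooth k l

/-- Each term `G^{pl} G^{0j} F_{jl}` gains an order over `F = O(ρ^q)`: from `G^{0j}` if `j ≠ 1`,
from `G^{p0}` if `j = 1` and `l = 0`, and otherwise from an `F` without index `0`. -/
lemma homE_zero_vanishes (hG : IsNormalMetricOn Ω G) (h : NormalTo Ω G q)
    {p : Fin (d + 2)} (hp : p ≠ 1) : VanishesTo Ω (q + 1) (homE G 1 p 0) := by
  refine (hG.homE_sub_vanishes (c := fun _ _ _ => 0) p 0 fun l j => ?_).congr hG.isOpen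
    fun z _ => by simp
  simp only [sub_zero]
  by_cases hj : j = 1
  · subst hj
    by_cases hl : l = 0
    · subst hl
      exact hG.term_vanishes (hG.inv_vanishes' hp) (hG.inv_zero _ _) (hG.homF_vanishes h _ _)
        (by omega)
    · exact hG.term_vanishes (hG.inv_zero _ _) (hG.inv_zero _ _)
        (hG.homF_vanishes_of_ne h (by simp) hl) (by omega)
  · exact hG.term_vanishes (hG.inv_zero _ _) (hG.inv_vanishes hj) (hG.homF_vanishes h _ _)
      (by omega)

/-- Only the term `l = 0`, `j = 1` has neither a factor `G^{0j}` that vanishes at `ρ = 0` nor an `F`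
without index `0`; it is therefore the only one of order `ρ^q`. -/
lemma homE_one_zero (hG : IsNormalMetricOn Ω G) (h : NormalTo Ω G q) :
    VanishesTo Ω (q + 1) (fun z => homE G 1 1 0 z +
      (1 / 2) * ((G z)⁻¹ 0 1 * ((G z)⁻¹ 0 1 * pderiv 0 (phi G) z))) := by
  refine (hG.homE_sub_vanishes 1 0 (m := q + 1) (c := fun l j z => if l = 0 then if j = 1 then
    (G z)⁻¹ 1 0 * (G z)⁻¹ 0 1 * homF G 1 1 0 z else 0 else 0) fun l j => ?_).congr hG.isOpen ?_
  · by_cases hj : j = 1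
    · subst hj
      by_cases hl : l = 0
      · subst hl
        simpa using VanishesTo.zero
      · simp only [hl, if_false, sub_zero]
        exact hG.term_vanishes (hG.inv_zero _ _) (hG.inv_zero _ _)
          (hG.homF_vanishes_of_ne h (by simp) hl) (by omega)
    · simp only [hj, if_false, ite_self, sub_zero]
      exact hG.term_vanishes (hG.inv_zero _ _) (hG.inv_vanishes hj) (hG.homF_vanishes h _ _)
        (by omega)
  · intro z hz
    simp only [Finset.sum_ite_eq', Finset.mem_univ, if_true, hG.homF_one_zero hz,
      hG.inv_symm hz 1 0, Finset.sum_ite_irrel, Finset.sum_const_zero]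
    ring

lemma homE_x_x (hG : IsNormalMetricOn Ω G) (h : NormalTo Ω G q)
    {k p : Fin (d + 2)} (hk : k ≠ 1) (hp : p ≠ 1) : VanishesTo Ω (q + 1) (homE G 1 k p) := by
  refine (hG.homE_sub_vanishes (c := fun _ _ _ => 0) k p fun l j => ?_).congr hG.isOpen
    fun z _ => by simp
  simp only [sub_zero]
  by_cases hj : j = 0
  · subst hj
    exact hG.term_vanishes (hG.inv_zero _ _) (hG.inv_vanishes' hp) (hG.homF_vanishes h _ _)
      (by omega)
  by_cases hl : l = 0
  · subst hl
    exact hG.term_vanishes (hG.inv_vanishes' hk) (hG.inv_zero _ _) (hG.homF_vanishes h _ _)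
      (by omega)
  exact hG.term_vanishes (hG.inv_zero _ _) (hG.inv_zero _ _) (hG.homF_vanishes_of_ne h hj hl)
    (by omega)

/-- The divergence of `homE`, with the homogeneity used in the `t`-direction. -/
lemma divergence_vanishes (hG : IsNormalMetricOn Ω G)
    (hR : ∀ m j, VanishesTo Ω m (ricci G 1 j)) (m : ℕ) (p : Fin (d + 2)) :
    VanishesTo Ω m (fun z =>
      pderiv 0 (homE G 1 0 p) z + (∑ k, christoffel G k k 0 z) * homE G 1 0 p z +
        d * homE G 1 1 p z + ∑ i : Fin d, (pderiv i.succ.succ (homE G 1 i.succ.succ p) z +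
          (∑ k, christoffel G k k i.succ.succ z) * homE G 1 i.succ.succ p z)) := by
  refine (VanishesTo.sum hG.isOpen Finset.univ fun j _ => VanishesTo.mul_le hG.isOpen (hR m j)
    (hG.inv_zero j p) (m := m) le_rfl).congr hG.isOpen fun z hz => ?_
  rw [hG.sum_ricci_hom hG.hom hz]
  rw [Finset.sum_comm (f := fun k l => christoffel G k k l z * homE G 1 l p z)]
  simp only [← Finset.sum_mul, ← Finset.sum_add_distrib]
  conv_rhs => rw [sum_univ_split]
  -- In the `t`-direction the derivative gives `-2` and the trace of the Christoffel symbols gives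
  -- the dimension `d + 2`; the coefficient `d` is their sum.
  rw [hG.pderiv_homE_hom hG.hom hz, hG.sum_christoffel_hom hG.hom hz]
  push_cast
  ring

/-- The `∞`-component of the equation determines `G₀₀`. -/
lemma phi_vanishes (hd : 1 ≤ d) (hG : IsNormalMetricOn Ω G)
    (hR : ∀ m j, VanishesTo Ω m (ricci G 1 j)) (h : NormalTo Ω G q) :
    VanishesTo Ω (q + 2) (phi G) := by
  have hΩ := hG.isOpen
  have h00 : ∀ z ∈ Ω, homE G 1 0 0 z = 0 := fun z hz => by
    have := hG.homE_antisymm hz 1 0 0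
    linarith
  have hγ : ∀ i, ContDiffOn ℝ ∞ (fun z => ∑ k, christoffel G k k i z) Ω := fun i =>
    ContDiffOn.sum fun k _ => hG.christoffel_smooth k k i
  have h1 : VanishesTo Ω (q + 1) (fun z => ∑ i : Fin d,
      (pderiv i.succ.succ (homE G 1 i.succ.succ 0) z +
        (∑ k, christoffel G k k i.succ.succ z) * homE G 1 i.succ.succ 0 z)) :=
    VanishesTo.sum hΩ _ fun i _ => by
      have := hG.homE_zero_vanishes h (succ_ne_one i)
      exact VanishesTo.add hΩ (VanishesTo.pderiv hΩ this (Fin.succ_ne_zero _))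
        (VanishesTo.smul hΩ (hγ _) this)
  -- `E^{00}` is zero by antisymmetry and the `E^{i0}` are already of higher order, so the equation
  -- is down to `d E^{10}`. Positivity of `d` is essential here.
  have h2 : VanishesTo Ω (q + 1) (homE G 1 1 0) := by
    refine (VanishesTo.const_mul hΩ (d : ℝ)⁻¹
      (VanishesTo.sub hΩ (hG.divergence_vanishes hR (q + 1) 0) h1)).congr hΩ fun z hz => ?_
    have hd' : (d : ℝ) ≠ 0 := by positivity
    rw [pderiv_congr hΩ h00 hz, pderiv_const, h00 z hz]
    field_simp
    ring
  have h3 : VanishesTo Ω (q + 1)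
      (fun z => (G z)⁻¹ 0 1 * ((G z)⁻¹ 0 1 * pderiv 0 (phi G) z)) :=
    (VanishesTo.const_mul hΩ 2 (VanishesTo.sub hΩ (hG.homE_one_zero h) h2)).congr hΩ
      fun z _ => by ring
  have hd0 := h.tt.pderiv_zero
  exact .of_pderiv_zero h.tt.smooth h.tt.2.1
    (hG.of_inv_mul hd0 (hG.of_inv_mul (VanishesTo.smul hΩ (hG.inv_smooth 0 1) hd0) h3))

/-- The leading behaviour of `G^{∞∞}`. -/
lemma inv_zero_zero (hG : IsNormalMetricOn Ω G) (h : NormalTo Ω G q)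
    (hφ : VanishesTo Ω (q + 2) (phi G)) :
    VanishesTo Ω 2 (fun z => (G z)⁻¹ 0 0 + 2 * (z 0 * (G z)⁻¹ 0 1)) := by
  have hΩ := hG.isOpen
  refine .of_smul hΩ (hG.smooth 0 1) hG.rt_ne ?_
  have h1 : VanishesTo Ω 2 (fun z => phi G z * (G z)⁻¹ 1 0) :=
    VanishesTo.mul_le hΩ hφ (hG.inv_zero _ _) (by omega)
  have h2 : VanishesTo Ω 2 (fun z => ∑ k : Fin d, G z 1 k.succ.succ * (G z)⁻¹ k.succ.succ 0) :=
    VanishesTo.sum hΩ _ fun k _ => VanishesTo.mul_le hΩ (h.tx k)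
      (hG.inv_vanishes' (succ_ne_one k)) (by omega)
  refine (VanishesTo.neg hΩ (VanishesTo.add hΩ h1 h2)).congr hΩ fun z hz => ?_
  -- In this entry of `G G⁻¹ = 1`, the part `2ρG₀₁` of `G₁₁` gives the leading term; `φ` and the
  -- products `G₁ₖ G^{k0}` are `O(ρ²)`.
  have e := hG.mul_inv hz 1 0
  rw [sum_univ_split, hG.symm z hz 1 0, if_neg (by simp), hG.inv_symm hz 1 0] at e
  rw [hG.inv_symm hz 1 0, phi]
  linear_combination e

/-- The term `∂₀ G₀ₖ` contracted with the inverse metric. -/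
def contr (G : (Fin (d + 2) → ℝ) → Matrix (Fin (d + 2)) (Fin (d + 2)) ℝ) (i : Fin d)
    (f : Fin d → (Fin (d + 2) → ℝ) → ℝ) (z : Fin (d + 2) → ℝ) : ℝ :=
  ∑ k : Fin d, (G z)⁻¹ 0 1 * (G z)⁻¹ i.succ.succ k.succ.succ * f k z

/-- The terms of order `ρ^q` are those with `l = 0` and `j` an `x`-index. The term with `l = 0`, `j
= 1` contains `∂₀φ`, and is negligible only because `φ` has already gained an order. -/
lemma homE_one_x (hG : IsNormalMetricOn Ω G) (h : NormalTo Ω G q)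
    (hφ : VanishesTo Ω (q + 2) (phi G)) (i : Fin d) :
    VanishesTo Ω (q + 1) (fun z => homE G 1 1 i.succ.succ z +
      (1 / 2) * contr G i (fun k => pderiv 0 (fun z => G z 1 k.succ.succ)) z) := by
  have hΩ := hG.isOpen
  have hi := succ_ne_one i
  have h10 : VanishesTo Ω (q + 1) (homF G 1 1 0) :=
    (VanishesTo.neg hΩ hφ.pderiv_zero).congr hΩ fun z hz => hG.homF_one_zero hz
  refine (VanishesTo.add hΩ (hG.homE_sub_vanishes 1 i.succ.succ (m := q + 1)
    (c := fun l j z => if l = 0 then (G z)⁻¹ 1 0 * (G z)⁻¹ i.succ.succ j * homF G 1 j 0 z else 0)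
    fun l j => ?_) (VanishesTo.const_mul hΩ (1 / 2) (hG.term_vanishes (m := q + 1)
      (hG.inv_zero 1 0) (hG.inv_zero i.succ.succ 1) h10 (by omega)))).congr hΩ ?_
  · by_cases hl : l = 0
    · subst hl
      simpa using VanishesTo.zero
    · simp only [hl, if_false, sub_zero]
      by_cases hj : j = 0
      · subst hj
        exact hG.term_vanishes (hG.inv_zero _ _) (hG.inv_vanishes' hi) (hG.homF_vanishes h _ _)
          (by omega)
      · exact hG.term_vanishes (hG.inv_zero _ _) (hG.inv_zero _ _)
          (hG.homF_vanishes_of_ne h hj hl) (by omega)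
  · intro z hz
    rw [Finset.sum_comm]
    simp only [Finset.sum_ite_eq', Finset.mem_univ, if_true, contr]
    rw [sum_univ_split]
    have h00 : homF G 1 0 0 z = 0 := by simp [homF]
    simp only [hG.homF_zero_x hz, h00, hG.inv_symm hz 1 0, mul_neg, Finset.sum_neg_distrib]
    ring

/-- One order more than in `homE_x_x` is needed because this component gets differentiated in `ρ`.
The surviving terms are `G^{00} G^{ik} F_{k0}` and `G^{01} G^{ik} F_{k1}`; substituting `G^{00} ≈
-2ρG^{01}` combines them into `(ρ∂₀ - 1) G₁ₖ`. -/
lemma homE_zero_x (hG : IsNormalMetricOn Ω G) (h : NormalTo Ω G q)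
    (hφ : VanishesTo Ω (q + 2) (phi G)) (i : Fin d) :
    VanishesTo Ω (q + 2) (fun z => homE G 1 0 i.succ.succ z -
      contr G i (fun k z => z 0 * pderiv 0 (fun z => G z 1 k.succ.succ) z -
        G z 1 k.succ.succ) z) := by
  have hΩ := hG.isOpen
  have hi := succ_ne_one i
  have h10 : VanishesTo Ω (q + 1) (homF G 1 1 0) :=
    (VanishesTo.neg hΩ hφ.pderiv_zero).congr hΩ fun z hz => hG.homF_one_zero hz
  have h01 : VanishesTo Ω (q + 1) (homF G 1 0 1) :=
    (VanishesTo.neg hΩ h10).congr hΩ fun z _ => homF_antisymm G 1 0 1 z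
  have h1l : ∀ l, VanishesTo Ω (q + 1) (homF G 1 1 l) := fun l => by
    by_cases hl : l = 0
    · subst hl; exact h10
    · exact hG.homF_vanishes_of_ne h (by simp) hl
  have h11 : ∀ z, homF G 1 1 1 z = 0 := fun z => by simp [homF]
  have key : ∀ k : Fin d, VanishesTo Ω (q + 2) (fun z =>
      (G z)⁻¹ 0 0 * (G z)⁻¹ i.succ.succ k.succ.succ * homF G 1 k.succ.succ 0 z +
      (G z)⁻¹ 0 1 * (G z)⁻¹ i.succ.succ k.succ.succ * homF G 1 k.succ.succ 1 z -
      2 * ((G z)⁻¹ 0 1 * (G z)⁻¹ i.succ.succ k.succ.succ *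
        (z 0 * pderiv 0 (fun z => G z 1 k.succ.succ) z - G z 1 k.succ.succ))) := fun k => by
    refine (VanishesTo.sub hΩ (hG.term_vanishes (m := q + 2) (hG.inv_zero 0 1)
      (hG.inv_zero i.succ.succ k.succ.succ) (VanishesTo.pderiv hΩ hφ (Fin.succ_ne_zero k.succ))
      (by omega)) (hG.term_vanishes (m := q + 2) (hG.inv_zero_zero h hφ)
      (hG.inv_zero i.succ.succ k.succ.succ) (h.tx k).pderiv_zero (by omega))).congr hΩ
      fun z hz => ?_
    rw [hG.homF_zero_x hz, hG.homF_x_one hz]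
    ring
  -- Every other term gets two orders beyond `ρ^q`, from vanishing entries of `G⁻¹`, from an `F`
  -- without index `0`, or from the improved order of `∂₀φ` when `{l, j} = {0, 1}`.
  have rest : ∀ l j : Fin (d + 2), (l = 0 ∨ l = 1 → j = 0 ∨ j = 1) → VanishesTo Ω (q + 2)
      (fun z => (G z)⁻¹ 0 l * (G z)⁻¹ i.succ.succ j * homF G 1 j l z) := fun l j hlj => by
    by_cases hl : l = 1
    · subst hl
      rcases hlj (Or.inr rfl) with rfl | rfl
      · exact hG.term_vanishes (hG.inv_zero _ _) (hG.inv_vanishes' hi) h01 (by omega)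
      · exact VanishesTo.zero.congr hΩ fun z _ => by rw [h11, mul_zero]
    by_cases hj0 : j = 0
    · subst hj0
      exact hG.term_vanishes (hG.inv_vanishes hl) (hG.inv_vanishes' hi) (hG.homF_vanishes h _ _)
        (by omega)
    by_cases hl0 : l = 0
    · obtain rfl : j = 1 := (hlj (Or.inl hl0)).resolve_left hj0
      exact hG.term_vanishes (hG.inv_vanishes hl) (hG.inv_zero _ _) (h1l l) (by omega)
    · exact hG.term_vanishes (hG.inv_vanishes hl) (hG.inv_zero _ _)
        (hG.homF_vanishes_of_ne h hj0 hl0) (by omega)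
  have h0 : ∀ l j : Fin (d + 2), VanishesTo Ω (q + 2)
      (fun z => (G z)⁻¹ 0 l * (G z)⁻¹ i.succ.succ j * homF G 1 j l z -
        if (l = 0 ∨ l = 1) ∧ ¬ (j = 0 ∨ j = 1) then
          (G z)⁻¹ 0 l * (G z)⁻¹ i.succ.succ j * homF G 1 j l z else 0) := fun l j => by
    by_cases hc : (l = 0 ∨ l = 1) ∧ ¬ (j = 0 ∨ j = 1)
    · simpa [hc] using VanishesTo.zero
    · simp only [hc, if_false, sub_zero]
      exact rest l j fun hl => by tauto
  refine (VanishesTo.add hΩ (hG.homE_sub_vanishes 0 i.succ.succ h0)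
    (VanishesTo.const_mul hΩ (1 / 2) (VanishesTo.sum hΩ Finset.univ fun k _ => key k))).congr hΩ
    fun z _ => ?_
  have e1 : ∀ k : Fin d, (k.succ.succ = 1) = False := fun k => by simp [succ_ne_one]
  rw [sum_univ_split]
  simp only [sum_univ_split (d := d), contr, Finset.sum_sub_distrib, Finset.sum_add_distrib,
    ← Finset.mul_sum]
  simp [e1]
  ring

/-- The angular components of the equation determine `G₀ᵢ` away from the critical order. -/
lemma tx_vanishes (hG : IsNormalMetricOn Ω G)
    (hR : ∀ m j, VanishesTo Ω m (ricci G 1 j)) (h : NormalTo Ω G q)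
    (hφ : VanishesTo Ω (q + 2) (phi G)) (hq : 2 * q ≠ d) (j : Fin d) :
    VanishesTo Ω (q + 2) (fun z => G z 1 j.succ.succ) := by
  have hΩ := hG.isOpen
  set c : Fin d → (Fin (d + 2) → ℝ) → ℝ := fun k => pderiv 0 (fun z => G z 1 k.succ.succ) with hc
  have hcv : ∀ k, VanishesTo Ω q (c k) := fun k => (h.tx k).pderiv_zero
  have hγ : ∀ i, ContDiffOn ℝ ∞ (fun z => ∑ k, christoffel G k k i z) Ω := fun i =>
    ContDiffOn.sum fun k _ => hG.christoffel_smooth k k i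
  have hcoef : ∀ i k : Fin d, ContDiffOn ℝ ∞
      (fun z => (G z)⁻¹ 0 1 * (G z)⁻¹ i.succ.succ k.succ.succ) Ω := fun i k =>
    (hG.inv_smooth _ _).mul (hG.inv_smooth _ _)
  have hu : ∀ k, VanishesTo Ω (q + 1)
      (fun z => z 0 * c k z - G z 1 k.succ.succ) := fun k =>
    VanishesTo.sub hΩ (VanishesTo.mul_le hΩ .coord_zero (hcv k) (by omega)) (h.tx k)
  -- As `c k` is `∂₀G₁ₖ`, the two terms without the factor `ρ` cancel. What is left is suited to
  -- Euler's relation, which replaces `ρ∂₀` by `q`.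
  have hdu : ∀ k, ∀ z ∈ Ω, pderiv 0 (fun z => z 0 * c k z - G z 1 k.succ.succ) z =
      z 0 * pderiv 0 (c k) z := fun k z hz => by
    have dz := differentiableAt_of_contDiffOn hΩ coord_smooth hz
    have dc := differentiableAt_of_contDiffOn hΩ (hcv k).smooth hz
    rw [pderiv_sub (f := fun z => z 0 * c k z) (dz.mul dc) (hG.diff hz _ _), pderiv_mul dz dc,
      pderiv_coord]
    simp [hc]
  -- the derivative of `E^{∞ i}`
  have hdE : ∀ i : Fin d, VanishesTo Ω (q + 1) (fun z =>
      pderiv 0 (homE G 1 0 i.succ.succ) z - q * contr G i c z) := fun i => by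
    have e1 := (hG.homE_zero_x h hφ i).pderiv_zero
    have e2 : VanishesTo Ω (q + 1) (fun z =>
        pderiv 0 (contr G i (fun k z => z 0 * c k z - G z 1 k.succ.succ)) z -
          q * contr G i c z) := by
      have e3 : VanishesTo Ω (q + 1) (fun z => ∑ k : Fin d,
          (pderiv 0 (fun z => (G z)⁻¹ 0 1 * (G z)⁻¹ i.succ.succ k.succ.succ) z *
            (z 0 * c k z - G z 1 k.succ.succ) +
          (G z)⁻¹ 0 1 * (G z)⁻¹ i.succ.succ k.succ.succ *
            (z 0 * pderiv 0 (c k) z - q * c k z))) :=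
        VanishesTo.sum hΩ _ fun k _ => VanishesTo.add hΩ
          (VanishesTo.smul hΩ (pderiv_contDiffOn hΩ (hcoef i k) 0) (hu k))
          (VanishesTo.smul hΩ (hcoef i k) (VanishesTo.euler hΩ (hcv k)))
      refine e3.congr hΩ fun z hz => ?_
      have d1 : ∀ k : Fin d, DifferentiableAt ℝ
          (fun z => (G z)⁻¹ 0 1 * (G z)⁻¹ i.succ.succ k.succ.succ) z := fun k =>
        differentiableAt_of_contDiffOn hΩ (hcoef i k) hz
      have d2 : ∀ k, DifferentiableAt ℝ (fun z => z 0 * c k z - G z 1 k.succ.succ) z := fun k =>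
        differentiableAt_of_contDiffOn hΩ (hu k).smooth hz
      have e4 : pderiv 0 (contr G i (fun k z => z 0 * c k z - G z 1 k.succ.succ)) z =
          ∑ k : Fin d, pderiv 0 (fun z => (G z)⁻¹ 0 1 * (G z)⁻¹ i.succ.succ k.succ.succ *
            (z 0 * c k z - G z 1 k.succ.succ)) z :=
        pderiv_sum _ (fun k _ => (d1 k).mul (d2 k)) 0
      rw [e4, contr, Finset.mul_sum, ← Finset.sum_sub_distrib]
      refine Finset.sum_congr rfl fun k _ => ?_
      rw [pderiv_mul (d1 k) (d2 k), hdu k z hz]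
      ring
    refine (VanishesTo.add hΩ e1 e2).congr hΩ fun z hz => ?_
    rw [pderiv_sub (differentiableAt_of_contDiffOn hΩ (hG.homE_smooth _ _ _) hz)]
    · ring
    · exact DifferentiableAt.fun_sum fun k _ =>
        (differentiableAt_of_contDiffOn hΩ (hcoef i k) hz).mul
          (differentiableAt_of_contDiffOn hΩ (hu k).smooth hz)
  have hcontr : ∀ i : Fin d, VanishesTo Ω (q + 1) (contr G i c) := fun i => by
    have e1 : VanishesTo Ω (q + 1) (fun z => ∑ k : Fin d,
        (pderiv k.succ.succ (homE G 1 k.succ.succ i.succ.succ) z +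
        (∑ l, christoffel G l l k.succ.succ z) * homE G 1 k.succ.succ i.succ.succ z)) :=
      VanishesTo.sum hΩ _ fun k _ => by
        have := hG.homE_x_x h (succ_ne_one k) (succ_ne_one i)
        exact VanishesTo.add hΩ (VanishesTo.pderiv hΩ this (Fin.succ_ne_zero _))
          (VanishesTo.smul hΩ (hγ _) this)
    have e2 : VanishesTo Ω (q + 1) (homE G 1 0 i.succ.succ) :=
      hG.homE_x_x h (by simp) (succ_ne_one i)
    have e3 := VanishesTo.sub hΩ (VanishesTo.sub hΩ (VanishesTo.sub hΩ (VanishesTo.sub hΩ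
      (hG.divergence_vanishes hR (q + 1) i.succ.succ) e1)
      (VanishesTo.smul hΩ (hγ 0) e2)) (hdE i))
      (VanishesTo.const_mul hΩ (d : ℝ) (hG.homE_one_x h hφ i))
    -- The contraction enters with coefficient `q` through `∂₀E^{0i}` and with `-d/2` through `d
    -- E^{1i}`. Dividing by the sum is where the critical order `2q = d` is excluded.
    refine (VanishesTo.const_mul hΩ (q - d / 2 : ℝ)⁻¹ e3).congr hΩ fun z _ => ?_
    rw [← hc]
    have hne : (q - d / 2 : ℝ) ≠ 0 := fun h0 => hq (by
      have : (2 * q : ℝ) = d := by linarith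
      exact_mod_cast this)
    rw [eq_inv_mul_iff_mul_eq₀ hne]
    ring
  refine .of_pderiv_zero (h.tx j).smooth (h.tx j).2.1 (hG.of_inv_mul (hcv j) ?_)
  have hlow : VanishesTo Ω (q + 1) (fun z => ∑ i : Fin d, G z j.succ.succ i.succ.succ *
      contr G i c z) := VanishesTo.sum hΩ _ fun i _ =>
    VanishesTo.smul hΩ (hG.smooth _ _) (hcontr i)
  -- The `x`-block of `G` inverts the `x`-block of `G⁻¹` only up to `Gⱼ₀ G^{0k} + Gⱼ₁ G^{1k}`. This
  -- vanishes at `ρ = 0`, so against `c k = O(ρ^q)` the error has the wanted order.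
  have hcorr : VanishesTo Ω (q + 1) (fun z => ∑ k : Fin d, (G z)⁻¹ 0 1 *
      (G z j.succ.succ 0 * (G z)⁻¹ 0 k.succ.succ * c k z +
      G z j.succ.succ 1 * (G z)⁻¹ 1 k.succ.succ * c k z)) := by
    refine VanishesTo.sum hΩ _ fun k _ => VanishesTo.smul hΩ (hG.inv_smooth _ _)
      (VanishesTo.add hΩ ?_ ?_)
    · exact hG.term_vanishes (a := 0) (hG.smooth _ _) (hG.inv_vanishes (succ_ne_one k)) (hcv k)
        (by omega)
    · refine hG.term_vanishes (a := q + 1) ?_ (hG.inv_zero _ _) (hcv k) (by omega)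
      exact (h.tx j).congr hΩ fun z hz => hG.symm z hz _ _
  refine (VanishesTo.add hΩ hlow hcorr).congr hΩ fun z hz => ?_
  have e : ∀ k : Fin d, (∑ i : Fin d, G z j.succ.succ i.succ.succ *
      (G z)⁻¹ i.succ.succ k.succ.succ) + G z j.succ.succ 0 * (G z)⁻¹ 0 k.succ.succ +
      G z j.succ.succ 1 * (G z)⁻¹ 1 k.succ.succ = if j = k then 1 else 0 := fun k => by
    have := hG.mul_inv hz j.succ.succ k.succ.succ
    rw [sum_univ_split] at this
    simp only [Fin.succ_inj] at this
    rw [← this]; ring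
  have e' : ∑ k : Fin d, (G z)⁻¹ 0 1 * ((∑ i : Fin d, G z j.succ.succ i.succ.succ *
      (G z)⁻¹ i.succ.succ k.succ.succ) + G z j.succ.succ 0 * (G z)⁻¹ 0 k.succ.succ +
      G z j.succ.succ 1 * (G z)⁻¹ 1 k.succ.succ) * c k z = (G z)⁻¹ 0 1 * c j z := by
    simp [e]
  rw [← e']
  simp only [contr, Finset.mul_sum]
  rw [Finset.sum_comm, ← Finset.sum_add_distrib]
  refine Finset.sum_congr rfl fun k _ => ?_
  simp only [mul_add, add_mul, Finset.mul_sum, Finset.sum_mul, add_assoc]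
  congr 1
  · exact Finset.sum_congr rfl fun i _ => by ring
  · ring

/-- The normal form of `G₀₀` and `G₀ᵢ`, to all orders if `d` is odd, and up to order `d / 2` if
`d` is even. -/
theorem normalTo (hd : 1 ≤ d) (hG : IsNormalMetricOn Ω G)
    (hR : ∀ m j, VanishesTo Ω m (ricci G 1 j)) (hq : Odd d ∨ 2 * q ≤ d) : NormalTo Ω G q := by
  induction q with
  | zero => exact hG.normalTo_zero
  | succ q ih =>
    have h := ih (hq.imp_right fun h => by omega)
    -- The order matters: the step for `G₁ᵢ` relies on the improved order of `φ`.
    have hφ := hG.phi_vanishes hd hR h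
    refine ⟨hφ, hG.tx_vanishes hR h hφ ?_⟩
    rintro rfl
    rcases hq with hq | hq
    · exact (Nat.not_odd_iff_even.2 (even_two_mul q)) hq
    · omega

end IsNormalMetricOn

/-! ### Charts of a Weyl structure adapted to a representative of the Weyl class -/

section

variable {d : ℕ} {M : Type*} [TopologicalSpace M] [ChartedSpace (Fin d → ℝ) M]
  {np nq : ℕ} {C : WeylClass d M np nq}
  {P : Type*} [TopologicalSpace P] [ChartedSpace (Fin (d + 1) → ℝ) P]

lemma WeylStructure.proj_contMDiff (W : WeylStructure C P) :
    ContMDiff 𝓘(ℝ, Fin (d + 1) → ℝ) 𝓘(ℝ, Fin d → ℝ) ∞ W.proj := by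
  intro p
  obtain ⟨U, -, hpU, T, hTs, -, hT1, -, hTsm, -⟩ := W.locally_trivial (W.proj p)
  have hp : p ∈ T.source := by rw [hTs]; exact hpU
  have h := (contMDiffOn_fst (s := Set.univ)).comp hTsm (fun _ _ => Set.mem_univ _)
  exact (h.congr fun q hq => (hT1 q hq).symm).contMDiffAt (T.open_source.mem_nhds hp)

lemma WeylStructure.exists_proj_eq (W : WeylStructure C P) (x : M) : ∃ p, W.proj p = x := by
  obtain ⟨U, -, hxU, T, hTs, hTt, hT1, -⟩ := W.locally_trivial x
  have h : (x, (1 : ℝ)) ∈ T.target := by rw [hTt]; exact ⟨hxU, by simp⟩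
  exact ⟨T.symm (x, 1), by rw [← hT1 _ (T.map_target h), T.right_inv h]⟩

/-- The chart `E` of `P` has the coordinates `(ln t, x)`, where `x` are those of the chart `e` of
`M`, and it is defined over the part `V` of the domain of `e`. -/
structure WeylStructure.IsAdapted (W : WeylStructure C P) (r : WeylPair d M np nq)
    (e : OpenPartialHomeomorph M (Fin d → ℝ)) (V : Set M)
    (E : OpenPartialHomeomorph P (Fin (d + 1) → ℝ)) : Prop where
  rep_mem : r ∈ C.reps
  base_mem : e ∈ Charts d M
  mem : E ∈ Charts (d + 1) P
  isOpen : IsOpen V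
  subset : V ⊆ e.source
  source_eq : E.source = W.proj ⁻¹' V
  target_eq : E.target = {u : Fin (d + 1) → ℝ | Fin.tail u ∈ e.target ∧ e.symm (Fin.tail u) ∈ V}
  apply_eq : ∀ p ∈ E.source, E p = Fin.cons (Real.log (W.fibre r p)) (e (W.proj p))

lemma contDiff_cons {n : ℕ} {X : Type*} [NormedAddCommGroup X] [NormedSpace ℝ X]
    {s : Set X} {f : X → ℝ} {g : X → Fin n → ℝ}
    (hf : ContDiffOn ℝ ∞ f s) (hg : ContDiffOn ℝ ∞ g s) :
    ContDiffOn ℝ ∞ (fun x => (Fin.cons (f x) (g x) : Fin (n + 1) → ℝ)) s := by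
  rw [contDiffOn_pi]
  intro i
  refine Fin.cases ?_ (fun j => ?_) i
  · simpa using hf
  · simpa using (contDiffOn_pi.1 hg) j

lemma contDiff_tail {n : ℕ} :
    ContDiff ℝ ∞ (fun u : Fin (n + 1) → ℝ => (Fin.tail u : Fin n → ℝ)) := by
  rw [contDiff_pi]
  intro i
  exact contDiff_apply ℝ ℝ i.succ

namespace WeylStructure.IsAdapted

variable {W : WeylStructure C P} {r : WeylPair d M np nq}
  {e : OpenPartialHomeomorph M (Fin d → ℝ)} {V : Set M}
  {E : OpenPartialHomeomorph P (Fin (d + 1) → ℝ)} {u : Fin (d + 1) → ℝ}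

lemma tail_mem (h : W.IsAdapted r e V E) (hu : u ∈ E.target) : Fin.tail u ∈ e.target := by
  rw [h.target_eq] at hu; exact hu.1

lemma apply_symm (h : W.IsAdapted r e V E) (hu : u ∈ E.target) :
    u = Fin.cons (Real.log (W.fibre r (E.symm u))) (e (W.proj (E.symm u))) := by
  rw [← h.apply_eq _ (E.map_target hu), E.right_inv hu]

lemma proj_symm (h : W.IsAdapted r e V E) (hu : u ∈ E.target) :
    W.proj (E.symm u) = e.symm (Fin.tail u) := by
  have hs := E.map_target hu
  rw [h.source_eq] at hs
  have h1 := congrArg Fin.tail (h.apply_symm hu)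
  rw [Fin.tail_cons] at h1
  rw [h1, e.left_inv (h.subset hs)]

lemma fibre_symm (h : W.IsAdapted r e V E) (hu : u ∈ E.target) :
    W.fibre r (E.symm u) = Real.exp (u 0) := by
  have h1 := congrFun (h.apply_symm hu) 0
  rw [Fin.cons_zero] at h1
  rw [h1, Real.exp_log (W.fibre_pos r h.rep_mem _)]

lemma cons_mem (h : W.IsAdapted r e V E) (hu : u ∈ E.target) (τ : ℝ) :
    (Fin.cons τ (Fin.tail u) : Fin (d + 1) → ℝ) ∈ E.target := by
  rw [h.target_eq] at hu ⊢
  simpa using hu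

lemma dil_symm (h : W.IsAdapted r e V E) (hu : u ∈ E.target) {s : ℝ} (hs : 0 < s) :
    W.dil s (E.symm u) = E.symm (Fin.cons (u 0 + Real.log s) (Fin.tail u)) := by
  have h1 : W.dil s (E.symm u) ∈ E.source := by
    have := E.map_target hu
    rw [h.source_eq] at this ⊢
    rwa [Set.mem_preimage, W.proj_dil s hs]
  rw [← E.left_inv h1]
  congr 1
  rw [h.apply_eq _ h1, W.fibre_dil r h.rep_mem s hs, W.proj_dil s hs, h.fibre_symm hu,
    h.proj_symm hu, e.right_inv (h.tail_mem hu), Real.log_mul hs.ne' (Real.exp_pos _).ne',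
    Real.log_exp, add_comm (Real.log s)]

end WeylStructure.IsAdapted

variable [IsManifold 𝓘(ℝ, Fin (d + 1) → ℝ) ∞ P]

/-- A local trivialization has some fibre coordinate that need not be `t`. Rescaling it by a
positive function on the base gives `t`, whose logarithm is then a coordinate on whole fibres, so
that the domain stays dilatation-invariant. -/
lemma WeylStructure.exists_isAdapted (W : WeylStructure C P) {r : WeylPair d M np nq}
    (hr : r ∈ C.reps) {e : OpenPartialHomeomorph M (Fin d → ℝ)} (he : e ∈ Charts d M)
    {x : M} (hx : x ∈ e.source) : ∃ V E, x ∈ V ∧ W.IsAdapted r e V E := by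
  obtain ⟨U, hU, hxU, T, hTs, hTt, hT1, hT2, hTsm, hTsm'⟩ := W.locally_trivial x
  have hTmem : ∀ y ∈ U, ∀ s : ℝ, 0 < s → (y, s) ∈ T.target := fun y hy s hs => by
    rw [hTt]; exact ⟨hy, hs⟩
  have hproj : ∀ y ∈ U, ∀ s : ℝ, 0 < s → W.proj (T.symm (y, s)) = y := fun y hy s hs => by
    rw [← hT1 _ (T.map_target (hTmem y hy s hs)), T.right_inv (hTmem y hy s hs)]
  -- The value of `t` on the unit section of the trivialization; by equivariance `t = s c(y)` at the
  -- point `(y, s)`.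
  set c : M → ℝ := fun y => W.fibre r (T.symm (y, 1)) with hc
  have hcpos : ∀ y, 0 < c y := fun y => W.fibre_pos r hr _
  have hfib : ∀ y ∈ U, ∀ s : ℝ, 0 < s → W.fibre r (T.symm (y, s)) = s * c y := by
    intro y hy s hs
    rw [hc, ← W.fibre_dil r hr s hs]
    congr 1
    have h1 := hTmem y hy 1 one_pos
    have hsrc : W.dil s (T.symm (y, 1)) ∈ T.source := by
      rw [hTs, Set.mem_preimage, W.proj_dil s hs, hproj y hy 1 one_pos]; exact hy
    rw [← T.left_inv hsrc]
    congr 1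
    refine Prod.ext ?_ ?_
    · rw [hT1 _ hsrc, W.proj_dil s hs, hproj y hy 1 one_pos]
    · rw [hT2 _ (T.map_target h1) s hs, T.right_inv h1, mul_one]
  have hproj' := W.proj_contMDiff
  have hTp : ∀ p, W.proj p ∈ U → T.symm (W.proj p, W.fibre r p / c (W.proj p)) = p := by
    intro p hp
    have hps : p ∈ T.source := by rw [hTs]; exact hp
    have hpt := T.map_source hps
    have hpos : 0 < (T p).2 := by
      rw [hTt] at hpt; exact hpt.2
    have h1 : T p = (W.proj p, (T p).2) := Prod.ext (hT1 p hps) rfl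
    have h2 := hfib (W.proj p) hp _ hpos
    rw [← h1, T.left_inv hps] at h2
    rw [h2, mul_div_cancel_right₀ _ (hcpos _).ne', ← h1, T.left_inv hps]
  set V : Set M := U ∩ e.source with hV
  have hVopen : IsOpen V := hU.inter e.open_source
  set fwd : P → Fin (d + 1) → ℝ := fun p => Fin.cons (Real.log (W.fibre r p)) (e (W.proj p))
  set bwd : (Fin (d + 1) → ℝ) → P := fun u =>
    T.symm (e.symm (Fin.tail u), Real.exp (u 0) / c (e.symm (Fin.tail u)))
  set src : Set P := W.proj ⁻¹' V
  set tgt : Set (Fin (d + 1) → ℝ) := {u | Fin.tail u ∈ e.target ∧ e.symm (Fin.tail u) ∈ V}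
  have hsrcopen : IsOpen src := hVopen.preimage hproj'.continuous
  have htgtopen : IsOpen tgt :=
    (e.symm.isOpen_inter_preimage hVopen).preimage contDiff_tail.continuous
  -- smoothness in both directions
  have hes : ContMDiffOn 𝓘(ℝ, Fin d → ℝ) 𝓘(ℝ, Fin d → ℝ) ∞ e e.source :=
    contMDiffOn_of_mem_maximalAtlas he
  have hes' : ContMDiffOn 𝓘(ℝ, Fin d → ℝ) 𝓘(ℝ, Fin d → ℝ) ∞ e.symm e.target :=
    contMDiffOn_symm_of_mem_maximalAtlas he
  have hcsm : ContMDiffOn 𝓘(ℝ, Fin d → ℝ) 𝓘(ℝ, ℝ) ∞ c U := by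
    refine (W.fibre_smooth r hr).comp_contMDiffOn (hTsm'.comp
      (contMDiffOn_id.prodMk contMDiffOn_const) fun y hy => hTmem y hy 1 one_pos)
  have htail : ContMDiffOn 𝓘(ℝ, Fin (d + 1) → ℝ) 𝓘(ℝ, Fin d → ℝ) ∞
      (fun u : Fin (d + 1) → ℝ => e.symm (Fin.tail u)) tgt :=
    hes'.comp contDiff_tail.contMDiff.contMDiffOn fun u hu => hu.1
  have hbwd : ContMDiffOn 𝓘(ℝ, Fin (d + 1) → ℝ) 𝓘(ℝ, Fin (d + 1) → ℝ) ∞ bwd tgt := by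
    refine hTsm'.comp (htail.prodMk ?_) fun u hu =>
      hTmem _ hu.2.1 _ (div_pos (Real.exp_pos _) (hcpos _))
    have h1 : ContMDiffOn 𝓘(ℝ, Fin (d + 1) → ℝ) 𝓘(ℝ, ℝ) ∞
        (fun u : Fin (d + 1) → ℝ => Real.exp (u 0)) tgt :=
      (Real.contDiff_exp.comp (contDiff_apply ℝ ℝ 0)).contMDiff.contMDiffOn
    have h2 : ContMDiffOn 𝓘(ℝ, Fin (d + 1) → ℝ) 𝓘(ℝ, ℝ) ∞
        (fun u : Fin (d + 1) → ℝ => c (e.symm (Fin.tail u))) tgt :=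
      hcsm.comp htail fun u hu => hu.2.1
    exact (h1.contDiffOn.div h2.contDiffOn fun u _ => (hcpos _).ne').contMDiffOn
  have hfwd : ContMDiffOn 𝓘(ℝ, Fin (d + 1) → ℝ) 𝓘(ℝ, Fin (d + 1) → ℝ) ∞ fwd src := by
    have h1 : ContMDiffOn 𝓘(ℝ, Fin (d + 1) → ℝ) 𝓘(ℝ, ℝ) ∞
        (fun p => Real.log (W.fibre r p)) src :=
      ((Real.contDiffOn_log.mono fun x hx => ne_of_gt hx).contMDiffOn (s := Set.Ioi 0)).comp
        (W.fibre_smooth r hr).contMDiffOn fun p _ => W.fibre_pos r hr p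
    have h2 : ContMDiffOn 𝓘(ℝ, Fin (d + 1) → ℝ) 𝓘(ℝ, Fin d → ℝ) ∞
        (fun p => e (W.proj p)) src :=
      hes.comp hproj'.contMDiffOn fun p hp => hp.2
    rw [contMDiffOn_pi_space] at h2 ⊢
    intro i
    refine Fin.cases ?_ (fun j => ?_) i
    · simpa [fwd] using h1
    · simpa [fwd] using h2 j
  let E : OpenPartialHomeomorph P (Fin (d + 1) → ℝ) :=
    { toFun := fwd
      invFun := bwd
      source := src
      target := tgt
      map_source' := fun p hp => by
        simp only [tgt, fwd, Set.mem_ofPred_eq, Fin.tail_cons]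
        exact ⟨e.map_source hp.2, by rw [e.left_inv hp.2]; exact hp⟩
      map_target' := fun u hu => by
        simp only [src, bwd, Set.mem_preimage]
        rw [hproj _ hu.2.1 _ (div_pos (Real.exp_pos _) (hcpos _))]
        exact hu.2
      left_inv' := fun p hp => by
        simp only [bwd, fwd, Fin.tail_cons, Fin.cons_zero]
        rw [e.left_inv hp.2, Real.exp_log (W.fibre_pos r hr p), hTp p hp.1]
      right_inv' := fun u hu => by
        have hpos := div_pos (Real.exp_pos (u 0)) (hcpos (e.symm (Fin.tail u)))
        simp only [bwd, fwd]
        rw [hproj _ hu.2.1 _ hpos, hfib _ hu.2.1 _ hpos, div_mul_cancel₀ _ (hcpos _).ne',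
          Real.log_exp, e.right_inv hu.1, Fin.cons_self_tail]
      open_source := hsrcopen
      open_target := htgtopen
      continuousOn_toFun := hfwd.continuousOn
      continuousOn_invFun := hbwd.continuousOn }
  exact ⟨V, E, ⟨hxU, hx⟩, hr, he, (IsManifold.mem_maximalAtlas_iff_contMDiffOn E).2 ⟨hfwd, hbwd⟩,
    hVopen, fun y hy => hy.2, rfl, rfl, fun p _ => rfl⟩

end

/-! ### Coordinate vectors -/

section

variable {n : ℕ} {X : Type*} [TopologicalSpace X] [ChartedSpace (Fin n → ℝ) X]
  {e : OpenPartialHomeomorph X (Fin n → ℝ)}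
  {y : Fin n → ℝ}

lemma mdifferentiable_of_mem_charts (he : e ∈ Charts n X) :
    e.MDifferentiable 𝓘(ℝ, Fin n → ℝ) 𝓘(ℝ, Fin n → ℝ) :=
  ⟨(contMDiffOn_of_mem_maximalAtlas he).mdifferentiableOn (by simp),
    (contMDiffOn_symm_of_mem_maximalAtlas he).mdifferentiableOn (by simp)⟩

lemma mfderiv_symm_eq_sum (e : OpenPartialHomeomorph X (Fin n → ℝ)) (y c : Fin n → ℝ) :
    mfderiv 𝓘(ℝ, Fin n → ℝ) 𝓘(ℝ, Fin n → ℝ) e.symm y c = ∑ i, c i • coordVec e y i := by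
  have hc : c = ∑ i, c i • (Pi.single i (1 : ℝ) : Fin n → ℝ) := by
    ext j; simp [Finset.sum_apply, Pi.single_apply]
  conv_lhs => rw [hc]
  exact (map_sum _ _ _).trans (Finset.sum_congr rfl fun i _ => map_smul _ _ _)

lemma mfderiv_symm_bijective (he : e ∈ Charts n X) (hy : y ∈ e.target) :
    Function.Bijective (mfderiv 𝓘(ℝ, Fin n → ℝ) 𝓘(ℝ, Fin n → ℝ) e.symm y) :=
  (mdifferentiable_of_mem_charts he).symm.mfderiv_bijective hy

lemma exists_mfderiv_symm_eq (he : e ∈ Charts n X) (hy : y ∈ e.target) (w : Tan n (e.symm y)) :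
    ∃ c : Fin n → ℝ, mfderiv 𝓘(ℝ, Fin n → ℝ) 𝓘(ℝ, Fin n → ℝ) e.symm y c = w :=
  (mfderiv_symm_bijective he hy).2 w

lemma exists_eq_sum_coordVec (he : e ∈ Charts n X) (hy : y ∈ e.target) (w : Tan n (e.symm y)) :
    ∃ c : Fin n → ℝ, w = ∑ i, c i • coordVec e y i := by
  obtain ⟨c, hc⟩ := exists_mfderiv_symm_eq he hy w
  exact ⟨c, by rw [← hc]; exact mfderiv_symm_eq_sum e y c⟩

lemma sum_coordVec_injective (he : e ∈ Charts n X) (hy : y ∈ e.target) {c c' : Fin n → ℝ}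
    (h : ∑ i, c i • coordVec e y i = ∑ i, c' i • coordVec e y i) : c = c' := by
  rw [← mfderiv_symm_eq_sum, ← mfderiv_symm_eq_sum] at h
  exact (mfderiv_symm_bijective he hy).1 h

end

section

variable {d : ℕ} {M : Type*} [TopologicalSpace M] [ChartedSpace (Fin d → ℝ) M]
  {np nq : ℕ} {C : WeylClass d M np nq}
  {P : Type*} [TopologicalSpace P] [ChartedSpace (Fin (d + 1) → ℝ) P]
  {W : WeylStructure C P} {r : WeylPair d M np nq}
  {e : OpenPartialHomeomorph M (Fin d → ℝ)} {V : Set M}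
  {E : OpenPartialHomeomorph P (Fin (d + 1) → ℝ)} {u : Fin (d + 1) → ℝ}

namespace WeylStructure.IsAdapted

lemma mdifferentiableAt_symm (h : W.IsAdapted r e V E) (hu : u ∈ E.target) :
    MDifferentiableAt 𝓘(ℝ, Fin (d + 1) → ℝ) 𝓘(ℝ, Fin (d + 1) → ℝ) E.symm u :=
  (mdifferentiable_of_mem_charts h.mem).mdifferentiableAt_symm hu

lemma dt_mfderiv (h : W.IsAdapted r e V E) (hu : u ∈ E.target) (c : Fin (d + 1) → ℝ) :
    W.dt r (E.symm u) (mfderiv 𝓘(ℝ, Fin (d + 1) → ℝ) 𝓘(ℝ, Fin (d + 1) → ℝ) E.symm u c) =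
      Real.exp (u 0) * c 0 := by
  have h1 : MDifferentiableAt 𝓘(ℝ, Fin (d + 1) → ℝ) 𝓘(ℝ, ℝ) (W.fibre r) (E.symm u) :=
    (W.fibre_smooth r h.rep_mem).mdifferentiableAt (by simp)
  have h2 := mfderiv_comp_apply u h1 (h.mdifferentiableAt_symm hu) c
  have h3 : W.fibre r ∘ E.symm =ᶠ[nhds u] fun u => Real.exp (u 0) := by
    filter_upwards [E.open_target.mem_nhds hu] with v hv
    exact h.fibre_symm hv
  have h4 : HasFDerivAt (fun u : Fin (d + 1) → ℝ => Real.exp (u 0))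
      (Real.exp (u 0) • ContinuousLinearMap.proj (R := ℝ) (φ := fun _ : Fin (d + 1) => ℝ) 0) u :=
    (ContinuousLinearMap.proj (R := ℝ) (φ := fun _ : Fin (d + 1) => ℝ) 0).hasFDerivAt.exp
  have h5 := congrArg (fun L => L c) (h3.mfderiv_eq (I := 𝓘(ℝ, Fin (d + 1) → ℝ)) (I' := 𝓘(ℝ, ℝ)))
  refine h2.symm.trans (h5.trans ?_)
  change mfderiv 𝓘(ℝ, Fin (d + 1) → ℝ) 𝓘(ℝ, ℝ) (fun u : Fin (d + 1) → ℝ => Real.exp (u 0)) u c = _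
  rw [mfderiv_eq_fderiv, h4.fderiv]
  rfl

lemma projT_mfderiv (h : W.IsAdapted r e V E) (hu : u ∈ E.target) (c : Fin (d + 1) → ℝ) :
    (W.projT (E.symm u)
      (mfderiv 𝓘(ℝ, Fin (d + 1) → ℝ) 𝓘(ℝ, Fin (d + 1) → ℝ) E.symm u c) : Fin d → ℝ) =
      mfderiv 𝓘(ℝ, Fin d → ℝ) 𝓘(ℝ, Fin d → ℝ) e.symm (Fin.tail u) (Fin.tail c) := by
  have h1 : MDifferentiableAt 𝓘(ℝ, Fin (d + 1) → ℝ) 𝓘(ℝ, Fin d → ℝ) W.proj (E.symm u) :=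
    W.proj_contMDiff.mdifferentiableAt (by simp)
  have h2 := mfderiv_comp_apply u h1 (h.mdifferentiableAt_symm hu) c
  have h3 : W.proj ∘ E.symm =ᶠ[nhds u] e.symm ∘ fun u : Fin (d + 1) → ℝ => Fin.tail u := by
    filter_upwards [E.open_target.mem_nhds hu] with v hv
    exact h.proj_symm hv
  have h5 := congrArg (fun L => L c)
    (h3.mfderiv_eq (I := 𝓘(ℝ, Fin (d + 1) → ℝ)) (I' := 𝓘(ℝ, Fin d → ℝ)))
  let τ : (Fin (d + 1) → ℝ) →L[ℝ] (Fin d → ℝ) :=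
    ContinuousLinearMap.pi fun i => ContinuousLinearMap.proj i.succ
  have hτ : HasMFDerivAt 𝓘(ℝ, Fin (d + 1) → ℝ) 𝓘(ℝ, Fin d → ℝ)
      (fun u : Fin (d + 1) → ℝ => (Fin.tail u : Fin d → ℝ)) u τ :=
    (τ.hasFDerivAt (x := u)).hasMFDerivAt
  have h6 := mfderiv_comp_apply u ((mdifferentiable_of_mem_charts h.base_mem).mdifferentiableAt_symm
    (h.tail_mem hu)) hτ.mdifferentiableAt c
  rw [hτ.mfderiv] at h6
  exact h2.symm.trans (h5.trans h6)

lemma dt_coordVec_zero (h : W.IsAdapted r e V E) (hu : u ∈ E.target) :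
    W.dt r (E.symm u) (coordVec E u 0) = Real.exp (u 0) := by
  refine (h.dt_mfderiv hu (Pi.single 0 1)).trans ?_
  simp

lemma dt_coordVec_succ (h : W.IsAdapted r e V E) (hu : u ∈ E.target) (i : Fin d) :
    W.dt r (E.symm u) (coordVec E u i.succ) = 0 := by
  refine (h.dt_mfderiv hu (Pi.single i.succ 1)).trans ?_
  simp [(Fin.succ_ne_zero i).symm]

lemma projT_coordVec_zero (h : W.IsAdapted r e V E) (hu : u ∈ E.target) :
    W.projT (E.symm u) (coordVec E u 0) = 0 := by
  refine (h.projT_mfderiv hu (Pi.single 0 1)).trans ?_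
  have : (Fin.tail (Pi.single 0 1 : Fin (d + 1) → ℝ) : Fin d → ℝ) = 0 := by
    ext i; simp [Fin.tail]
  rw [this]
  exact map_zero _

lemma projT_coordVec_succ (h : W.IsAdapted r e V E) (hu : u ∈ E.target) (i : Fin d) :
    (W.projT (E.symm u) (coordVec E u i.succ) : Fin d → ℝ) = coordVec e (Fin.tail u) i := by
  refine (h.projT_mfderiv hu (Pi.single i.succ 1)).trans ?_
  have : (Fin.tail (Pi.single i.succ 1 : Fin (d + 1) → ℝ) : Fin d → ℝ) = Pi.single i 1 := by
    ext j; simp [Fin.tail, Pi.single_apply]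
  rw [this]
  rfl

/-- In an adapted chart `s ↦ δ_s p` is the line `ln t + ln s` with `x` fixed, whose velocity at `s =
1` is the first coordinate vector. -/
lemma gen_symm (h : W.IsAdapted r e V E) (hu : u ∈ E.target) :
    W.gen (E.symm u) = coordVec E u 0 := by
  let γ : ℝ → Fin (d + 1) → ℝ := fun s => Fin.cons (u 0 + Real.log s) (Fin.tail u)
  have hγ1 : γ 1 = u := by simp [γ]
  let L : ℝ →L[ℝ] (Fin (d + 1) → ℝ) := ContinuousLinearMap.toSpanSingleton ℝ (Pi.single 0 1)
  have hγ' : HasFDerivAt γ L 1 := by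
    refine HasDerivAt.hasFDerivAt (f' := (Pi.single 0 1 : Fin (d + 1) → ℝ)) ?_
    rw [hasDerivAt_pi]
    intro i
    refine Fin.cases ?_ (fun j => ?_) i
    · simpa [γ] using (Real.hasDerivAt_log one_ne_zero).const_add (u 0)
    · simpa [γ, Pi.single_apply] using hasDerivAt_const (1 : ℝ) (Fin.tail u j)
  have hγ : HasMFDerivAt 𝓘(ℝ, ℝ) 𝓘(ℝ, Fin (d + 1) → ℝ) γ 1 L := hγ'.hasMFDerivAt
  have h3 : (fun s => W.dil s (E.symm u)) =ᶠ[nhds 1] E.symm ∘ γ := by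
    filter_upwards [lt_mem_nhds one_pos] with s hs
    exact h.dil_symm hu hs
  have h5 := congrArg (fun L => L (1 : ℝ))
    (h3.mfderiv_eq (I := 𝓘(ℝ, ℝ)) (I' := 𝓘(ℝ, Fin (d + 1) → ℝ)))
  have h6 := mfderiv_comp_apply_of_eq (x := (1 : ℝ)) (h.mdifferentiableAt_symm hu)
    hγ.mdifferentiableAt hγ1 (1 : ℝ)
  rw [hγ.mfderiv] at h6
  refine h5.trans (h6.trans ?_)
  have : L 1 = Pi.single 0 1 := by simp [L]
  exact congrArg (mfderiv 𝓘(ℝ, Fin (d + 1) → ℝ) 𝓘(ℝ, Fin (d + 1) → ℝ) E.symm u) this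

/-- Dilatations are translations of the coordinate `ln t`, so they carry coordinate vectors to
coordinate vectors. -/
lemma dilT_coordVec (h : W.IsAdapted r e V E) (hu : u ∈ E.target) {s : ℝ} (hs : 0 < s)
    (i : Fin (d + 1)) : (W.dilT s (E.symm u) (coordVec E u i) : Fin (d + 1) → ℝ) =
      coordVec E (Fin.cons (u 0 + Real.log s) (Fin.tail u)) i := by
  let γ : (Fin (d + 1) → ℝ) → Fin (d + 1) → ℝ := fun v =>
    v + Pi.single 0 (Real.log s)
  have hγeq : ∀ v, γ v = Fin.cons (v 0 + Real.log s) (Fin.tail v) := fun v => by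
    ext i
    refine Fin.cases ?_ (fun j => ?_) i
    · simp [γ]
    · simp [γ, Fin.tail]
  have hγ : HasMFDerivAt 𝓘(ℝ, Fin (d + 1) → ℝ) 𝓘(ℝ, Fin (d + 1) → ℝ) γ u
      (ContinuousLinearMap.id ℝ (Fin (d + 1) → ℝ)) :=
    HasFDerivAt.hasMFDerivAt ((hasFDerivAt_id u).add_const _)
  have hmem := h.cons_mem hu (u 0 + Real.log s)
  -- the dilatation is smooth
  have hd : MDifferentiableAt 𝓘(ℝ, Fin (d + 1) → ℝ) 𝓘(ℝ, Fin (d + 1) → ℝ)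
      (W.dil s) (E.symm u) := by
    have h1 : W.dil s =ᶠ[nhds (E.symm u)] E.symm ∘ γ ∘ E := by
      filter_upwards [E.open_source.mem_nhds (E.map_target hu)] with p hp
      have := h.dil_symm (E.map_source hp) hs
      rw [E.left_inv hp] at this
      simp only [Function.comp_apply, hγeq, this]
    refine MDifferentiableAt.congr_of_eventuallyEq ?_ h1
    have hEu : E (E.symm u) = u := E.right_inv hu
    refine MDifferentiableAt.comp (I' := 𝓘(ℝ, Fin (d + 1) → ℝ)) _ ?_
      (MDifferentiableAt.comp (I' := 𝓘(ℝ, Fin (d + 1) → ℝ)) _ ?_ ?_)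
    · rw [Function.comp_apply, hEu, hγeq]
      exact h.mdifferentiableAt_symm hmem
    · rw [hEu]; exact hγ.mdifferentiableAt
    · exact (mdifferentiable_of_mem_charts h.mem).mdifferentiableAt (E.map_target hu)
  have h2 := mfderiv_comp_apply u hd (h.mdifferentiableAt_symm hu) (Pi.single i (1 : ℝ))
  have h3 : W.dil s ∘ E.symm =ᶠ[nhds u] E.symm ∘ γ := by
    filter_upwards [E.open_target.mem_nhds hu] with v hv
    simp only [Function.comp_apply, hγeq, h.dil_symm hv hs]
  have h5 := congrArg (fun L => L (Pi.single i (1 : ℝ)))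
    (h3.mfderiv_eq (I := 𝓘(ℝ, Fin (d + 1) → ℝ)) (I' := 𝓘(ℝ, Fin (d + 1) → ℝ)))
  have h6 := mfderiv_comp_apply_of_eq (x := u) (h.mdifferentiableAt_symm hmem)
    hγ.mdifferentiableAt (hγeq u) (Pi.single i (1 : ℝ))
  rw [hγ.mfderiv] at h6
  exact h2.symm.trans (h5.trans h6)

end WeylStructure.IsAdapted

end

/-! ### The components of a Weyl-ambient metric in an adapted chart -/

namespace HasSignature

variable {V : Type*} [AddCommGroup V] [Module ℝ V] {B : LinearMap.BilinForm ℝ V} {np nq : ℕ}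

lemma symm (h : HasSignature B np nq) (v w : V) : B v w = B w v := by
  obtain ⟨b, hb⟩ := h
  have : B = B.flip := b.ext fun i => b.ext fun j => by
    change B (b i) (b j) = B (b j) (b i)
    rw [hb, hb]
    by_cases hij : i = j
    · subst hij; rfl
    · rw [if_neg hij, if_neg (Ne.symm hij)]
  conv_lhs => rw [this]
  rfl

lemma eq_zero_of_forall (h : HasSignature B np nq) {w : V} (hw : ∀ v, B v w = 0) : w = 0 := by
  obtain ⟨b, hb⟩ := h
  rw [← b.sum_repr w]
  refine Finset.sum_eq_zero fun i _ => ?_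
  have h1 := hw (b i)
  rw [← b.sum_repr w, map_sum, Finset.sum_eq_single i] at h1
  · rw [map_smul, hb, if_pos rfl, smul_eq_mul] at h1
    rcases i with i | i <;> simp_all
  · intro j _ hj
    rw [map_smul, hb, if_neg (Ne.symm hj), smul_zero]
  · simp

end HasSignature

/-! ### Integration along the `ρ`-lines -/

section

variable {n : ℕ} {Ω : Set (Fin (n + 1) → ℝ)} {f : (Fin (n + 1) → ℝ) → ℝ} {y : Fin n → ℝ} {ρ : ℝ}

lemma hasDerivAt_slice (hΩ : IsOpen Ω) (hf : ContDiffOn ℝ ∞ f Ω)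
    (hρ : (Fin.cons ρ y : Fin (n + 1) → ℝ) ∈ Ω) :
    HasDerivAt (fun σ : ℝ => f (Fin.cons σ y)) (pderiv 0 f (Fin.cons ρ y)) ρ := by
  have h := pderiv_eq_deriv 0 (differentiableAt_of_contDiffOn hΩ hf hρ)
  simpa only [Fin.update_cons_zero, Fin.cons_zero] using h

/-- The fundamental theorem of calculus in the first coordinate. -/
lemma integral_pderiv_zero (hΩ : IsOpen Ω) (hf : ContDiffOn ℝ ∞ f Ω)
    (hy : ∀ σ ∈ Set.uIcc 0 ρ, (Fin.cons σ y : Fin (n + 1) → ℝ) ∈ Ω) :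
    IntervalIntegrable (fun σ : ℝ => pderiv 0 f (Fin.cons σ y)) MeasureTheory.volume 0 ρ ∧
      ∫ σ in (0 : ℝ)..ρ, pderiv 0 f (Fin.cons σ y) = f (Fin.cons ρ y) - f (Fin.cons 0 y) := by
  have hc : Continuous (fun ρ : ℝ => (Fin.cons ρ y : Fin (n + 1) → ℝ)) :=
    Continuous.finCons (A := fun _ => ℝ) continuous_id continuous_const
  have hi : IntervalIntegrable (fun σ : ℝ => pderiv 0 f (Fin.cons σ y))
      MeasureTheory.volume 0 ρ :=
    ((pderiv_contDiffOn hΩ hf 0).continuousOn.comp hc.continuousOn hy).intervalIntegrable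
  exact ⟨hi, intervalIntegral.integral_eq_sub_of_hasDerivAt
    (fun σ hσ => hasDerivAt_slice hΩ hf (hy σ hσ)) hi⟩

lemma eq_of_pderiv_zero_eq_zero (hΩ : IsOpen Ω) (hf : ContDiffOn ℝ ∞ f Ω)
    (h0 : ∀ z ∈ Ω, pderiv 0 f z = 0)
    (hy : ∀ σ ∈ Set.uIcc 0 ρ, (Fin.cons σ y : Fin (n + 1) → ℝ) ∈ Ω) :
    f (Fin.cons ρ y) = f (Fin.cons 0 y) := by
  have h := (integral_pderiv_zero hΩ hf hy).2
  rw [intervalIntegral.integral_congr (g := fun _ => (0 : ℝ)) fun σ hσ => h0 _ (hy σ hσ)] at h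
  simp only [intervalIntegral.integral_zero] at h
  linarith

end

section

variable {d : ℕ} {M : Type*} [TopologicalSpace M] [ChartedSpace (Fin d → ℝ) M]
  {np nq : ℕ} {C : WeylClass d M np nq}
  {P : Type*} [TopologicalSpace P] [ChartedSpace (Fin (d + 1) → ℝ) P]
  {W : WeylStructure C P} {r : WeylPair d M np nq}
  {e : OpenPartialHomeomorph M (Fin d → ℝ)} {V : Set M}
  {E : OpenPartialHomeomorph P (Fin (d + 1) → ℝ)} {z : Fin (d + 2) → ℝ}
  {S : PreAmbient W} {A : ∀ (p : P) (_ : ℝ), Tan (d + 1) p × ℝ}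

/-- All tangent spaces unfold to the same model space; comparing vectors there avoids transport when
two base points agree only propositionally. -/
lemma PreAmbient.metric_congr (S : PreAmbient W) {p p' : P} (hp : p = p') {ρ : ℝ}
    {v w : Tan (d + 1) p × ℝ} {v' w' : Tan (d + 1) p' × ℝ}
    (hv : (v.1 : Fin (d + 1) → ℝ) = v'.1) (hv2 : v.2 = v'.2)
    (hw : (w.1 : Fin (d + 1) → ℝ) = w'.1) (hw2 : w.2 = w'.2) :
    S.metric p ρ v w = S.metric p' ρ v' w' := by
  subst hp
  obtain rfl : v = v' := Prod.ext hv hv2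
  obtain rfl : w = w' := Prod.ext hw hw2
  rfl

lemma isOpen_coordDomain {n : ℕ} {X : Type*} [TopologicalSpace X]
    (e : OpenPartialHomeomorph X (Fin n → ℝ)) {D : Set (X × ℝ)} (hD : IsOpen D) :
    IsOpen (coordDomain e D) := by
  have ht : Continuous (fun z : Fin (n + 1) → ℝ => (Fin.tail z : Fin n → ℝ)) :=
    contDiff_tail.continuous
  have hc : ContinuousOn (fun z : Fin (n + 1) → ℝ => (e.symm (Fin.tail z), z 0))
      ((fun z : Fin (n + 1) → ℝ => (Fin.tail z : Fin n → ℝ)) ⁻¹' e.target) :=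
    (e.continuousOn_symm.comp ht.continuousOn fun _ h => h).prodMk
      (continuous_apply 0).continuousOn
  exact hc.isOpen_inter_preimage (e.open_target.preimage ht) hD

lemma exists_eq_sum_frame (hE : E ∈ Charts (d + 1) P) (hz : Fin.tail z ∈ E.target)
    (w : Tan (d + 1) (E.symm (Fin.tail z)) × ℝ) :
    ∃ c : Fin (d + 2) → ℝ, w = ∑ I, c I • frame E z I := by
  obtain ⟨c, hc⟩ := exists_eq_sum_coordVec hE hz w.1
  refine ⟨Fin.cons w.2 c, ?_⟩
  rw [Fin.sum_univ_succ]
  refine Prod.ext ?_ ?_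
  · simp [frame, Prod.fst_sum, ← hc]
  · simp [frame, Prod.snd_sum]

lemma eq_zero_of_sum_frame (hE : E ∈ Charts (d + 1) P) (hz : Fin.tail z ∈ E.target)
    {c : Fin (d + 2) → ℝ} (h : ∑ I, c I • frame E z I = 0) : c = 0 := by
  rw [Fin.sum_univ_succ] at h
  have h1 := congrArg Prod.fst h
  have h2 := congrArg Prod.snd h
  simp only [frame, Fin.cons_zero, Fin.cons_succ, Prod.fst_add, Prod.snd_add, Prod.fst_sum,
    Prod.snd_sum, Prod.smul_fst, Prod.smul_snd, smul_zero, smul_eq_mul, mul_one, mul_zero,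
    Finset.sum_const_zero, zero_add, add_zero, Prod.fst_zero, Prod.snd_zero] at h1 h2
  have h3 : (fun i => c (Fin.succ i)) = fun _ => 0 :=
    sum_coordVec_injective hE hz (by simpa using h1)
  ext I
  refine Fin.cases h2 (fun i => congrFun h3 i) I

lemma comps_apply (G : ∀ (p : P) (_ : ℝ), LinearMap.BilinForm ℝ (Tan (d + 1) p × ℝ))
    (E : OpenPartialHomeomorph P (Fin (d + 1) → ℝ)) (z : Fin (d + 2) → ℝ) (I J : Fin (d + 2)) :
    comps G E z I J = G (E.symm (Fin.tail z)) (z 0) (frame E z I) (frame E z J) := rfl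

lemma PreAmbient.isMetricOn (S : PreAmbient W) (hE : E ∈ Charts (d + 1) P) :
    IsMetricOn (coordDomain E S.dom) (comps S.metric E) where
  isOpen := isOpen_coordDomain E S.isOpen_dom
  smooth := S.smooth E hE
  symm _ hz _ _ := (S.signature _ _ hz.2).symm _ _
  det_ne z hz h0 := by
    obtain ⟨v, hv, hv0⟩ := Matrix.exists_mulVec_eq_zero_iff.2 h0
    refine hv (eq_zero_of_sum_frame hE hz.1
      ((S.signature _ _ hz.2).eq_zero_of_forall fun x => ?_))
    obtain ⟨c, rfl⟩ := exists_eq_sum_frame hE hz.1 x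
    have h1 : ∀ I, S.metric (E.symm (Fin.tail z)) (z 0) (frame E z I)
        (∑ J, v J • frame E z J) = 0 := fun I => by
      have := congrFun hv0 I
      simp only [Matrix.mulVec, dotProduct, comps_apply, Pi.zero_apply] at this
      rw [map_sum, ← this]
      exact Finset.sum_congr rfl fun J _ => by rw [map_smul, smul_eq_mul, mul_comm]
    rw [map_sum (S.metric (E.symm (Fin.tail z)) (z 0)), LinearMap.sum_apply]
    exact Finset.sum_eq_zero fun I _ => by rw [map_smul, LinearMap.smul_apply, h1, smul_zero]

lemma tail_update_one (z : Fin (d + 2) → ℝ) (t : ℝ) :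
    (Fin.tail (Function.update z 1 t) : Fin (d + 1) → ℝ) = Fin.cons t (Fin.tail (Fin.tail z)) := by
  ext i
  refine Fin.cases ?_ (fun j => ?_) i
  · simp [Fin.tail]
  · simp [Fin.tail, IsNormalMetricOn.succ_ne_one]

/-- The homogeneity of the metric, in components. -/
lemma PreAmbient.comps_update (S : PreAmbient W) (h : W.IsAdapted r e V E)
    (hz : z ∈ coordDomain E S.dom) {s : ℝ} (hs : 0 < s) (I J : Fin (d + 2)) :
    comps S.metric E (Function.update z 1 (z 1 + Real.log s)) I J =
      s ^ 2 * comps S.metric E z I J := by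
  rw [comps_apply, comps_apply, ← S.homogeneous s hs _ _ hz.2]
  have h0 : Function.update z 1 (z 1 + Real.log s) 0 = z 0 :=
    Function.update_of_ne (by simp) _ _
  rw [h0]
  have hfr : ∀ I, ((frame E (Function.update z 1 (z 1 + Real.log s)) I).1 : Fin (d + 1) → ℝ) =
      W.dilT s (E.symm (Fin.tail z)) (frame E z I).1 ∧
      (frame E (Function.update z 1 (z 1 + Real.log s)) I).2 = (frame E z I).2 := fun I => by
    refine Fin.cases ?_ (fun i => ?_) I
    · exact ⟨(map_zero (W.dilT s (E.symm (Fin.tail z)))).symm, rfl⟩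
    · refine ⟨?_, rfl⟩
      refine Eq.trans ?_ (h.dilT_coordVec hz.1 hs i).symm
      simp only [frame, Fin.cons_succ]
      rw [tail_update_one]
      rfl
  refine S.metric_congr ?_ (hfr I).1 (hfr I).2 (hfr J).1 (hfr J).2
  rw [h.dil_symm hz.1 hs, tail_update_one]
  rfl

/-- The homogeneity with `s = exp(t - z 1)`, differentiated at `t = z 1`. -/
lemma PreAmbient.pderiv_one_comps (S : PreAmbient W) (h : W.IsAdapted r e V E)
    (hz : z ∈ coordDomain E S.dom) (I J : Fin (d + 2)) :
    pderiv 1 (fun z => comps S.metric E z I J) z = 2 * comps S.metric E z I J := by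
  have hG := S.isMetricOn h.mem
  have h1 := pderiv_eq_deriv 1 (hG.diff hz I J)
  have h2 : HasDerivAt (fun t : ℝ => Real.exp (t - z 1) ^ 2 * comps S.metric E z I J)
      (2 * comps S.metric E z I J) (z 1) := by
    have := ((((hasDerivAt_id (z 1)).sub_const (z 1)).exp.pow 2).mul_const
      (comps S.metric E z I J))
    simpa using this
  refine h1.unique (h2.congr_of_eventuallyEq (Filter.Eventually.of_forall fun t => ?_))
  have := S.comps_update h hz (Real.exp_pos (t - z 1)) I J
  rwa [Real.log_exp, add_sub_cancel] at this

/-- The acceleration in components. -/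
lemma PreAmbient.IsWeylNormal.metric_acceleration (hA : S.IsWeylNormal r A)
    (h : W.IsAdapted r e V E) (hz : z ∈ coordDomain E S.dom) (J : Fin (d + 2)) :
    S.metric (E.symm (Fin.tail z)) (z 0) (A (E.symm (Fin.tail z)) (z 0)) (frame E z J) =
      pderiv 0 (fun z => comps S.metric E z 0 J) z -
        (1 / 2) * pderiv J (fun z => comps S.metric E z 0 0) z := by
  have hG := S.isMetricOn h.mem
  have h1 := hG.sum_mul_christoffel hz J 0 0
  rw [hA.acceleration E h.mem z hz, map_sum, LinearMap.sum_apply]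
  have h2 : ∀ K, S.metric (E.symm (Fin.tail z)) (z 0)
      (christoffel (comps S.metric E) K 0 0 z • frame E z K) (frame E z J) =
      comps S.metric E z J K * christoffel (comps S.metric E) K 0 0 z := fun K => by
    rw [map_smul, LinearMap.smul_apply, smul_eq_mul, hG.symm z hz J K, mul_comm, comps_apply]
  rw [Finset.sum_congr rfl fun K _ => h2 K, h1]
  ring

lemma cons_mem_coordDomain {n : ℕ} {X : Type*} [TopologicalSpace X]
    {e : OpenPartialHomeomorph X (Fin n → ℝ)} {D : Set (X × ℝ)} {ρ : ℝ} {y : Fin n → ℝ} :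
    (Fin.cons ρ y : Fin (n + 1) → ℝ) ∈ coordDomain e D ↔ y ∈ e.target ∧ (e.symm y, ρ) ∈ D := by
  simp [coordDomain]

lemma PreAmbient.IsWeylNormal.segment_mem (hA : S.IsWeylNormal r A)
    {u : Fin (d + 1) → ℝ} {ρ : ℝ}
    (hz : (Fin.cons ρ u : Fin (d + 2) → ℝ) ∈ coordDomain E S.dom) (σ : ℝ)
    (hσ : σ ∈ Set.uIcc 0 ρ) : (Fin.cons σ u : Fin (d + 2) → ℝ) ∈ coordDomain E S.dom := by
  rw [cons_mem_coordDomain] at hz ⊢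
  exact ⟨hz.1, (hA.interval (E.symm u)).uIcc_subset (S.zero_mem _) hz.2 hσ⟩

/-- Orthogonality of the acceleration to `∂_ρ` says `½ ∂₀G₀₀ = 0`, the initial metric has no `dρ²`
term, and each `ρ`-slice is an interval containing `0`. -/
lemma PreAmbient.IsWeylNormal.comps_zero_zero (hA : S.IsWeylNormal r A)
    (h : W.IsAdapted r e V E) (hz : z ∈ coordDomain E S.dom) :
    comps S.metric E z 0 0 = 0 := by
  have hG := S.isMetricOn h.mem
  have h0 : ∀ z ∈ coordDomain E S.dom, pderiv 0 (fun z => comps S.metric E z 0 0) z = 0 := by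
    intro z hz
    have h1 := hA.metric_acceleration h hz 0
    have h2 := hA.orthogonal_velocity _ _ hz.2
    rw [(S.signature _ _ hz.2).symm] at h2
    have h3 : frame E z 0 = (0, 1) := rfl
    rw [h3, h2] at h1
    linarith
  rw [← Fin.cons_self_tail z] at hz ⊢
  rw [eq_of_pderiv_zero_eq_zero hG.isOpen (hG.smooth 0 0) h0 (hA.segment_mem hz), comps_apply]
  have h3 : frame E (Fin.cons 0 (Fin.tail z)) 0 = (0, 1) := rfl
  rw [Fin.cons_zero, hA.initial, h3]
  simp

/-- Since `G₀₀` vanishes identically, orthogonality of the acceleration to `T` becomes `∂₀G₀₁ = 0`.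
-/
lemma PreAmbient.IsWeylNormal.comps_zero_one (hA : S.IsWeylNormal r A)
    (h : W.IsAdapted r e V E) (hz : z ∈ coordDomain E S.dom) :
    comps S.metric E z 0 1 = Real.exp (z 1) ^ 2 := by
  have hG := S.isMetricOn h.mem
  have h0 : ∀ z ∈ coordDomain E S.dom, pderiv 0 (fun z => comps S.metric E z 0 1) z = 0 := by
    intro z hz
    have h1 := hA.metric_acceleration h hz 1
    have h2 := hA.orthogonal_gen _ _ hz.2
    rw [(S.signature _ _ hz.2).symm, h.gen_symm hz.1] at h2
    have h3 : frame E z 1 = (coordVec E (Fin.tail z) 0, 0) := rfl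
    rw [h3, h2, pderiv_congr hG.isOpen (fun z hz => hA.comps_zero_zero h hz) hz,
      pderiv_const] at h1
    linarith
  obtain ⟨ρ, u, rfl⟩ : ∃ ρ u, z = Fin.cons ρ u := ⟨z 0, Fin.tail z, (Fin.cons_self_tail z).symm⟩
  have hu := (cons_mem_coordDomain.1 hz).1
  rw [eq_of_pderiv_zero_eq_zero hG.isOpen (hG.smooth 0 1) h0 (hA.segment_mem hz)]
  have e1 : comps S.metric E (Fin.cons 0 u) 0 1 =
      S.metric (E.symm u) 0 (0, 1) (coordVec E u 0, 0) := rfl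
  have e2 : (Fin.cons ρ u : Fin (d + 2) → ℝ) 1 = u 0 := rfl
  have hexp := (Real.exp_pos (u 0)).ne'
  rw [e1, e2, hA.initial, h.projT_coordVec_zero hu, h.dt_coordVec_zero hu, h.fibre_symm hu]
  simp [hexp]

/-- At `ρ = 0` the generator of the dilatations is orthogonal to `P`. -/
lemma PreAmbient.comps_one_succ_init (S : PreAmbient W) (h : W.IsAdapted r e V E)
    (hz : z ∈ coordDomain E S.dom) (h0 : z 0 = 0) (i : Fin (d + 1)) :
    comps S.metric E z 1 i.succ = 0 := by
  have e1 : comps S.metric E z 1 i.succ = S.metric (E.symm (Fin.tail z)) (z 0)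
    (coordVec E (Fin.tail z) 0, 0) (coordVec E (Fin.tail z) i, 0) := rfl
  rw [e1, h0, S.pullback, h.projT_coordVec_zero hz.1]
  simp

theorem PreAmbient.IsWeylNormal.isNormalMetricOn (hA : S.IsWeylNormal r A)
    (h : W.IsAdapted r e V E) :
    IsNormalMetricOn (coordDomain E S.dom) (comps S.metric E) where
  toIsMetricOn := S.isMetricOn h.mem
  hom _ hz := S.pderiv_one_comps h hz
  rt z hz i hi := by
    rw [pderiv_congr (S.isMetricOn h.mem).isOpen (fun z hz => hA.comps_zero_one h hz) hz]
    have h1 : HasFDerivAt (fun z : Fin (d + 2) → ℝ => Real.exp (z 1))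
        (Real.exp (z 1) • ContinuousLinearMap.proj (R := ℝ) (φ := fun _ : Fin (d + 2) => ℝ) 1) z :=
      (ContinuousLinearMap.proj (R := ℝ) (φ := fun _ : Fin (d + 2) => ℝ) 1).hasFDerivAt.exp
    rw [pderiv, (h1.pow 2).fderiv]
    simp [hi.symm]
  rt_ne z hz := by
    rw [hA.comps_zero_one h hz]
    positivity
  tt_init z hz h0 := S.comps_one_succ_init h hz h0 0
  tx_init z hz h0 k := S.comps_one_succ_init h hz h0 k.succ

lemma PreAmbient.IsAmbient.ricci_vanishesTo (hS : S.IsAmbient) (hE : E ∈ Charts (d + 1) P)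
    (I J : Fin (d + 2)) (m : ℕ) :
    VanishesTo (coordDomain E S.dom) m (ricci (comps S.metric E) I J) := by
  have hG := S.isMetricOn hE
  rw [vanishesTo_iff_iteratedDeriv hG.isOpen (hG.ricci_smooth I J)]
  exact fun y hy k _ => hS E hE y (cons_mem_coordDomain.1 hy).1 I J k

end

/-! ### The families of tensors on the base -/

section

variable {d : ℕ} {M : Type*} [TopologicalSpace M] [ChartedSpace (Fin d → ℝ) M]
  {np nq : ℕ} {C : WeylClass d M np nq}
  {P : Type*} [TopologicalSpace P] [ChartedSpace (Fin (d + 1) → ℝ) P]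
  {W : WeylStructure C P} {r : WeylPair d M np nq}
  {e : OpenPartialHomeomorph M (Fin d → ℝ)} {V : Set M}
  {E : OpenPartialHomeomorph P (Fin (d + 1) → ℝ)} {u : Fin (d + 1) → ℝ}
  {S : PreAmbient W} {A : ∀ (p : P) (_ : ℝ), Tan (d + 1) p × ℝ}

/-! ### Horizontal vectors and descent to the base -/

section Horizontal

variable [IsManifold 𝓘(ℝ, Fin d → ℝ) ∞ M] [IsManifold 𝓘(ℝ, Fin (d + 1) → ℝ) ∞ P]

lemma WeylStructure.exists_isAdapted_symm (W : WeylStructure C P) (hr : r ∈ C.reps) (p : P) :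
    ∃ e V E, W.IsAdapted r e V E ∧ ∃ u ∈ E.target, p = E.symm u := by
  obtain ⟨V, E, hV, h⟩ := W.exists_isAdapted hr
    (IsManifold.chart_mem_maximalAtlas (I := 𝓘(ℝ, Fin d → ℝ)) (n := ∞) (W.proj p))
    (mem_chart_source (Fin d → ℝ) (W.proj p))
  have hp : p ∈ E.source := by rw [h.source_eq]; exact hV
  exact ⟨_, V, E, h, E p, E.map_source hp, (E.left_inv hp).symm⟩

lemma WeylStructure.dt_gen (W : WeylStructure C P) (hr : r ∈ C.reps) (p : P) :
    W.dt r p (W.gen p) = W.fibre r p := by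
  obtain ⟨e, V, E, h, u, hu, rfl⟩ := W.exists_isAdapted_symm hr p
  rw [h.gen_symm hu, h.dt_coordVec_zero hu, h.fibre_symm hu]

lemma WeylStructure.projT_gen (W : WeylStructure C P) (hr : r ∈ C.reps) (p : P) :
    W.projT p (W.gen p) = 0 := by
  obtain ⟨e, V, E, h, u, hu, rfl⟩ := W.exists_isAdapted_symm hr p
  rw [h.gen_symm hu, h.projT_coordVec_zero hu]

/-- Points of one fibre have the same `x` in an adapted chart, and their values of `ln t` differ by
a translation. -/
lemma WeylStructure.eq_dil_of_proj_eq (W : WeylStructure C P) (hr : r ∈ C.reps) {p p' : P}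
    (hp : W.proj p' = W.proj p) : p' = W.dil (W.fibre r p' / W.fibre r p) p := by
  obtain ⟨e, V, E, h, u, hu, rfl⟩ := W.exists_isAdapted_symm hr p
  have hs : 0 < W.fibre r p' / W.fibre r (E.symm u) :=
    div_pos (W.fibre_pos r hr _) (W.fibre_pos r hr _)
  have hp' : p' ∈ E.source := by
    have := E.map_target hu
    rw [h.source_eq] at this ⊢
    rwa [Set.mem_preimage, hp]
  rw [h.dil_symm hu hs, E.eq_symm_apply hp' (h.cons_mem hu _), h.apply_eq _ hp', hp,
    h.proj_symm hu, e.right_inv (h.tail_mem hu), Real.log_div (W.fibre_pos r hr _).ne'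
    (W.fibre_pos r hr _).ne', h.fibre_symm hu, Real.log_exp, add_sub_cancel]

/-- The projection is already onto when restricted to the kernel of `dt`. Choosing the right inverse
linear is what makes the tensors on the base linear. -/
lemma WeylStructure.exists_horizontal_lift (W : WeylStructure C P) (hr : r ∈ C.reps) (p : P) :
    ∃ L : Tan d (W.proj p) →ₗ[ℝ] Tan (d + 1) p, ∀ v, W.dt r p (L v) = 0 ∧ W.projT p (L v) = v := by
  obtain ⟨e, V, E, h, u, hu, rfl⟩ := W.exists_isAdapted_symm hr p
  have hsurj : Function.Surjective
      (W.projT (E.symm u) ∘ₗ (LinearMap.ker (W.dt r (E.symm u))).subtype) := by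
    intro v
    obtain ⟨c, hc⟩ := exists_mfderiv_symm_eq h.base_mem (h.tail_mem hu) v
    refine ⟨⟨mfderiv 𝓘(ℝ, Fin (d + 1) → ℝ) 𝓘(ℝ, Fin (d + 1) → ℝ) E.symm u
      (Fin.cons 0 c : Fin (d + 1) → ℝ), ?_⟩, ?_⟩
    · rw [LinearMap.mem_ker]
      refine (h.dt_mfderiv hu (Fin.cons 0 c)).trans ?_
      simp
    · refine (h.projT_mfderiv hu (Fin.cons 0 c)).trans ?_
      rw [Fin.tail_cons]
      exact hc
  obtain ⟨L, hL⟩ := LinearMap.exists_rightInverse_of_surjective _ (LinearMap.range_eq_top.2 hsurj)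
  exact ⟨(LinearMap.ker (W.dt r (E.symm u))).subtype ∘ₗ L, fun v =>
    ⟨LinearMap.mem_ker.1 (L v).2, LinearMap.congr_fun hL v⟩⟩

/-- A horizontal vector is mapped by the dilatation to the horizontal vector with the same
projection. -/
lemma WeylStructure.eq_dilT (W : WeylStructure C P) (hr : r ∈ C.reps) {p : P} {s : ℝ} (hs : 0 < s)
    {w : Tan (d + 1) p} {w' : Tan (d + 1) (W.dil s p)} (hw : W.dt r p w = 0)
    (hw' : W.dt r (W.dil s p) w' = 0)
    (hww' : (W.projT p w : Fin d → ℝ) = W.projT (W.dil s p) w') : w' = W.dilT s p w := by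
  obtain ⟨e, V, E, h, u, hu, rfl⟩ := W.exists_isAdapted_symm hr p
  have hmem := h.cons_mem hu (u 0 + Real.log s)
  obtain ⟨c, rfl⟩ := exists_mfderiv_symm_eq h.mem hu w
  -- The dilated point equals its chart expression only propositionally; generalizing it to `q`
  -- allows the equation to be substituted.
  have key : ∀ (q : P) (hq : q = E.symm (Fin.cons (u 0 + Real.log s) (Fin.tail u)))
      (w' : Tan (d + 1) q), W.dt r q w' = 0 →
      (mfderiv 𝓘(ℝ, Fin d → ℝ) 𝓘(ℝ, Fin d → ℝ) e.symm (Fin.tail u) (Fin.tail c) : Fin d → ℝ) =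
        W.projT q w' → (w' : Fin (d + 1) → ℝ) =
      mfderiv 𝓘(ℝ, Fin (d + 1) → ℝ) 𝓘(ℝ, Fin (d + 1) → ℝ) E.symm
        (Fin.cons (u 0 + Real.log s) (Fin.tail u)) c := by
    rintro q rfl w' h1 h2
    obtain ⟨c', rfl⟩ := exists_mfderiv_symm_eq h.mem hmem w'
    have e1 : c 0 = 0 := by
      have := (h.dt_mfderiv hu c).symm.trans hw
      exact (mul_eq_zero.1 this).resolve_left (Real.exp_pos _).ne'
    have e2 : c' 0 = 0 := by
      have := (h.dt_mfderiv hmem c').symm.trans h1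
      exact (mul_eq_zero.1 this).resolve_left (Real.exp_pos _).ne'
    have e3 : (Fin.tail c : Fin d → ℝ) = Fin.tail c' := by
      refine (mfderiv_symm_bijective h.base_mem (h.tail_mem hu)).1 ?_
      exact h2.trans (h.projT_mfderiv hmem c')
    have e4 : c = c' := by
      rw [← Fin.cons_self_tail c, ← Fin.cons_self_tail c', e1, e2, e3]
    rw [e4]
  refine (key _ (h.dil_symm hu hs) w' hw' ((h.projT_mfderiv hu c).symm.trans hww')).trans ?_
  have e5 : (W.dilT s (E.symm u)
      (mfderiv 𝓘(ℝ, Fin (d + 1) → ℝ) 𝓘(ℝ, Fin (d + 1) → ℝ) E.symm u c) : Fin (d + 1) → ℝ) =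
      ∑ i, c i • W.dilT s (E.symm u) (coordVec E u i) := by
    rw [mfderiv_symm_eq_sum, map_sum]
    exact Finset.sum_congr rfl fun i _ => map_smul _ _ _
  rw [e5, mfderiv_symm_eq_sum]
  exact Finset.sum_congr rfl fun i _ =>
    congrArg (fun v : Fin (d + 1) → ℝ => c i • v) (h.dilT_coordVec hu hs i).symm

lemma PreAmbient.mem_dom_of_proj_eq (S : PreAmbient W) (hr : r ∈ C.reps) {p p' : P}
    (hp : W.proj p' = W.proj p) {ρ : ℝ} (hd : (p, ρ) ∈ S.dom) : (p', ρ) ∈ S.dom := by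
  rw [W.eq_dil_of_proj_eq hr hp]
  exact S.dil_mem _ (div_pos (W.fibre_pos r hr _) (W.fibre_pos r hr _)) _ _ hd

/-- On horizontal vectors `t⁻² g̃` only depends on the projections to `M`. -/
lemma PreAmbient.metric_horizontal (S : PreAmbient W) (hr : r ∈ C.reps) {p p' : P}
    (hp : W.proj p' = W.proj p) {ρ : ℝ} (hd : (p, ρ) ∈ S.dom) {w₁ w₂ : Tan (d + 1) p}
    {w₁' w₂' : Tan (d + 1) p'} (h₁ : W.dt r p w₁ = 0) (h₂ : W.dt r p w₂ = 0)
    (h₁' : W.dt r p' w₁' = 0) (h₂' : W.dt r p' w₂' = 0)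
    (hw₁ : (W.projT p w₁ : Fin d → ℝ) = W.projT p' w₁')
    (hw₂ : (W.projT p w₂ : Fin d → ℝ) = W.projT p' w₂') (a₁ a₂ : ℝ) :
    ((W.fibre r p') ^ 2)⁻¹ * S.metric p' ρ (w₁', a₁) (w₂', a₂) =
      ((W.fibre r p) ^ 2)⁻¹ * S.metric p ρ (w₁, a₁) (w₂, a₂) := by
  have hs : 0 < W.fibre r p' / W.fibre r p :=
    div_pos (W.fibre_pos r hr _) (W.fibre_pos r hr _)
  have hpp := W.eq_dil_of_proj_eq hr hp
  -- The ratio involves `p'`, so its value has to be forgotten before `p'` is replaced by `δ_s p`.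
  set s := W.fibre r p' / W.fibre r p
  clear_value s
  subst hpp
  have hhom := S.homogeneous s hs p ρ hd (w₁, a₁) (w₂, a₂)
  rw [← W.eq_dilT hr hs h₁ h₁' hw₁, ← W.eq_dilT hr hs h₂ h₂' hw₂] at hhom
  rw [hhom, W.fibre_dil r hr s hs]
  have := (W.fibre_pos r hr p).ne'
  field_simp

/-- One point of the fibre and one lift define the form; `metric_horizontal` shows that every other
choice gives the same value, which is the independence of `t`. Over points not covered by the domain
the form is set to zero arbitrarily. -/
lemma PreAmbient.exists_oneForm (S : PreAmbient W) (hr : r ∈ C.reps) (x : M) (ρ : ℝ) :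
    ∃ α : Tan d x →ₗ[ℝ] ℝ, ∀ p, W.proj p = x → (p, ρ) ∈ S.dom → ∀ w : Tan (d + 1) p,
      W.dt r p w = 0 → ∀ v : Tan d x, (W.projT p w : Fin d → ℝ) = v →
      α v = ((W.fibre r p) ^ 2)⁻¹ * S.metric p ρ (w, 0) (0, 1) := by
  obtain ⟨p, rfl⟩ := W.exists_proj_eq x
  by_cases hd : (p, ρ) ∈ S.dom
  · obtain ⟨L, hL⟩ := W.exists_horizontal_lift hr p
    refine ⟨((W.fibre r p) ^ 2)⁻¹ • (S.metric p ρ).flip (0, 1) ∘ₗ LinearMap.inl ℝ _ ℝ ∘ₗ L,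
      fun p' hp' _ w hw v hv => ?_⟩
    refine (S.metric_horizontal hr hp' hd (w₁ := L v) (w₂ := 0) (w₂' := 0) (hL v).1
      (map_zero _) hw (map_zero _) ?_ ?_ 0 1).symm
    · rw [(hL v).2, hv]
    · exact (map_zero (W.projT p)).trans (map_zero (W.projT p')).symm
  · exact ⟨0, fun p' hp' hd' => absurd (S.mem_dom_of_proj_eq hr hp'.symm hd') hd⟩

lemma PreAmbient.exists_bilinForm (S : PreAmbient W) (hr : r ∈ C.reps) (x : M) (ρ : ℝ) :
    ∃ γ : LinearMap.BilinForm ℝ (Tan d x), ∀ p, W.proj p = x → (p, ρ) ∈ S.dom →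
      ∀ w₁ w₂ : Tan (d + 1) p, W.dt r p w₁ = 0 → W.dt r p w₂ = 0 → ∀ v₁ v₂ : Tan d x,
      (W.projT p w₁ : Fin d → ℝ) = v₁ → (W.projT p w₂ : Fin d → ℝ) = v₂ →
      γ v₁ v₂ = ((W.fibre r p) ^ 2)⁻¹ * S.metric p ρ (w₁, 0) (w₂, 0) := by
  obtain ⟨p, rfl⟩ := W.exists_proj_eq x
  by_cases hd : (p, ρ) ∈ S.dom
  · obtain ⟨L, hL⟩ := W.exists_horizontal_lift hr p
    refine ⟨((W.fibre r p) ^ 2)⁻¹ • (S.metric p ρ).compl₁₂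
      (LinearMap.inl ℝ _ ℝ ∘ₗ L) (LinearMap.inl ℝ _ ℝ ∘ₗ L),
      fun p' hp' _ w₁ w₂ hw₁ hw₂ v₁ v₂ hv₁ hv₂ => ?_⟩
    refine (S.metric_horizontal hr hp' hd (w₁ := L v₁) (w₂ := L v₂) (hL v₁).1
      (hL v₂).1 hw₁ hw₂ ?_ ?_ 0 0).symm
    · rw [(hL v₁).2, hv₁]
    · rw [(hL v₂).2, hv₂]
  · exact ⟨0, fun p' hp' hd' => absurd (S.mem_dom_of_proj_eq hr hp'.symm hd') hd⟩

/-- The components of the families on `M` in a chart of `M` are components of `g̃` along the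
section `t = 1`. -/
lemma PreAmbient.contDiffOn_base (S : PreAmbient W) (hr : r ∈ C.reps) (he : e ∈ Charts d M)
    {F : (Fin (d + 1) → ℝ) → ℝ} (I J : Fin (d + 2))
    (hF : ∀ V E, W.IsAdapted r e V E → ∀ z : Fin (d + 1) → ℝ,
      (Fin.cons 0 (Fin.tail z) : Fin (d + 1) → ℝ) ∈ E.target →
      (E.symm (Fin.cons 0 (Fin.tail z)), z 0) ∈ S.dom →
      F z = comps S.metric E (Fin.cons (z 0) (Fin.cons 0 (Fin.tail z))) I J) :
    ContDiffOn ℝ ∞ F (coordDomain e S.base) := by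
  intro z₀ hz₀
  obtain ⟨V, E, hV, h⟩ := W.exists_isAdapted hr he (e.map_target hz₀.1)
  let κ : (Fin (d + 1) → ℝ) → Fin (d + 2) → ℝ := fun z =>
    Fin.cons (z 0) (Fin.cons 0 (Fin.tail z))
  have hκ : ContDiff ℝ ∞ κ := by
    rw [← contDiffOn_univ]
    exact contDiff_cons (contDiff_apply ℝ ℝ 0).contDiffOn
      (contDiff_cons contDiffOn_const contDiff_tail.contDiffOn)
  have hmem : ∀ z ∈ coordDomain e S.base, e.symm (Fin.tail z) ∈ V →
      (Fin.cons 0 (Fin.tail z) : Fin (d + 1) → ℝ) ∈ E.target ∧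
      (E.symm (Fin.cons 0 (Fin.tail z)), z 0) ∈ S.dom := by
    intro z hz hzV
    have h1 : (Fin.cons 0 (Fin.tail z) : Fin (d + 1) → ℝ) ∈ E.target := by
      rw [h.target_eq]
      simpa using ⟨hz.1, hzV⟩
    obtain ⟨p, hp, hpd⟩ := hz.2
    refine ⟨h1, S.mem_dom_of_proj_eq hr ?_ hpd⟩
    rw [h.proj_symm h1, hp, Fin.tail_cons]
  have hκ₀ : κ z₀ ∈ coordDomain E S.dom :=
    cons_mem_coordDomain.2 (hmem z₀ hz₀ hV)
  have hG := S.isMetricOn h.mem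
  have hsm : ContDiffAt ℝ ∞ (fun z => comps S.metric E (κ z) I J) z₀ :=
    ((hG.smooth I J).contDiffAt (hG.isOpen.mem_nhds hκ₀)).comp z₀ hκ.contDiffAt
  have hVo : coordDomain e (V ×ˢ (Set.univ : Set ℝ)) ∈ nhds z₀ :=
    (isOpen_coordDomain e (h.isOpen.prod isOpen_univ)).mem_nhds ⟨hz₀.1, hV, trivial⟩
  have hFz : ∀ z ∈ coordDomain e S.base, e.symm (Fin.tail z) ∈ V →
      F z = comps S.metric E (κ z) I J := fun z hz hzV =>
    hF V E h z (hmem z hz hzV).1 (hmem z hz hzV).2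
  refine hsm.contDiffWithinAt.congr_of_eventuallyEq ?_ (hFz z₀ hz₀ hV)
  filter_upwards [self_mem_nhdsWithin, mem_nhdsWithin_of_mem_nhds hVo] with z hz hz'
  exact hFz z hz hz'.2.1

end Horizontal

end

/-! ### The normal form -/

section

variable {d : ℕ} {M : Type*} [TopologicalSpace M] [ChartedSpace (Fin d → ℝ) M]
  {np nq : ℕ} {C : WeylClass d M np nq}
  {P : Type*} [TopologicalSpace P] [ChartedSpace (Fin (d + 1) → ℝ) P]
  {W : WeylStructure C P} {r : WeylPair d M np nq}
  {e : OpenPartialHomeomorph M (Fin d → ℝ)} {V : Set M}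
  {E : OpenPartialHomeomorph P (Fin (d + 1) → ℝ)} {u : Fin (d + 1) → ℝ}
  {S : PreAmbient W} {A : ∀ (p : P) (_ : ℝ), Tan (d + 1) p × ℝ} {p : P} {ρ : ℝ}

lemma PreAmbient.metric_sum_right (S : PreAmbient W) (v : Tan (d + 1) (E.symm u) × ℝ)
    (c : Fin (d + 1) → ℝ) :
    S.metric (E.symm u) ρ v (∑ i, c i • coordVec E u i, 0) =
      ∑ i, c i * S.metric (E.symm u) ρ v (coordVec E u i, 0) := by
  have h1 : ((∑ i, c i • coordVec E u i, 0) : Tan (d + 1) (E.symm u) × ℝ) =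
      ∑ i, c i • (coordVec E u i, (0 : ℝ)) := by
    refine Prod.ext ?_ ?_
    · simp [Prod.fst_sum]
    · simp [Prod.snd_sum]
  rw [h1, map_sum]
  exact Finset.sum_congr rfl fun i _ => map_smul _ _ _

/-- The horizontal part of a tangent vector of `P`. -/
def WeylStructure.hor (W : WeylStructure C P) (r : WeylPair d M np nq) (p : P)
    (w : Tan (d + 1) p) : Tan (d + 1) p :=
  w - (W.dt r p w / W.fibre r p) • W.gen p

lemma WeylStructure.eq_gen_add_hor (W : WeylStructure C P) (w : Tan (d + 1) p) :
    w = (W.dt r p w / W.fibre r p) • W.gen p + W.hor r p w := by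
  rw [hor]; abel

lemma PreAmbient.metric_velocity_right (S : PreAmbient W) (r : WeylPair d M np nq)
    (w : Tan (d + 1) p × ℝ) :
    S.metric p ρ w (0, 1) = w.2 * S.metric p ρ (0, 1) (0, 1) +
      (W.dt r p w.1 / W.fibre r p) * S.metric p ρ (W.gen p, 0) (0, 1) +
      S.metric p ρ (W.hor r p w.1, 0) (0, 1) := by
  have h1 : w = w.2 • ((0, 1) : Tan (d + 1) p × ℝ) +
      (W.dt r p w.1 / W.fibre r p) • ((W.gen p, 0) : Tan (d + 1) p × ℝ) +
      (W.hor r p w.1, 0) := by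
    refine Prod.ext ?_ ?_
    · simp [← W.eq_gen_add_hor]
    · simp
  conv_lhs => rw [h1]
  simp only [map_add, map_smul, LinearMap.add_apply, LinearMap.smul_apply, smul_eq_mul]

lemma PreAmbient.metric_tangent (S : PreAmbient W) (hp : (p, ρ) ∈ S.dom) (r : WeylPair d M np nq)
    (w₁ w₂ : Tan (d + 1) p) :
    S.metric p ρ (w₁, 0) (w₂, 0) =
      (W.dt r p w₁ / W.fibre r p) * (W.dt r p w₂ / W.fibre r p) *
        S.metric p ρ (W.gen p, 0) (W.gen p, 0) +
      (W.dt r p w₁ / W.fibre r p) * S.metric p ρ (W.gen p, 0) (W.hor r p w₂, 0) +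
      (W.dt r p w₂ / W.fibre r p) * S.metric p ρ (W.gen p, 0) (W.hor r p w₁, 0) +
      S.metric p ρ (W.hor r p w₁, 0) (W.hor r p w₂, 0) := by
  have h1 : ∀ w : Tan (d + 1) p, ((w, 0) : Tan (d + 1) p × ℝ) =
      (W.dt r p w / W.fibre r p) • ((W.gen p, 0) : Tan (d + 1) p × ℝ) +
      (W.hor r p w, 0) := fun w => by
    refine Prod.ext ?_ ?_
    · simp [← W.eq_gen_add_hor]
    · simp
  conv_lhs => rw [h1 w₁, h1 w₂]
  simp only [map_add, map_smul, LinearMap.add_apply, LinearMap.smul_apply, smul_eq_mul]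
  rw [(S.signature p ρ hp).symm (W.hor r p w₁, 0) (W.gen p, 0)]
  ring

lemma PreAmbient.metric_split (S : PreAmbient W) (hp : (p, ρ) ∈ S.dom)
    (w₁ w₂ : Tan (d + 1) p × ℝ) :
    S.metric p ρ w₁ w₂ = w₁.2 * S.metric p ρ w₂ (0, 1) + w₂.2 * S.metric p ρ (w₁.1, 0) (0, 1) +
      S.metric p ρ (w₁.1, 0) (w₂.1, 0) := by
  have h1 : ∀ w : Tan (d + 1) p × ℝ, w = w.2 • ((0, 1) : Tan (d + 1) p × ℝ) + (w.1, 0) :=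
    fun w => by
      refine Prod.ext ?_ ?_
      · simp
      · simp
  conv_lhs => rw [h1 w₁]
  rw [map_add, map_smul, LinearMap.add_apply, LinearMap.smul_apply, smul_eq_mul,
    (S.signature p ρ hp).symm (0, 1) w₂, add_assoc]
  congr 1
  conv_lhs => rw [h1 w₂]
  rw [map_add, map_smul, smul_eq_mul]

variable [IsManifold 𝓘(ℝ, Fin d → ℝ) ∞ M] [IsManifold 𝓘(ℝ, Fin (d + 1) → ℝ) ∞ P]

/-- The integral of the acceleration. -/
lemma PreAmbient.IsWeylNormal.integral_acceleration (hA : S.IsWeylNormal r A) (hr : r ∈ C.reps)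
    (hp : (p, ρ) ∈ S.dom) (w : Tan (d + 1) p) :
    IntervalIntegrable (fun σ => S.metric p σ (A p σ) (w, 0)) MeasureTheory.volume 0 ρ ∧
      ∫ σ in (0 : ℝ)..ρ, S.metric p σ (A p σ) (w, 0) =
        S.metric p ρ (0, 1) (w, 0) - S.metric p 0 (0, 1) (w, 0) := by
  obtain ⟨e, V, E, h, u, hu, rfl⟩ := W.exists_isAdapted_symm hr p
  obtain ⟨c, rfl⟩ := exists_eq_sum_coordVec h.mem hu w
  have hG := S.isMetricOn h.mem
  have hz : (Fin.cons ρ u : Fin (d + 2) → ℝ) ∈ coordDomain E S.dom :=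
    cons_mem_coordDomain.2 ⟨hu, hp⟩
  have hseg := hA.segment_mem hz
  have h1 : ∀ i : Fin (d + 1), ∀ σ ∈ Set.uIcc 0 ρ,
      S.metric (E.symm u) σ (A (E.symm u) σ) (coordVec E u i, 0) =
        pderiv 0 (fun z => comps S.metric E z 0 i.succ) (Fin.cons σ u) := fun i σ hσ => by
    -- Because `G₀₀` is identically zero, the acceleration component is exactly `∂₀G_{0J}`, and the
    -- fundamental theorem of calculus applies.
    have h2 := hA.metric_acceleration h (hseg σ hσ) i.succ
    rw [pderiv_congr hG.isOpen (fun z hz => hA.comps_zero_zero h hz) (hseg σ hσ),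
      pderiv_const, mul_zero, sub_zero] at h2
    exact h2
  have h2 : ∀ i : Fin (d + 1), IntervalIntegrable
      (fun σ => S.metric (E.symm u) σ (A (E.symm u) σ) (coordVec E u i, 0))
      MeasureTheory.volume 0 ρ ∧
      ∫ σ in (0 : ℝ)..ρ, S.metric (E.symm u) σ (A (E.symm u) σ) (coordVec E u i, 0) =
        S.metric (E.symm u) ρ (0, 1) (coordVec E u i, 0) -
          S.metric (E.symm u) 0 (0, 1) (coordVec E u i, 0) := fun i => by
    have h3 := integral_pderiv_zero hG.isOpen (hG.smooth 0 i.succ) hseg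
    refine ⟨h3.1.congr fun σ hσ => (h1 i σ (Set.uIoc_subset_uIcc hσ)).symm, ?_⟩
    rw [intervalIntegral.integral_congr (h1 i), h3.2]
    rfl
  simp only [S.metric_sum_right]
  refine ⟨by
    simpa only [Finset.sum_fn] using IntervalIntegrable.sum Finset.univ
      (f := fun i σ => c i * S.metric (E.symm u) σ (A (E.symm u) σ) (coordVec E u i, 0))
      fun i _ => (h2 i).1.const_mul _, ?_⟩
  rw [intervalIntegral.integral_finsetSum fun i _ => (h2 i).1.const_mul _,
    ← Finset.sum_sub_distrib]
  refine Finset.sum_congr rfl fun i _ => ?_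
  rw [intervalIntegral.integral_const_mul, (h2 i).2]
  ring

lemma PreAmbient.IsWeylNormal.metric_velocity (hA : S.IsWeylNormal r A) (hr : r ∈ C.reps)
    (hp : (p, ρ) ∈ S.dom) : S.metric p ρ (0, 1) (0, 1) = 0 := by
  obtain ⟨e, V, E, h, u, hu, rfl⟩ := W.exists_isAdapted_symm hr p
  exact hA.comps_zero_zero h (z := Fin.cons ρ u) (cons_mem_coordDomain.2 ⟨hu, hp⟩)

lemma PreAmbient.IsWeylNormal.metric_gen_velocity (hA : S.IsWeylNormal r A) (hr : r ∈ C.reps)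
    (hp : (p, ρ) ∈ S.dom) : S.metric p ρ (W.gen p, 0) (0, 1) = (W.fibre r p) ^ 2 := by
  obtain ⟨e, V, E, h, u, hu, rfl⟩ := W.exists_isAdapted_symm hr p
  rw [(S.signature _ _ hp).symm, h.gen_symm hu, h.fibre_symm hu]
  exact hA.comps_zero_one h (z := Fin.cons ρ u) (cons_mem_coordDomain.2 ⟨hu, hp⟩)

lemma WeylStructure.dt_hor (W : WeylStructure C P) (hr : r ∈ C.reps) (w : Tan (d + 1) p) :
    W.dt r p (W.hor r p w) = 0 := by
  have := (W.fibre_pos r hr p).ne'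
  rw [hor, map_sub, map_smul, W.dt_gen hr, smul_eq_mul]
  field_simp
  ring

lemma WeylStructure.projT_hor (W : WeylStructure C P) (hr : r ∈ C.reps) (w : Tan (d + 1) p) :
    W.projT p (W.hor r p w) = W.projT p w := by
  rw [hor, map_sub, map_smul, W.projT_gen hr, smul_zero, sub_zero]

/-- The mixed components vanish to the order of the normal form. -/
lemma PreAmbient.IsWeylNormal.iteratedDeriv_eq_zero (hA : S.IsWeylNormal r A) (hd : 1 ≤ d)
    (hS : S.IsAmbient) (hr : r ∈ C.reps) {m : ℕ} (hm : Odd d ∨ 2 * m ≤ d) {w₁ w₂ : Tan (d + 1) p}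
    (h₁ : W.dt r p w₁ = 0) (h₂ : W.dt r p w₂ = 0) (a b c : ℝ) :
    iteratedDeriv m (fun ρ => a * (S.metric p ρ (W.gen p, 0) (W.gen p, 0) -
      2 * (ρ * (W.fibre r p) ^ 2)) + b * S.metric p ρ (W.gen p, 0) (w₁, 0) +
      c * S.metric p ρ (W.gen p, 0) (w₂, 0)) 0 = 0 := by
  obtain ⟨e, V, E, h, u, hu, rfl⟩ := W.exists_isAdapted_symm hr p
  have hG := hA.isNormalMetricOn h
  have hΩ := hG.isOpen
  have hN := hG.normalTo hd (fun m j => hS.ricci_vanishesTo h.mem 1 j m) hm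
  have hz : ∀ᶠ ρ in nhds (0 : ℝ), (Fin.cons ρ u : Fin (d + 2) → ℝ) ∈ coordDomain E S.dom := by
    have hc : Continuous (fun ρ : ℝ => (Fin.cons ρ u : Fin (d + 2) → ℝ)) :=
      Continuous.finCons (A := fun _ => ℝ) continuous_id continuous_const
    exact hc.continuousAt (hΩ.mem_nhds (cons_mem_coordDomain.2 ⟨hu, S.zero_mem _⟩))
  -- A vector killed by `dt` has no `ln t` component, so pairing it with `T` involves only the
  -- `G₁ₖ`, with coefficients constant in `ρ`.
  have hsum : ∀ w : Tan (d + 1) (E.symm u), W.dt r (E.symm u) w = 0 → ∃ x : Fin d → ℝ, ∀ ρ,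
      S.metric (E.symm u) ρ (W.gen (E.symm u), 0) (w, 0) =
        ∑ k, x k * comps S.metric E (Fin.cons ρ u) 1 k.succ.succ := by
    intro w hw
    obtain ⟨x, rfl⟩ := exists_eq_sum_coordVec h.mem hu w
    rw [← mfderiv_symm_eq_sum] at hw
    have hx : x 0 = 0 :=
      (mul_eq_zero.1 ((h.dt_mfderiv hu x).symm.trans hw)).resolve_left (Real.exp_pos _).ne'
    refine ⟨fun k => x k.succ, fun ρ => ?_⟩
    rw [S.metric_sum_right, Fin.sum_univ_succ, hx, zero_mul, zero_add, h.gen_symm hu]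
    rfl
  obtain ⟨x₁, hx₁⟩ := hsum w₁ h₁
  obtain ⟨x₂, hx₂⟩ := hsum w₂ h₂
  have hv : VanishesTo (coordDomain E S.dom) (m + 1) (fun z =>
      a * IsNormalMetricOn.phi (comps S.metric E) z +
      b * ∑ k, x₁ k * comps S.metric E z 1 k.succ.succ +
      c * ∑ k, x₂ k * comps S.metric E z 1 k.succ.succ) :=
    VanishesTo.add hΩ (VanishesTo.add hΩ (VanishesTo.const_mul hΩ a hN.tt)
      (VanishesTo.const_mul hΩ b (VanishesTo.sum hΩ _ fun k _ =>
        VanishesTo.const_mul hΩ _ (hN.tx k))))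
      (VanishesTo.const_mul hΩ c (VanishesTo.sum hΩ _ fun k _ =>
        VanishesTo.const_mul hΩ _ (hN.tx k)))
  refine (Filter.EventuallyEq.iteratedDeriv_eq m ?_).trans
    ((vanishesTo_iff_iteratedDeriv hΩ hv.smooth _).1 hv u
      (cons_mem_coordDomain.2 ⟨hu, S.zero_mem _⟩) m (by omega))
  filter_upwards [hz] with ρ hρ
  rw [hx₁, hx₂, IsNormalMetricOn.phi, hA.comps_zero_one h hρ, h.gen_symm hu, h.fibre_symm hu]
  rfl

end

end WeylAmbient

end

/-! ### Assembly of the normal form -/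

theorem mainTheorem3 {d np nq : ℕ} (hd : 1 ≤ d)
    {M : Type*} [TopologicalSpace M] [ChartedSpace (Fin d → ℝ) M]
    [IsManifold 𝓘(ℝ, Fin d → ℝ) ∞ M]
    {P : Type*} [TopologicalSpace P] [ChartedSpace (Fin (d + 1) → ℝ) P]
    [IsManifold 𝓘(ℝ, Fin (d + 1) → ℝ) ∞ P]
    (C : WeylAmbient.WeylClass d M np nq) (W : WeylAmbient.WeylStructure C P)
    (r : WeylAmbient.WeylPair d M np nq) (hr : r ∈ C.reps)
    (S : WeylAmbient.PreAmbient W) (hS : S.IsAmbient)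
    (A : ∀ (p : P) (_ : ℝ), WeylAmbient.Tan (d + 1) p × ℝ) (hA : S.IsWeylNormal r A) :
    ∃ (aρ : ∀ (x : M) (_ : ℝ), WeylAmbient.Tan d x →ₗ[ℝ] ℝ)
      (gρ : ∀ (x : M) (_ : ℝ), LinearMap.BilinForm ℝ (WeylAmbient.Tan d x)),
      -- `aρ` and `gρ` are smooth families of one-forms and symmetric two-tensors on `M`
      (∀ e ∈ WeylAmbient.Charts d M, ∀ i, ContDiffOn ℝ ∞
        (fun z : Fin (d + 1) → ℝ => aρ (e.symm (Fin.tail z)) (z 0)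
          (WeylAmbient.coordVec e (Fin.tail z) i))
        (WeylAmbient.coordDomain e S.base)) ∧
      (∀ e ∈ WeylAmbient.Charts d M, ∀ i j, ContDiffOn ℝ ∞
        (fun z : Fin (d + 1) → ℝ => gρ (e.symm (Fin.tail z)) (z 0)
          (WeylAmbient.coordVec e (Fin.tail z) i) (WeylAmbient.coordVec e (Fin.tail z) j))
        (WeylAmbient.coordDomain e S.base)) ∧
      (∀ x ρ, (x, ρ) ∈ S.base → ∀ v₁ v₂, gρ x ρ v₁ v₂ = gρ x ρ v₂ v₁) ∧
      (∀ x, gρ x 0 = r.g.form x) ∧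
      -- `aᵢ(x, ρ) = aᵢ(x) + t⁻² ∫₀^ρ Aᵢ(t, x, ρ') dρ'`
      (∀ p ρ, (p, ρ) ∈ S.dom → ∀ w : WeylAmbient.Tan (d + 1) p,
        IntervalIntegrable (fun σ => S.metric p σ (A p σ) (w, 0)) MeasureTheory.volume 0 ρ ∧
        aρ (W.proj p) ρ (W.projT p w) = r.a.form (W.proj p) (W.projT p w) +
          ((W.fibre r p) ^ 2)⁻¹ * ∫ σ in (0 : ℝ)..ρ, S.metric p σ (A p σ) (w, 0)) ∧
      -- the components `g̃_{I∞}` and `g̃ᵢⱼ` have the asserted form everywhere on `M̃`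
      (∀ p ρ, (p, ρ) ∈ S.dom → ∀ w : WeylAmbient.Tan (d + 1) p × ℝ,
        S.metric p ρ w (0, 1) = WeylAmbient.weylAmbientForm W r aρ gρ p ρ w (0, 1)) ∧
      (∀ p ρ, (p, ρ) ∈ S.dom → ∀ w₁ w₂ : WeylAmbient.Tan (d + 1) p,
        W.dt r p w₁ = 0 → W.dt r p w₂ = 0 → S.metric p ρ (w₁, 0) (w₂, 0) =
          WeylAmbient.weylAmbientForm W r aρ gρ p ρ (w₁, 0) (w₂, 0)) ∧
      -- `g̃` has the asserted form to all orders in `ρ` (up to order `d / 2` if `d` is even)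
      (∀ p, ∀ w₁ w₂ : WeylAmbient.Tan (d + 1) p × ℝ, ∀ m : ℕ, (Odd d ∨ 2 * m ≤ d) →
        iteratedDeriv m (fun ρ : ℝ => S.metric p ρ w₁ w₂ -
          WeylAmbient.weylAmbientForm W r aρ gρ p ρ w₁ w₂) 0 = 0) := by
  choose aρ haρ using fun x ρ => S.exists_oneForm hr x ρ
  choose gρ hgρ using fun x ρ => S.exists_bilinForm hr x ρ
  have hvel : ∀ p ρ, (p, ρ) ∈ S.dom → ∀ w : WeylAmbient.Tan (d + 1) p × ℝ,
      S.metric p ρ w (0, 1) = WeylAmbient.weylAmbientForm W r aρ gρ p ρ w (0, 1) := by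
    intro p ρ hp w
    have ht := (W.fibre_pos r hr p).ne'
    have h1 := haρ (W.proj p) ρ p rfl hp (W.hor r p w.1) (W.dt_hor hr w.1) (W.projT p w.1)
      (W.projT_hor hr w.1)
    rw [S.metric_velocity_right r w, hA.metric_velocity hr hp, hA.metric_gen_velocity hr hp]
    simp only [WeylAmbient.weylAmbientForm, map_zero]
    rw [h1]
    field_simp
    ring
  have hhor : ∀ p ρ, (p, ρ) ∈ S.dom → ∀ w₁ w₂ : WeylAmbient.Tan (d + 1) p,
      W.dt r p w₁ = 0 → W.dt r p w₂ = 0 → S.metric p ρ (w₁, 0) (w₂, 0) =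
        (W.fibre r p) ^ 2 * gρ (W.proj p) ρ (W.projT p w₁) (W.projT p w₂) := by
    intro p ρ hp w₁ w₂ h₁ h₂
    have ht := (W.fibre_pos r hr p).ne'
    rw [hgρ (W.proj p) ρ p rfl hp w₁ w₂ h₁ h₂ _ _ rfl rfl]
    field_simp
  refine ⟨aρ, gρ, fun e he i => ?_, fun e he i j => ?_, ?_, ?_, ?_, hvel, ?_, ?_⟩
  · refine S.contDiffOn_base hr he i.succ.succ 0 fun V E h z hz hzd => ?_
    have key := haρ _ (z 0) _ (h.proj_symm hz) hzd _ (h.dt_coordVec_succ hz i) _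
      (h.projT_coordVec_succ hz i)
    rw [h.fibre_symm hz, Fin.cons_zero, Real.exp_zero, one_pow, inv_one, one_mul] at key
    exact key
  · refine S.contDiffOn_base hr he i.succ.succ j.succ.succ fun V E h z hz hzd => ?_
    have key := hgρ _ (z 0) _ (h.proj_symm hz) hzd _ _ (h.dt_coordVec_succ hz i)
      (h.dt_coordVec_succ hz j) _ _ (h.projT_coordVec_succ hz i) (h.projT_coordVec_succ hz j)
    rw [h.fibre_symm hz, Fin.cons_zero, Real.exp_zero, one_pow, inv_one, one_mul] at key
    exact key
  · rintro x ρ ⟨p, rfl, hp⟩ v₁ v₂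
    obtain ⟨L, hL⟩ := W.exists_horizontal_lift hr p
    rw [hgρ _ ρ p rfl hp (L v₁) (L v₂) (hL v₁).1 (hL v₂).1 v₁ v₂ (hL v₁).2 (hL v₂).2,
      hgρ _ ρ p rfl hp (L v₂) (L v₁) (hL v₂).1 (hL v₁).1 v₂ v₁ (hL v₂).2 (hL v₁).2,
      (S.signature p ρ hp).symm]
  · intro x
    obtain ⟨p, rfl⟩ := W.exists_proj_eq x
    obtain ⟨L, hL⟩ := W.exists_horizontal_lift hr p
    refine LinearMap.ext fun v₁ => LinearMap.ext fun v₂ => ?_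
    have ht := (W.fibre_pos r hr p).ne'
    rw [hgρ _ 0 p rfl (S.zero_mem p) (L v₁) (L v₂) (hL v₁).1 (hL v₂).1 v₁ v₂ (hL v₁).2 (hL v₂).2,
      S.pullback, W.metricAt_eq r hr, (hL v₁).2, (hL v₂).2, LinearMap.smul_apply,
      LinearMap.smul_apply, smul_eq_mul]
    field_simp
  · intro p ρ hp w
    obtain ⟨h1, h2⟩ := hA.integral_acceleration hr hp w
    refine ⟨h1, ?_⟩
    have ht := (W.fibre_pos r hr p).ne'
    -- The integral is a difference of `G(∂_ρ, w)` between `ρ` and `0`. The `dt` terms are equal at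
    -- both ends and cancel, and the initial value supplies `aᵢ(x)`.
    rw [h2, (S.signature p ρ hp).symm, hvel p ρ hp, hA.initial]
    simp only [WeylAmbient.weylAmbientForm, map_zero, LinearMap.zero_apply]
    field_simp
    ring
  · intro p ρ hp w₁ w₂ h₁ h₂
    rw [hhor p ρ hp w₁ w₂ h₁ h₂]
    simp [WeylAmbient.weylAmbientForm, h₁]
  · intro p w₁ w₂ m hm
    -- Splitting both vectors into `∂_ρ`, generator and horizontal parts, the difference from the
    -- normal form is a combination of `G(T, T) - 2ρt²` and the `G(T, ·)` on horizontal parts, with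
    -- coefficients constant in `ρ`. The identity is available only near `ρ = 0`, where `(p, ρ)`
    -- lies in the domain.
    refine (Filter.EventuallyEq.iteratedDeriv_eq m ?_).trans
      (hA.iteratedDeriv_eq_zero hd hS hr hm (W.dt_hor hr w₁.1) (W.dt_hor hr w₂.1)
      ((W.dt r p w₁.1 / W.fibre r p) * (W.dt r p w₂.1 / W.fibre r p))
      (W.dt r p w₂.1 / W.fibre r p) (W.dt r p w₁.1 / W.fibre r p))
    have hev : ∀ᶠ ρ in nhds (0 : ℝ), (p, ρ) ∈ S.dom :=
      (Continuous.prodMk_right p).continuousAt (S.isOpen_dom.mem_nhds (S.zero_mem p))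
    filter_upwards [hev] with ρ hp
    have ht := (W.fibre_pos r hr p).ne'
    have h3 := hhor p ρ hp _ _ (W.dt_hor hr w₁.1) (W.dt_hor hr w₂.1)
    rw [W.projT_hor hr, W.projT_hor hr] at h3
    rw [S.metric_split hp, hvel p ρ hp, hvel p ρ hp, S.metric_tangent hp r, h3]
    simp only [WeylAmbient.weylAmbientForm, map_zero]
    field_simp
    ring
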